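/- A biquadratic field is a number field that is Galois over $\mathbb{Q}$ with Galois group isomorphic to $\mathbb{Z}/2\mathbb{Z}\times\mathbb{Z}/2\mathbb{Z}$. Fix an algebraic closure $\overline{\mathbb{Q}}$ of $\mathbb{Q}$. For real $X$, let $B^+(X)$ (respectively $B^-(X)$) denote the number of totally real (respectively totally complex) biquadratic fields $K\subset\overline{\mathbb{Q}}$ with discriminant at most $X$; equivalently, such fields are counted up to isomorphism. Both numbers are finite. Put $c^+=1/4$ and $c^-=3/4$. Then the product $\prod_p\left(1-\frac1p\right)^3\left(1+\frac3p\right)$ over all primes $p$ converges (unconditionally), and for each $\sigma\in\{+,-\}$ and all real $X\ge 2$, \[ B^\sigma(X)=\frac{23\,c^\sigma}{960}\,\sqrt{X}\,(\log X)^2\prod_p\left(\left(1-\frac1p\right)^3\left(1+\frac3p\right)\right)+O\!\left(\sqrt{X}\,\log X\right), \] where the implied constant is absolute. -/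

import Mathlib

/-- A number field `K` is biquadratic if it is Galois over `ℚ` with Galois group the
Klein four-group `ℤ/2 × ℤ/2`. -/
def IsBiquadratic (K : Type*) [Field K] [NumberField K] : Prop :=
  IsGalois ℚ K ∧ IsKleinFour (K ≃ₐ[ℚ] K)

/-- The two possible signs of a biquadratic field. -/
inductive FieldSign : Type
  | plus
  | minus

/-- Sign `+` means totally real, sign `-` means totally complex. -/
def FieldSign.Holds (K : Type*) [Field K] : FieldSign → Prop
  | .plus => NumberField.IsTotallyReal K
  | .minus => NumberField.IsTotallyComplex K

/-- The proportions `c⁺ = 1/4` and `c⁻ = 3/4`. -/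
noncomputable def FieldSign.c : FieldSign → ℝ
  | .plus => 1 / 4
  | .minus => 3 / 4

/-- The set of biquadratic fields of sign `σ` and discriminant at most `X`, inside a fixed
algebraic closure of `ℚ`. (These fields are Galois over `ℚ`, so isomorphic ones coincide there.) -/
def biquadraticFields (σ : FieldSign) (X : ℝ) : Set (IntermediateField ℚ (AlgebraicClosure ℚ)) :=
  {K | ∃ _ : NumberField K,
    IsBiquadratic K ∧ FieldSign.Holds K σ ∧ (NumberField.discr K : ℝ) ≤ X}

/-- The number `B^σ(X)` of biquadratic fields of sign `σ` and discriminant at most `X`. -/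
noncomputable def biquadraticCount (σ : FieldSign) (X : ℝ) : ℕ :=
  (biquadraticFields σ X).ncard

/-- The Euler factor `(1 - 1/p)^3 (1 + 3/p)`. -/
noncomputable def eulerFactor (p : Nat.Primes) : ℝ :=
  (1 - 1 / (p : ℝ)) ^ 3 * (1 + 3 / (p : ℝ))

/-! A biquadratic field has three quadratic subfields. Taking `c` to be the positive gcd of two of
their squarefree radicands writes all three as `b c`, `a c`, `a b` with `a b c` squarefree. Such a
triple with `c > 0` amounts to an ordered pair of distinct quadratic subfields, so each field has
exactly six triples (`GeneratedBy.ncard_triples`). Explicit integral bases show that the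
discriminant is `(f a b c) ^ 2`, where `f ∈ {1, 4, 8}` depends only on `a, b, c` modulo 4
(`BiquadGen.discr`); the field is totally real exactly when `a, b > 0`, and totally complex
otherwise.

It remains to count, for each sign pattern of `(a, b)`, the triples with `f |a b c| ≤ √X`. At most
one entry is even; once the factor 2 is removed, the residues modulo 4 of the odd entries are
detected by the character `χ₄`. This leaves sums over odd squarefree `n` of threefold convolutions
(`card_signedSet`). With three trivial characters, the convolution is `ζ * ζ * ζ` times a correction
whose Dirichlet series converges absolutely to the left of `1`, whence a main term of order `Y (log
Y) ^ 2` with the Euler product as constant. With two copies of `χ₄`, bounded character sums leave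
only `O(Y (1 + log Y))`.

Let `P` be the Euler product. The odd sum is asymptotic to `(P / 5) Y (log Y) ^ 2`, the factor at 2
having lost `2 / 5` and the threefold divisor problem contributing `1 / 2`. The thresholds `Y, Y/4,
Y/8, Y/16` carry weights `1, 3, 6, 6` over 4, which gives `(1 + 3/4 + 6/8 + 6/16) / 4 = 23 / 32` and
hence `23 / 160` per sign pattern. There are `4 c^σ` patterns; dividing by 6 and using `log √X =
(log X) / 2` yields `23 c^σ / 960`. -/

/-! ### Square-root generators: independence, multiplication, conjugations -/

theorem eq_one_of_squarefree_of_rat_sq {d : ℤ} (hd : Squarefree d) {r : ℚ} (h : r ^ 2 = d) :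
    d = 1 := by
  have hi : IsIntegral ℤ r := by
    refine IsIntegral.of_pow (n := 2) two_pos ?_
    rw [h]
    exact isIntegral_algebraMap (R := ℤ) (A := ℚ) (x := d)
  obtain ⟨n, rfl⟩ := IsIntegrallyClosed.isIntegral_iff.mp hi
  have h' : n ^ 2 = d := by
    have : ((n : ℚ)) ^ 2 = d := by simpa using h
    exact_mod_cast this
  have hu : IsUnit n := hd n ⟨1, by rw [← h']; ring⟩
  rcases Int.isUnit_iff.mp hu with rfl | rfl <;> simpa using h'.symm

/-- Square roots `x, y, z` of `b c`, `a c`, `a b` with compatible signs, for `a b c` squarefree. -/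
structure BiquadGen {K : Type*} [Field K] (a b c : ℤ) (x y z : K) : Prop where
  xx : x ^ 2 = b * c
  yy : y ^ 2 = a * c
  zz : z ^ 2 = a * b
  xy : x * y = c * z
  xz : x * z = b * y
  yz : y * z = a * x
  sqf : Squarefree (a * b * c)
  hx : b * c ≠ 1
  hy : a * c ≠ 1
  hz : a * b ≠ 1

namespace BiquadGen

variable {K : Type*} [Field K] {a b c : ℤ} {x y z : K}

theorem rotate (h : BiquadGen a b c x y z) : BiquadGen b c a y z x where
  xx := by rw [h.yy]; ring
  yy := by rw [h.zz]; ring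
  zz := h.xx
  xy := h.yz
  xz := by rw [← h.xy]; ring
  yz := by rw [← h.xz]; ring
  sqf := by have := h.sqf; rwa [show b * c * a = a * b * c by ring]
  hx := by rw [mul_comm]; exact h.hy
  hy := by rw [mul_comm]; exact h.hz
  hz := h.hx

theorem neg (h : BiquadGen a b c x y z) : BiquadGen (-a) (-b) (-c) (-x) (-y) (-z) where
  xx := by push_cast; rw [neg_sq, h.xx]; ring
  yy := by push_cast; rw [neg_sq, h.yy]; ring
  zz := by push_cast; rw [neg_sq, h.zz]; ring
  xy := by push_cast; rw [neg_mul_neg, neg_mul_neg, h.xy]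
  xz := by push_cast; rw [neg_mul_neg, neg_mul_neg, h.xz]
  yz := by push_cast; rw [neg_mul_neg, neg_mul_neg, h.yz]
  sqf := by
    have := h.sqf
    rw [show -a * -b * -c = -(a * b * c) by ring]
    exact this.squarefree_of_dvd (neg_dvd.mpr dvd_rfl)
  hx := by rw [neg_mul_neg]; exact h.hx
  hy := by rw [neg_mul_neg]; exact h.hy
  hz := by rw [neg_mul_neg]; exact h.hz

theorem sqfX (h : BiquadGen a b c x y z) : Squarefree (b * c) :=
  h.sqf.squarefree_of_dvd ⟨a, by ring⟩

theorem sqfY (h : BiquadGen a b c x y z) : Squarefree (a * c) :=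
  h.sqf.squarefree_of_dvd ⟨b, by ring⟩

theorem sqfZ (h : BiquadGen a b c x y z) : Squarefree (a * b) :=
  h.sqf.squarefree_of_dvd ⟨c, by ring⟩

theorem a_ne_zero (h : BiquadGen a b c x y z) : a ≠ 0 := by
  rintro rfl; simpa using h.sqf.ne_zero

theorem b_ne_zero (h : BiquadGen a b c x y z) : b ≠ 0 := h.rotate.a_ne_zero

theorem c_ne_zero (h : BiquadGen a b c x y z) : c ≠ 0 := h.rotate.rotate.a_ne_zero

variable [CharZero K]

theorem eq_zero_of_add_mul (h : BiquadGen a b c x y z) {p q : ℚ} (e : (p : K) + q * x = 0) :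
    p = 0 ∧ q = 0 := by
  have hq : q = 0 := by
    by_contra hq
    have hq' : (q : K) ≠ 0 := by exact_mod_cast hq
    have hx : x = ((-p / q : ℚ) : K) := by
      push_cast
      field_simp
      linear_combination e
    have := h.xx
    rw [hx] at this
    have h2 : (-p / q) ^ 2 = ((b * c : ℤ) : ℚ) := by
      push_cast
      exact_mod_cast this
    exact h.hx (eq_one_of_squarefree_of_rat_sq h.sqfX h2)
  subst hq
  refine ⟨?_, rfl⟩
  simpa using e

/-- None of `b c`, `a c`, `a b` is a rational square, so `x` is irrational and `y` does not lie in
`ℚ + ℚ x`. -/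
theorem eq_zero_of_comb (h : BiquadGen a b c x y z) {p q r s : ℚ}
    (e : (p : K) + q * x + r * y + s * z = 0) : p = 0 ∧ q = 0 ∧ r = 0 ∧ s = 0 := by
  have hcK : (c : K) ≠ 0 := by exact_mod_cast h.c_ne_zero
  by_cases hrs : r = 0 ∧ s = 0
  · obtain ⟨rfl, rfl⟩ := hrs
    have := h.eq_zero_of_add_mul (p := p) (q := q) (by simpa using e)
    exact ⟨this.1, this.2, rfl, rfl⟩
  exfalso
  -- Since `c z = x y`, multiplying the relation by `c` gives `(c p + c q x) + (c r + s x) y = 0`.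
  -- Here `N` is the norm of `c r + s x`, nonzero because `b c` is not a rational square.
  set N : ℚ := (c * r) ^ 2 - s ^ 2 * (b * c) with hN
  have hN0 : N ≠ 0 := by
    intro h0
    have hs : s ≠ 0 := by
      rintro rfl
      apply hrs
      have : (c : ℚ) ≠ 0 := by exact_mod_cast h.c_ne_zero
      simp [hN, this] at h0
      exact ⟨h0, rfl⟩
    refine h.hx (eq_one_of_squarefree_of_rat_sq h.sqfX (r := c * r / s) ?_)
    push_cast
    field_simp
    linear_combination h0
  have hNK : (N : K) ≠ 0 := by exact_mod_cast hN0
  have hy : (N : K) * y = ((-c * p * (c * r) + c * q * s * (b * c) : ℚ) : K)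
      + ((c * p * s - c * q * (c * r) : ℚ) : K) * x := by
    rw [hN]
    push_cast
    linear_combination (c * (c * r - s * x) : K) * e + (s * (c * r - s * x) : K) * h.xy
      + (c * q * s + s ^ 2 * y : K) * h.xx
  set t : ℚ := (c * p * s - c * q * (c * r)) / N with ht
  set u : ℚ := (-c * p * (c * r) + c * q * s * (b * c)) / N with hu
  have hy' : y = u + t * x := by
    have e1 : (u : K) = ((-c * p * (c * r) + c * q * s * (b * c) : ℚ) : K) / N := by
      rw [hu]; push_cast; rfl
    have e2 : (t : K) = ((c * p * s - c * q * (c * r) : ℚ) : K) / N := by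
      rw [ht]; push_cast; rfl
    rw [e1, e2, ← mul_right_inj' hNK, hy, mul_add, mul_div_cancel₀ _ hNK, ← mul_assoc (N : K),
      mul_div_cancel₀ _ hNK]
  -- Squaring `y = u + t x` and comparing coefficients gives `u t = 0`: either `y = t x`, making `a
  -- b` a square, or `y = u`, making `a c` a square.
  have h2 := h.yy
  rw [hy'] at h2
  have h3 := h.eq_zero_of_add_mul (p := u ^ 2 + t ^ 2 * (b * c) - a * c) (q := 2 * u * t) (by
    push_cast
    linear_combination h2 - (t ^ 2 : K) * h.xx)
  have h4 : u = 0 ∨ t = 0 := by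
    have := h3.2
    simpa using this
  rcases h4 with h4 | h4
  · refine h.hz (eq_one_of_squarefree_of_rat_sq h.sqfZ (r := t * b) ?_)
    have h5 := h3.1
    rw [h4] at h5
    have hc : (c : ℚ) ≠ 0 := by exact_mod_cast h.c_ne_zero
    push_cast
    apply mul_left_cancel₀ hc
    linear_combination b * h5
  · refine h.hy (eq_one_of_squarefree_of_rat_sq h.sqfY (r := u) ?_)
    have h5 := h3.1
    rw [h4] at h5
    push_cast
    linear_combination h5

theorem linearIndependent (h : BiquadGen a b c x y z) :
    LinearIndependent ℚ ![1, x, y, z] := by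
  rw [Fintype.linearIndependent_iff]
  intro g hg
  simp only [Fin.sum_univ_four, Matrix.cons_val, Rat.smul_def] at hg
  have := h.eq_zero_of_comb (p := g 0) (q := g 1) (r := g 2) (s := g 3) (by
    linear_combination hg)
  intro i
  fin_cases i
  exacts [this.1, this.2.1, this.2.2.1, this.2.2.2]

/-- The basis `1, x, y, z` of a field of degree four. -/
noncomputable def basis (h : BiquadGen a b c x y z) (hK : Module.finrank ℚ K = 4) :
    Module.Basis (Fin 4) ℚ K :=
  basisOfLinearIndependentOfCardEqFinrank h.linearIndependent (by simp [hK])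

theorem coe_basis (h : BiquadGen a b c x y z) (hK : Module.finrank ℚ K = 4) :
    ⇑(h.basis hK) = ![1, x, y, z] := by
  simp [basis]

theorem exists_coord (h : BiquadGen a b c x y z) (hK : Module.finrank ℚ K = 4) (w : K) :
    ∃ p q r s : ℚ, w = p + q * x + r * y + s * z := by
  have := (h.basis hK).sum_repr w
  rw [Fin.sum_univ_four, h.coe_basis hK] at this
  simp only [Matrix.cons_val, Rat.smul_def] at this
  rw [mul_one] at this
  exact ⟨_, _, _, _, this.symm⟩

/-- The automorphism fixing `x` and changing the signs of `y` and `z`. -/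
theorem exists_conj (h : BiquadGen a b c x y z) (hK : Module.finrank ℚ K = 4) :
    ∃ σ : K →ₐ[ℚ] K, σ x = x ∧ σ y = -y ∧ σ z = -z := by
  let T : K →ₗ[ℚ] K := (h.basis hK).constr ℚ ![1, x, -y, -z]
  have hb := h.coe_basis hK
  have T1 : T 1 = 1 := by
    have := (h.basis hK).constr_basis ℚ ![1, x, -y, -z] 0
    rwa [hb] at this
  have Tx : T x = x := by
    have := (h.basis hK).constr_basis ℚ ![1, x, -y, -z] 1
    rwa [hb] at this
  have Ty : T y = -y := by
    have := (h.basis hK).constr_basis ℚ ![1, x, -y, -z] 2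
    rwa [hb] at this
  have Tz : T z = -z := by
    have := (h.basis hK).constr_basis ℚ ![1, x, -y, -z] 3
    rwa [hb] at this
  have hT : ∀ p q r s : ℚ, T (p + q * x + r * y + s * z) = p + q * x - r * y - s * z := by
    intro p q r s
    have : (p + q * x + r * y + s * z : K) = p • (1 : K) + q • x + r • y + s • z := by
      simp [Rat.smul_def]
    rw [this, map_add, map_add, map_add, map_smul, map_smul, map_smul, map_smul, T1, Tx, Ty, Tz]
    simp only [Rat.smul_def]
    ring
  refine ⟨AlgHom.ofLinearMap T T1 ?_, Tx, Ty, Tz⟩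
  intro w w'
  obtain ⟨p, q, r, s, rfl⟩ := h.exists_coord hK w
  obtain ⟨p', q', r', s', rfl⟩ := h.exists_coord hK w'
  -- The basis is graded by the Klein four-group, and the sign change is a character of that group;
  -- comparing the product coordinatewise therefore gives multiplicativity.
  have e : (p + q * x + r * y + s * z : K) * (p' + q' * x + r' * y + s' * z)
      = ((p * p' + q * q' * (b * c) + r * r' * (a * c) + s * s' * (a * b) : ℚ) : K)
        + ((p * q' + q * p' + (r * s' + s * r') * a : ℚ) : K) * x
        + ((p * r' + r * p' + (q * s' + s * q') * b : ℚ) : K) * y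
        + ((p * s' + s * p' + (q * r' + r * q') * c : ℚ) : K) * z := by
    push_cast
    linear_combination (q * q' : K) * h.xx + (r * r' : K) * h.yy + (s * s' : K) * h.zz
      + (q * r' + r * q' : K) * h.xy + (q * s' + s * q' : K) * h.xz
      + (r * s' + s * r' : K) * h.yz
  rw [e, hT, hT, hT]
  push_cast
  linear_combination -(q * q' : K) * h.xx - (r * r' : K) * h.yy - (s * s' : K) * h.zz
      + (q * r' + r * q' : K) * h.xy + (q * s' + s * q' : K) * h.xz
      - (r * s' + s * r' : K) * h.yz

end BiquadGen

/-! ### Integrality constraints from relative traces and norms -/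

theorem exists_int_of_isIntegral_ratCast {K : Type*} [Field K] [CharZero K] {r : ℚ}
    (h : IsIntegral ℤ (r : K)) : ∃ n : ℤ, r = n := by
  have h' : IsIntegral ℤ (algebraMap ℚ K r) := by simpa using h
  rw [isIntegral_algebraMap_iff (algebraMap ℚ K).injective] at h'
  obtain ⟨n, hn⟩ := IsIntegrallyClosed.isIntegral_iff.mp h'
  exact ⟨n, by simpa using hn.symm⟩

namespace BiquadGen

variable {K : Type*} [Field K] [CharZero K] {a b c : ℤ} {x y z : K}

/-- The trace `2 r` and the norm `r ^ 2 - s ^ 2 b c` from `ℚ(x)` are integers. Hence `b c (2 s) ^ 2`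
is an integer, and squarefreeness of `b c` clears the denominator of `2 s`. -/
theorem exists_half_int (h : BiquadGen a b c x y z) (hK : Module.finrank ℚ K = 4) {r s : ℚ}
    (hi : IsIntegral ℤ ((r : K) + s * x)) :
    ∃ R S : ℤ, r = R / 2 ∧ s = S / 2 ∧ 4 ∣ R ^ 2 - b * c * S ^ 2 := by
  obtain ⟨σ, -, -, hσ⟩ := h.rotate.exists_conj hK
  have hi' := hi.map (σ.restrictScalars ℤ)
  have e : (σ.restrictScalars ℤ) ((r : K) + s * x) = r - s * x := by
    simp [hσ, sub_eq_add_neg]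
  rw [e] at hi'
  obtain ⟨R, hR⟩ := exists_int_of_isIntegral_ratCast (K := K) (r := 2 * r) (by
    have e' : ((2 * r : ℚ) : K) = (r + s * x) + (r - s * x) := by push_cast; ring
    rw [e']
    exact hi.add hi')
  obtain ⟨m, hm⟩ := exists_int_of_isIntegral_ratCast (K := K) (r := r ^ 2 - s ^ 2 * (b * c)) (by
    have e' : ((r ^ 2 - s ^ 2 * (b * c) : ℚ) : K) = (r + s * x) * (r - s * x) := by
      push_cast
      linear_combination (s ^ 2 : K) * h.xx
    rw [e']
    exact hi.mul hi')
  have key : (b * c : ℤ) * (2 * s) ^ 2 = ((R ^ 2 - 4 * m : ℤ) : ℚ) := by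
    push_cast
    linear_combination (2 * r + R) * hR - 4 * hm
  -- `2 s` is an integer because `b c` is squarefree
  have hden : ∃ S : ℤ, 2 * s = S := by
    set t := 2 * s with ht
    have hd : (b * c) * t.num ^ 2 = (R ^ 2 - 4 * m) * (t.den : ℤ) ^ 2 := by
      have hden0 : (t.den : ℚ) ≠ 0 := by exact_mod_cast t.den_nz
      have : ((b * c * t.num ^ 2 : ℤ) : ℚ) = ((R ^ 2 - 4 * m) * (t.den : ℤ) ^ 2 : ℤ) := by
        rw [← Rat.num_div_den t] at key
        push_cast at key ⊢
        field_simp at key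
        linear_combination key
      exact_mod_cast this
    have hcop : IsCoprime ((t.den : ℤ) ^ 2) (t.num ^ 2) := by
      apply IsCoprime.pow
      rw [Int.isCoprime_iff_gcd_eq_one, Int.gcd_comm]
      simpa [Int.gcd, Nat.Coprime] using t.reduced
    have hdvd : (t.den : ℤ) * t.den ∣ b * c := by
      rw [← sq]
      exact hcop.dvd_of_dvd_mul_right ⟨R ^ 2 - 4 * m, by rw [hd]; ring⟩
    have hu := Int.isUnit_iff.mp (h.sqfX _ hdvd)
    have h1 : t.den = 1 := by omega
    exact ⟨t.num, by rw [← Rat.den_eq_one_iff t |>.mp h1]; simp⟩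
  obtain ⟨S, hS⟩ := hden
  refine ⟨R, S, by linear_combination hR / 2, by linear_combination hS / 2, m, ?_⟩
  rw [hS] at key
  have : ((b * c * S ^ 2 : ℤ) : ℚ) = (R ^ 2 - 4 * m : ℤ) := by
    rw [← key]; push_cast; ring
  have := Int.cast_injective this
  linarith

/-- The relative trace to `ℚ(x)` is the integral element `2 p + 2 q x`, to which `exists_half_int`
applies. -/
theorem exists_trace (h : BiquadGen a b c x y z) (hK : Module.finrank ℚ K = 4) {p q r s : ℚ}
    (hi : IsIntegral ℤ ((p : K) + q * x + r * y + s * z)) :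
    ∃ R S : ℤ, p = R / 4 ∧ q = S / 4 ∧ 4 ∣ R ^ 2 - b * c * S ^ 2 := by
  obtain ⟨σ, h1, h2, h3⟩ := h.exists_conj hK
  have hi' := hi.map (σ.restrictScalars ℤ)
  have e : (σ.restrictScalars ℤ) ((p : K) + q * x + r * y + s * z) = p + q * x - r * y - s * z := by
    simp [h1, h2, h3]
    ring
  rw [e] at hi'
  obtain ⟨R, S, hR, hS, hd⟩ := h.exists_half_int hK (r := 2 * p) (s := 2 * q) (by
    have e' : ((2 * p : ℚ) : K) + (2 * q : ℚ) * x
        = ((p : K) + q * x + r * y + s * z) + (p + q * x - r * y - s * z) := by push_cast; ring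
    rw [e']
    exact hi.add hi')
  exact ⟨R, S, by linear_combination hR / 2, by linear_combination hS / 2, hd⟩

/-- The same argument for the relative norm to `ℚ(x)`. It supplies the congruences that the traces
miss. -/
theorem exists_norm (h : BiquadGen a b c x y z) (hK : Module.finrank ℚ K = 4) {p q r s : ℚ}
    (hi : IsIntegral ℤ ((p : K) + q * x + r * y + s * z)) :
    ∃ R S : ℤ, p ^ 2 + q ^ 2 * (b * c) - r ^ 2 * (a * c) - s ^ 2 * (a * b) = R / 2 ∧
      2 * p * q - 2 * r * s * a = S / 2 ∧ 4 ∣ R ^ 2 - b * c * S ^ 2 := by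
  obtain ⟨σ, h1, h2, h3⟩ := h.exists_conj hK
  have hi' := hi.map (σ.restrictScalars ℤ)
  have e : (σ.restrictScalars ℤ) ((p : K) + q * x + r * y + s * z) = p + q * x - r * y - s * z := by
    simp [h1, h2, h3]
    ring
  rw [e] at hi'
  exact h.exists_half_int hK (by
    have e' : ((p ^ 2 + q ^ 2 * (b * c) - r ^ 2 * (a * c) - s ^ 2 * (a * b) : ℚ) : K)
        + ((2 * p * q - 2 * r * s * a : ℚ) : K) * x
        = ((p : K) + q * x + r * y + s * z) * (p + q * x - r * y - s * z) := by
      push_cast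
      linear_combination (-q ^ 2 : K) * h.xx + (r ^ 2 : K) * h.yy + (s ^ 2 : K) * h.zz
      + (2 * r * s : K) * h.yz
    rw [e']
    exact hi.mul hi')

end BiquadGen

/-! ### The discriminant from an explicit integral basis -/

open NumberField in
theorem NumberField.discr_eq_of_integral_spanning {K : Type*} [Field K] [NumberField K]
    {ι : Type*} [Fintype ι] [DecidableEq ι] (v : ι → K) (hv : ∀ i, IsIntegral ℤ (v i))
    (hd : Algebra.discr ℚ v ≠ 0)
    (hs : ∀ w : K, IsIntegral ℤ w → ∃ n : ι → ℤ, w = ∑ i, (n i : K) * v i) :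
    (discr K : ℚ) = Algebra.discr ℚ v := by
  have hli : LinearIndependent ℚ v := by
    by_contra hc
    exact hd (Algebra.discr_zero_of_not_linearIndependent ℚ hc)
  let u : ι → 𝓞 K := fun i => ⟨v i, hv i⟩
  have hu : ∀ i, (u i : K) = v i := fun i => rfl
  have hliZ : LinearIndependent ℤ v := hli.restrict_scalars' ℤ
  have hliu : LinearIndependent ℤ u := by
    apply LinearIndependent.of_comp ((Algebra.linearMap (𝓞 K) K).restrictScalars ℤ)
    exact hliZ
  have hsp : ⊤ ≤ Submodule.span ℤ (Set.range u) := by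
    intro w _
    obtain ⟨n, hn⟩ := hs w w.2
    have : w = ∑ i, n i • u i := by
      apply RingOfIntegers.ext
      rw [hn]
      refine Eq.trans ?_ (map_sum (algebraMap (𝓞 K) K) (fun i => n i • u i) Finset.univ).symm
      refine Finset.sum_congr rfl fun i _ => ?_
      rw [zsmul_eq_mul, map_mul, map_intCast]
      rfl
    rw [this]
    exact Submodule.sum_mem _ fun i _ => Submodule.smul_mem _ _ (Submodule.subset_span ⟨i, rfl⟩)
  let B := Module.Basis.mk hliu hsp
  rw [← discr_eq_discr K B]
  have h1 := Algebra.discr_localizationLocalization ℤ (nonZeroDivisors ℤ) K B (Rₘ := ℚ)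
  have h2 : ⇑(B.localizationLocalization ℚ (nonZeroDivisors ℤ) K) = v := by
    ext i
    rw [Module.Basis.localizationLocalization_apply, Module.Basis.mk_apply]
    rfl
  rw [h2] at h1
  rw [h1]
  rfl

namespace BiquadGen

open Matrix

variable {K : Type*} [Field K] [NumberField K] {a b c : ℤ} {x y z : K}

theorem trace_eq_zero (h : BiquadGen a b c x y z) (hK : Module.finrank ℚ K = 4) :
    Algebra.trace ℚ K y = 0 := by
  obtain ⟨σ, -, h2, -⟩ := h.exists_conj hK
  have := Algebra.trace_eq_of_algEquiv (AlgEquiv.ofBijective σ (Algebra.IsAlgebraic.algHom_bijective σ)) y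
  simp only [AlgEquiv.coe_ofBijective, h2, map_neg] at this
  linarith

theorem trace_mul_intCast {n : ℤ} (w : K) :
    Algebra.trace ℚ K (n * w) = n * Algebra.trace ℚ K w := by
  have : (n : K) * w = n • w := by simp
  rw [this, map_zsmul]
  simp

/-- The product of two distinct basis elements is an integer multiple of one of `x, y, z`, which
have trace zero; the trace matrix is therefore diagonal. -/
theorem discr_gens (h : BiquadGen a b c x y z) (hK : Module.finrank ℚ K = 4) :
    Algebra.discr ℚ ![1, x, y, z] = 256 * (a * b * c) ^ 2 := by
  have ty := h.trace_eq_zero hK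
  have tz := h.rotate.trace_eq_zero hK
  have tx := h.rotate.rotate.trace_eq_zero hK
  have t1 : Algebra.trace ℚ K 1 = 4 := by
    have := Algebra.trace_algebraMap (S := K) (1 : ℚ)
    simpa [hK] using this
  have ti : ∀ n : ℤ, Algebra.trace ℚ K n = n * 4 := by
    intro n
    have := trace_mul_intCast (n := n) (1 : K)
    rwa [mul_one, t1] at this
  have xx : x * x = ((b * c : ℤ) : K) := by push_cast; rw [← h.xx]; ring
  have yy : y * y = ((a * c : ℤ) : K) := by push_cast; rw [← h.yy]; ring
  have zz : z * z = ((a * b : ℤ) : K) := by push_cast; rw [← h.zz]; ring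
  have : Algebra.traceMatrix ℚ ![1, x, y, z]
      = Matrix.diagonal ![4, ((b * c : ℤ) : ℚ) * 4, ((a * c : ℤ) : ℚ) * 4,
        ((a * b : ℤ) : ℚ) * 4] := by
    ext i j
    rw [Algebra.traceMatrix_apply, Algebra.traceForm_apply]
    fin_cases i <;> fin_cases j <;>
      simp [-Int.cast_mul, t1, tx, ty, tz, h.xy, h.xz, h.yz, mul_comm y x, mul_comm z x,
        mul_comm z y, trace_mul_intCast, xx, yy, zz, ti]
  rw [Algebra.discr_def, this, Matrix.det_diagonal, Fin.prod_univ_four]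
  simp
  ring

/-- The rows of `M` are the coordinates of a proposed integral basis. Each case below then only has
to check integrality of the rows and express the coordinates of integers through them. -/
theorem discr_eq_of_matrix (h : BiquadGen a b c x y z) (hK : Module.finrank ℚ K = 4)
    (M : Matrix (Fin 4) (Fin 4) ℚ) (hM : M.det ≠ 0)
    (hint : ∀ i, IsIntegral ℤ ((M i 0 : K) + M i 1 * x + M i 2 * y + M i 3 * z))
    (hs : ∀ p q r s : ℚ, IsIntegral ℤ ((p : K) + q * x + r * y + s * z) →
      ∃ n : Fin 4 → ℤ, p = ∑ i, n i * M i 0 ∧ q = ∑ i, n i * M i 1 ∧ r = ∑ i, n i * M i 2 ∧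
        s = ∑ i, n i * M i 3) :
    (NumberField.discr K : ℚ) = M.det ^ 2 * (256 * (a * b * c) ^ 2) := by
  set v : Fin 4 → K := fun i => (M i 0 : K) + M i 1 * x + M i 2 * y + M i 3 * z with hv
  have hvM : v = M.map (algebraMap ℚ K) *ᵥ ![1, x, y, z] := by
    ext i
    simp [hv, Matrix.mulVec, dotProduct, Fin.sum_univ_four]
  have hD : Algebra.discr ℚ v = M.det ^ 2 * (256 * (a * b * c) ^ 2) := by
    rw [hvM, Algebra.discr_of_matrix_mulVec, h.discr_gens hK]
  rw [← hD]
  refine NumberField.discr_eq_of_integral_spanning v hint ?_ ?_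
  · rw [hD]
    have : ((a * b * c : ℤ) : ℚ) ≠ 0 := by exact_mod_cast h.sqf.ne_zero
    push_cast at this
    positivity
  · intro w hw
    obtain ⟨p, q, r, s, rfl⟩ := h.exists_coord hK w
    obtain ⟨n, h1, h2, h3, h4⟩ := hs p q r s hw
    refine ⟨n, ?_⟩
    simp only [hv, Fin.sum_univ_four] at *
    rw [h1, h2, h3, h4]
    push_cast
    ring

end BiquadGen

/-! ### Integral bases according to residues modulo 4 -/

theorem four_dvd_iff_zmod {n : ℤ} : 4 ∣ n ↔ (n : ZMod 4) = 0 :=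
  (ZMod.intCast_zmod_eq_zero_iff_dvd n 4).symm

/-- Parity is read off inside `ZMod 4`, so that the congruence arguments below become finite checks.
-/
theorem two_dvd_of_zmod_four {n : ℤ} (h : 2 * (n : ZMod 4) = 0) : 2 ∣ n := by
  have : ((2 * n : ℤ) : ZMod 4) = 0 := by push_cast; exact h
  have := four_dvd_iff_zmod.mpr this
  omega

theorem two_dvd_sub_of_one {d R S : ℤ} (hd : (d : ZMod 4) = 1) (h : 4 ∣ R ^ 2 - d * S ^ 2) :
    2 ∣ R - S := by
  apply two_dvd_of_zmod_four
  have h := four_dvd_iff_zmod.mp h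
  push_cast at h ⊢
  rw [hd] at h
  revert h
  generalize (R : ZMod 4) = R
  generalize (S : ZMod 4) = S
  revert R S
  decide

theorem two_dvd_of_two_or_three {d R S : ℤ} (hd : (d : ZMod 4) = 2 ∨ (d : ZMod 4) = 3)
    (h : 4 ∣ R ^ 2 - d * S ^ 2) : 2 ∣ R ∧ 2 ∣ S := by
  have : 2 * (R : ZMod 4) = 0 ∧ 2 * (S : ZMod 4) = 0 := by
    have h := four_dvd_iff_zmod.mp h
    push_cast at h
    revert h hd
    generalize (R : ZMod 4) = R
    generalize (S : ZMod 4) = S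
    generalize (d : ZMod 4) = d
    revert R S d
    decide
  exact ⟨two_dvd_of_zmod_four this.1, two_dvd_of_zmod_four this.2⟩

namespace BiquadGen

theorem isIntegral_x {K : Type*} [Field K] {a b c : ℤ} {x y z : K}
    (h : BiquadGen a b c x y z) : IsIntegral ℤ x := by
  refine IsIntegral.of_pow (n := 2) two_pos ?_
  rw [h.xx]
  exact_mod_cast isIntegral_algebraMap (R := ℤ) (A := K) (x := b * c)

theorem isIntegral_intCast {K : Type*} [Field K] (n : ℤ) : IsIntegral ℤ (n : K) :=
  isIntegral_algebraMap (R := ℤ) (A := K) (x := n)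

theorem isIntegral_half {K : Type*} [Field K] [CharZero K] {a b c : ℤ} {x y z : K}
    (h : BiquadGen a b c x y z) (h1 : ((b * c : ℤ) : ZMod 4) = 1) :
    IsIntegral ℤ ((1 + x) / 2) := by
  have : 4 ∣ b * c - 1 := by rw [four_dvd_iff_zmod]; push_cast at h1 ⊢; rw [h1]; ring
  obtain ⟨m, hm⟩ := this
  refine ⟨Polynomial.X ^ 2 - Polynomial.X - Polynomial.C m, ?_, ?_⟩
  · monicity!
  · have hm' : (b * c - 1 : K) = 4 * m := by exact_mod_cast congrArg (Int.cast (R := K)) hm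
    simp only [Polynomial.eval₂_sub, Polynomial.eval₂_pow, Polynomial.eval₂_X, Polynomial.eval₂_C]
    simp only [algebraMap_int_eq, eq_intCast]
    linear_combination h.xx / 4 + hm' / 4

variable {K : Type*} [Field K] [NumberField K] {a b c : ℤ} {x y z : K}

/-- Writing `c = 1 + 4 m`, the element equals `((1 + x) / 2) ((1 + y) / 2) - m z`. -/
theorem isIntegral_quarter (h : BiquadGen a b c x y z)
    (ha : (a : ZMod 4) = 1) (hb : (b : ZMod 4) = 1) (hc : (c : ZMod 4) = 1) :
    IsIntegral ℤ ((1 + x + y + z) / 4) := by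
  have hbc : ((b * c : ℤ) : ZMod 4) = 1 := by push_cast; rw [hb, hc]; rfl
  have hca : ((c * a : ℤ) : ZMod 4) = 1 := by push_cast; rw [hc, ha]; rfl
  have : 4 ∣ c - 1 := by rw [four_dvd_iff_zmod]; push_cast; rw [hc]; ring
  obtain ⟨m, hm⟩ := this
  have hm' : (c - 1 : K) = 4 * m := by exact_mod_cast congrArg (Int.cast (R := K)) hm
  refine Eq.subst (motive := IsIntegral ℤ) ?_
    (((h.isIntegral_half hbc).mul (h.rotate.isIntegral_half hca)).sub
      ((isIntegral_intCast m).mul h.rotate.rotate.isIntegral_x))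
  linear_combination h.xy / 4 + z / 4 * hm'

theorem discr_of_one (h : BiquadGen a b c x y z) (hK : Module.finrank ℚ K = 4)
    (ha : (a : ZMod 4) = 1) (hb : (b : ZMod 4) = 1) (hc : (c : ZMod 4) = 1) :
    NumberField.discr K = (a * b * c) ^ 2 := by
  have hbc : ((b * c : ℤ) : ZMod 4) = 1 := by push_cast; rw [hb, hc]; rfl
  have hca : ((c * a : ℤ) : ZMod 4) = 1 := by push_cast; rw [hc, ha]; rfl
  have hab : ((a * b : ℤ) : ZMod 4) = 1 := by push_cast; rw [ha, hb]; rfl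
  have hq := h.isIntegral_quarter ha hb hc
  have hdet : Matrix.det !![(1 : ℚ), 0, 0, 0; 1/2, 1/2, 0, 0; 1/2, 0, 1/2, 0; 1/4, 1/4, 1/4, 1/4]
      = 1 / 16 := by
    simp [Matrix.det_succ_row_zero, Fin.sum_univ_succ]
    norm_num
  have key := h.discr_eq_of_matrix hK
    !![1, 0, 0, 0; 1/2, 1/2, 0, 0; 1/2, 0, 1/2, 0; 1/4, 1/4, 1/4, 1/4] ?_ ?_ ?_
  · rw [hdet] at key
    have : (NumberField.discr K : ℚ) = ((a * b * c) ^ 2 : ℤ) := by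
      rw [key]; push_cast; ring
    exact_mod_cast this
  · rw [hdet]; norm_num
  · intro i
    fin_cases i
    · simpa using isIntegral_one
    · refine Eq.subst (motive := IsIntegral ℤ) ?_ (h.isIntegral_half hbc)
      simp; ring
    · refine Eq.subst (motive := IsIntegral ℤ) ?_ (h.rotate.isIntegral_half hca)
      simp; ring
    · refine Eq.subst (motive := IsIntegral ℤ) ?_ hq
      simp; ring
  · intro p q r s hi
    obtain ⟨P, Q, rfl, rfl, d1⟩ := h.exists_trace hK hi
    obtain ⟨P', R, e1, rfl, d2⟩ := h.rotate.exists_trace hK (p := P / 4) (q := r) (r := s)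
      (s := Q / 4) (Eq.subst (motive := IsIntegral ℤ) (by push_cast; ring) hi)
    obtain ⟨P'', S, e2, rfl, d3⟩ := h.rotate.rotate.exists_trace hK (p := P / 4) (q := s)
      (r := Q / 4) (s := R / 4) (Eq.subst (motive := IsIntegral ℤ) (by push_cast; ring) hi)
    obtain rfl : P = P' := by
      have : (P : ℚ) = P' := by linarith
      exact_mod_cast this
    obtain rfl : P = P'' := by
      have : (P : ℚ) = P'' := by linarith
      exact_mod_cast this
    have f1 := two_dvd_sub_of_one hbc (by exact_mod_cast d1)
    have f2 := two_dvd_sub_of_one hca (by exact_mod_cast d2)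
    have f3 := two_dvd_sub_of_one hab (by exact_mod_cast d3)
    obtain ⟨A, hA⟩ : 2 ∣ P - S := by omega
    obtain ⟨B, hB⟩ : 2 ∣ Q - S := by omega
    obtain ⟨C, hC⟩ : 2 ∣ R - S := by omega
    obtain rfl : P = S + 2 * A := by omega
    obtain rfl : Q = S + 2 * B := by omega
    obtain rfl : R = S + 2 * C := by omega
    -- The traces gave quarter-integers with numerators of one parity. Subtracting `S (1 + x + y +
    -- z) / 4` leaves `(A + B x + C y) / 2`.
    have hi2 := hi.sub ((isIntegral_intCast S).mul hq)
    obtain ⟨R', S', g1, g2, g3⟩ := h.exists_norm hK (p := A / 2) (q := B / 2) (r := C / 2) (s := 0)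
      (Eq.subst (motive := IsIntegral ℤ) (by push_cast; ring) hi2)
    have g4 := two_dvd_sub_of_one hbc (by exact_mod_cast g3)
    have g1' : A ^ 2 + B ^ 2 * (b * c) - C ^ 2 * (a * c) = 2 * R' := by
      have : ((A ^ 2 + B ^ 2 * (b * c) - C ^ 2 * (a * c) : ℤ) : ℚ) = (2 * R' : ℤ) := by
        push_cast; linear_combination 4 * g1
      exact_mod_cast this
    have g2' : A * B = S' := by
      have : ((A * B : ℤ) : ℚ) = S' := by push_cast; linear_combination 2 * g2
      exact_mod_cast this
    have g5 : 2 ∣ A - B - C := by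
      apply two_dvd_of_zmod_four
      -- The two norm coordinates `R'` and `S'` have the same parity, and modulo 4 this reads `(A -
      -- B) ^ 2 = C ^ 2`.
      have : 4 ∣ A ^ 2 + B ^ 2 * (b * c) - C ^ 2 * (a * c) - 2 * (A * B) := by omega
      have := four_dvd_iff_zmod.mp this
      push_cast at this ⊢
      rw [ha, hb, hc] at this
      revert this
      generalize (A : ZMod 4) = A
      generalize (B : ZMod 4) = B
      generalize (C : ZMod 4) = C
      revert A B C
      decide
    obtain ⟨D, hD⟩ := g5
    refine ⟨![D, B, C, S], ?_, ?_, ?_, ?_⟩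
    · obtain rfl : A = B + C + 2 * D := by omega
      simp [Fin.sum_univ_four]
      ring
    all_goals
      simp [Fin.sum_univ_four]
      try ring

/-- With `b = c + 4 m` and `c = 1 + 2 k`, the square of `(y + z) / 2` is `a ((1 + x) / 2 + k + m)`.
-/
theorem isIntegral_half_add_of_one (h : BiquadGen a b c x y z)
    (hbc : ((b * c : ℤ) : ZMod 4) = 1) : IsIntegral ℤ ((y + z) / 2) := by
  have h1 : 4 ∣ b - c ∧ 2 ∣ c - 1 := by
    have : ((b - c : ℤ) : ZMod 4) = 0 ∧ 2 * ((c - 1 : ℤ) : ZMod 4) = 0 := by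
      push_cast at hbc ⊢
      revert hbc
      generalize (b : ZMod 4) = b
      generalize (c : ZMod 4) = c
      revert b c
      decide
    exact ⟨four_dvd_iff_zmod.mpr this.1, two_dvd_of_zmod_four this.2⟩
  obtain ⟨⟨m, hm⟩, ⟨k, hk⟩⟩ := h1
  have hm' : (b - c : K) = 4 * m := by exact_mod_cast congrArg (Int.cast (R := K)) hm
  have hk' : (c - 1 : K) = 2 * k := by exact_mod_cast congrArg (Int.cast (R := K)) hk
  refine IsIntegral.of_pow (n := 2) two_pos ?_
  refine Eq.subst (motive := IsIntegral ℤ) ?_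
    ((isIntegral_intCast a).mul ((h.isIntegral_half hbc).add (isIntegral_intCast (k + m))))
  push_cast
  linear_combination -h.yy / 4 - h.zz / 4 - h.yz / 2 - (a / 4 : K) * hm' - (a / 2 : K) * hk'

/-- With `b + c = 4 m` and `a = 2 k`, the square of `(y + z) / 2` is `k (2 m + x)`. -/
theorem isIntegral_half_add_of_three (h : BiquadGen a b c x y z)
    (hbc : ((b * c : ℤ) : ZMod 4) = 3) (ha : 2 ∣ a) : IsIntegral ℤ ((y + z) / 2) := by
  have h1 : 4 ∣ b + c := by
    rw [four_dvd_iff_zmod]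
    push_cast at hbc ⊢
    revert hbc
    generalize (b : ZMod 4) = b
    generalize (c : ZMod 4) = c
    revert b c
    decide
  obtain ⟨m, hm⟩ := h1
  obtain ⟨k, hk⟩ := ha
  have hm' : (b + c : K) = 4 * m := by exact_mod_cast congrArg (Int.cast (R := K)) hm
  have hk' : (a : K) = 2 * k := by exact_mod_cast congrArg (Int.cast (R := K)) hk
  refine IsIntegral.of_pow (n := 2) two_pos ?_
  refine Eq.subst (motive := IsIntegral ℤ) ?_
    ((isIntegral_intCast k).mul ((isIntegral_intCast (2 * m)).add h.isIntegral_x))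
  push_cast
  linear_combination -h.yy / 4 - h.zz / 4 - h.yz / 2 - (a / 4 : K) * hm' - (m + x / 2 : K) * hk'

/-- As soon as two of the radicands are not 1 modulo 4, the trace conditions make every
quarter-numerator even, so denominators drop to 2. The relative norm supplies the remaining
conditions. -/
theorem exists_even_coords (h : BiquadGen a b c x y z) (hK : Module.finrank ℚ K = 4)
    (hca : ((c * a : ℤ) : ZMod 4) = 2 ∨ ((c * a : ℤ) : ZMod 4) = 3)
    (hab : ((a * b : ℤ) : ZMod 4) = 2 ∨ ((a * b : ℤ) : ZMod 4) = 3)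
    (hbc : ((b * c : ℤ) : ZMod 4) = 1 ∨ ((b * c : ℤ) : ZMod 4) = 3) {p q r s : ℚ}
    (hi : IsIntegral ℤ ((p : K) + q * x + r * y + s * z)) :
    ∃ P Q R S R' S' : ℤ, p = P / 2 ∧ q = Q / 2 ∧ r = R / 2 ∧ s = S / 2 ∧
      P ^ 2 + Q ^ 2 * (b * c) - R ^ 2 * (c * a) - S ^ 2 * (a * b) = 2 * R' ∧
      P * Q - R * S * a = S' ∧ 4 ∣ R' ^ 2 - b * c * S' ^ 2 := by
  obtain ⟨P, Q, rfl, rfl, d1⟩ := h.exists_trace hK hi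
  obtain ⟨P', R, e1, rfl, d2⟩ := h.rotate.exists_trace hK (p := P / 4) (q := r) (r := s)
    (s := Q / 4) (Eq.subst (motive := IsIntegral ℤ) (by push_cast; ring) hi)
  obtain ⟨P'', S, e2, rfl, d3⟩ := h.rotate.rotate.exists_trace hK (p := P / 4) (q := s)
    (r := Q / 4) (s := R / 4) (Eq.subst (motive := IsIntegral ℤ) (by push_cast; ring) hi)
  obtain rfl : P = P' := by
    have : (P : ℚ) = P' := by linarith
    exact_mod_cast this
  obtain rfl : P = P'' := by
    have : (P : ℚ) = P'' := by linarith
    exact_mod_cast this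
  have f2 := two_dvd_of_two_or_three hca (by exact_mod_cast d2)
  have f3 := two_dvd_of_two_or_three hab (by exact_mod_cast d3)
  have f1 : 2 ∣ Q := by
    rcases hbc with hbc | hbc
    · have := two_dvd_sub_of_one hbc (by exact_mod_cast d1)
      omega
    · exact (two_dvd_of_two_or_three (Or.inr hbc) (by exact_mod_cast d1)).2
  obtain ⟨⟨P, rfl⟩, ⟨R, rfl⟩⟩ := f2
  obtain ⟨-, ⟨S, rfl⟩⟩ := f3
  obtain ⟨Q, rfl⟩ := f1
  obtain ⟨R', S', g1, g2, g3⟩ := h.exists_norm hK hi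
  refine ⟨P, Q, R, S, R', S', by push_cast; ring, by push_cast; ring, by push_cast; ring,
    by push_cast; ring, ?_, ?_, g3⟩
  · have : ((P ^ 2 + Q ^ 2 * (b * c) - R ^ 2 * (c * a) - S ^ 2 * (a * b) : ℤ) : ℚ)
        = (2 * R' : ℤ) := by
      push_cast at g1 ⊢
      linear_combination 4 * g1
    exact_mod_cast this
  · have : ((P * Q - R * S * a : ℤ) : ℚ) = S' := by
      push_cast at g2 ⊢
      linear_combination 2 * g2
    exact_mod_cast this

theorem discr_of_one_of_ne (h : BiquadGen a b c x y z) (hK : Module.finrank ℚ K = 4)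
    (hbc : ((b * c : ℤ) : ZMod 4) = 1)
    (hca : ((c * a : ℤ) : ZMod 4) = 2 ∨ ((c * a : ℤ) : ZMod 4) = 3) :
    NumberField.discr K = (4 * (a * b * c)) ^ 2 := by
  have hb : (b : ZMod 4) = c := by
    push_cast at hbc
    revert hbc
    generalize (b : ZMod 4) = b
    generalize (c : ZMod 4) = c
    revert b c
    decide
  have hab : ((a * b : ℤ) : ZMod 4) = 2 ∨ ((a * b : ℤ) : ZMod 4) = 3 := by
    push_cast at hca ⊢
    rwa [hb, mul_comm]
  have hdet : Matrix.det !![(1 : ℚ), 0, 0, 0; 1/2, 1/2, 0, 0; 0, 0, 1, 0; 0, 0, 1/2, 1/2]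
      = 1 / 4 := by
    simp [Matrix.det_succ_row_zero, Fin.sum_univ_succ]
    norm_num
  have key := h.discr_eq_of_matrix hK
    !![1, 0, 0, 0; 1/2, 1/2, 0, 0; 0, 0, 1, 0; 0, 0, 1/2, 1/2] ?_ ?_ ?_
  · rw [hdet] at key
    have : (NumberField.discr K : ℚ) = ((4 * (a * b * c)) ^ 2 : ℤ) := by
      rw [key]; push_cast; ring
    exact_mod_cast this
  · rw [hdet]; norm_num
  · intro i
    fin_cases i
    · simpa using isIntegral_one
    · refine Eq.subst (motive := IsIntegral ℤ) ?_ (h.isIntegral_half hbc)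
      simp; ring
    · simpa using h.rotate.isIntegral_x
    · refine Eq.subst (motive := IsIntegral ℤ) ?_ (h.isIntegral_half_add_of_one hbc)
      simp; ring
  · intro p q r s hi
    obtain ⟨P, Q, R, S, R', S', rfl, rfl, rfl, rfl, g1, g2, g3⟩ :=
      h.exists_even_coords hK hca hab (Or.inl hbc) hi
    have g4 := two_dvd_sub_of_one hbc (by exact_mod_cast g3)
    have g5 : 2 ∣ P - Q ∧ 2 ∣ R - S := by
      have : 4 ∣ P ^ 2 + Q ^ 2 * (b * c) - R ^ 2 * (c * a) - S ^ 2 * (a * b)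
        - 2 * (P * Q - R * S * a) := by omega
      have := four_dvd_iff_zmod.mp this
      have h2 : 2 * ((P - Q : ℤ) : ZMod 4) = 0 ∧ 2 * ((R - S : ℤ) : ZMod 4) = 0 := by
        push_cast at this hbc hca ⊢
        rw [hbc, mul_comm (a : ZMod 4) (b : ZMod 4), hb] at this
        have hc : (c : ZMod 4) = 1 ∨ (c : ZMod 4) = 3 := by
          rw [hb] at hbc
          revert hbc
          generalize (c : ZMod 4) = c
          revert c
          decide
        have ha : 2 * (a : ZMod 4) = 2 * (c * a) := by
          rcases hc with hc | hc <;> rw [hc]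
          · ring
          · generalize (a : ZMod 4) = a
            revert a
            decide
        -- The left side is `(P - Q) ^ 2 - c a (R - S) ^ 2`; with `c a` equal to 2 or 3 modulo 4,
        -- its vanishing makes both differences even.
        have e : (P : ZMod 4) ^ 2 + Q ^ 2 * 1 - R ^ 2 * (c * a) - S ^ 2 * (c * a)
            - 2 * (P * Q) + R * S * (2 * (c * a)) = 0 := by
          rw [← ha]; linear_combination this
        clear this
        revert e
        generalize (P : ZMod 4) = P
        generalize (Q : ZMod 4) = Q
        generalize (R : ZMod 4) = R
        generalize (S : ZMod 4) = S
        rcases hca with hca | hca <;> rw [hca] <;> revert P Q R S <;> decide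
      exact ⟨two_dvd_of_zmod_four h2.1, two_dvd_of_zmod_four h2.2⟩
    obtain ⟨⟨A, hA⟩, ⟨B, hB⟩⟩ := g5
    obtain rfl : P = Q + 2 * A := by omega
    obtain rfl : R = S + 2 * B := by omega
    refine ⟨![A, Q, B, S], ?_, ?_, ?_, ?_⟩
    all_goals
      simp [Fin.sum_univ_four]
      try ring

theorem discr_of_three (h : BiquadGen a b c x y z) (hK : Module.finrank ℚ K = 4)
    (hbc : ((b * c : ℤ) : ZMod 4) = 3) (ha : (a : ZMod 4) = 2) :
    NumberField.discr K = (8 * (a * b * c)) ^ 2 := by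
  have hbc' : ((c : ZMod 4) * 2 = 2) ∧ 2 * (b : ZMod 4) = 2 := by
    push_cast at hbc
    revert hbc
    generalize (b : ZMod 4) = b
    generalize (c : ZMod 4) = c
    revert b c
    decide
  have hca : ((c * a : ℤ) : ZMod 4) = 2 := by
    push_cast; rw [ha]; exact hbc'.1
  have hab : ((a * b : ℤ) : ZMod 4) = 2 := by
    push_cast; rw [ha]; exact hbc'.2
  have ha2 : 2 ∣ a := two_dvd_of_zmod_four (by rw [ha]; rfl)
  have hdet : Matrix.det !![(1 : ℚ), 0, 0, 0; 0, 1, 0, 0; 0, 0, 1, 0; 0, 0, 1/2, 1/2]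
      = 1 / 2 := by
    simp [Matrix.det_succ_row_zero, Fin.sum_univ_succ]
  have key := h.discr_eq_of_matrix hK
    !![1, 0, 0, 0; 0, 1, 0, 0; 0, 0, 1, 0; 0, 0, 1/2, 1/2] ?_ ?_ ?_
  · rw [hdet] at key
    have : (NumberField.discr K : ℚ) = ((8 * (a * b * c)) ^ 2 : ℤ) := by
      rw [key]; push_cast; ring
    exact_mod_cast this
  · rw [hdet]; norm_num
  · intro i
    fin_cases i
    · simpa using isIntegral_one
    · simpa using h.isIntegral_x
    · simpa using h.rotate.isIntegral_x
    · refine Eq.subst (motive := IsIntegral ℤ) ?_ (h.isIntegral_half_add_of_three hbc ha2)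
      simp; ring
  · intro p q r s hi
    obtain ⟨P, Q, R, S, R', S', rfl, rfl, rfl, rfl, g1, g2, g3⟩ :=
      h.exists_even_coords hK (Or.inl hca) (Or.inl hab) (Or.inr hbc) hi
    have g4 := two_dvd_of_two_or_three (Or.inr hbc) (by exact_mod_cast g3)
    -- Both norm coordinates are now even. Modulo 4 the first reads `P ^ 2 + 3 Q ^ 2 = 2 (R ^ 2 + S
    -- ^ 2)`, and the second says that `P Q` is even.
    have g5 : 2 ∣ P ∧ 2 ∣ Q ∧ 2 ∣ R - S := by
      have e1 : 4 ∣ P ^ 2 + Q ^ 2 * (b * c) - R ^ 2 * (c * a) - S ^ 2 * (a * b) := by omega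
      have e2 : 4 ∣ 2 * (P * Q - R * S * a) := by omega
      have e1 := four_dvd_iff_zmod.mp e1
      have e2 := four_dvd_iff_zmod.mp e2
      have h2 : 2 * (P : ZMod 4) = 0 ∧ 2 * (Q : ZMod 4) = 0 ∧ 2 * ((R - S : ℤ) : ZMod 4) = 0 := by
        push_cast at e1 e2 hbc hca hab ⊢
        rw [hbc, hca, hab] at e1
        rw [ha] at e2
        revert e1 e2
        generalize (P : ZMod 4) = P
        generalize (Q : ZMod 4) = Q
        generalize (R : ZMod 4) = R
        generalize (S : ZMod 4) = S
        revert P Q R S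
        decide
      exact ⟨two_dvd_of_zmod_four h2.1, two_dvd_of_zmod_four h2.2.1, two_dvd_of_zmod_four h2.2.2⟩
    obtain ⟨⟨A, rfl⟩, ⟨C, rfl⟩, ⟨B, hB⟩⟩ := g5
    obtain rfl : R = S + 2 * B := by omega
    refine ⟨![A, C, B, S], ?_, ?_, ?_, ?_⟩
    all_goals
      simp [Fin.sum_univ_four]
      try ring

end BiquadGen

/-! ### Uniform discriminant formula and Galois group -/

/-- The ratio of the square root of the discriminant to `|a b c|`. -/
def ramFactor (a b c : ZMod 4) : ℕ :=
  if a = b ∧ b = c then 1 else if b = c ∨ c = a ∨ a = b then 4 else 8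

theorem ramFactor_rotate (a b c : ZMod 4) : ramFactor b c a = ramFactor a b c := by
  revert a b c; decide

/-- In lowest terms the square of the denominator of `q` divides `e`, and that of the numerator
divides `d`; both are therefore 1. -/
theorem eq_of_squarefree_of_rat_sq_mul {d e : ℤ} (hd : Squarefree d) (he : Squarefree e) {q : ℚ}
    (h : (d : ℚ) = q ^ 2 * e) : d = e := by
  have hden0 : (q.den : ℚ) ≠ 0 := by exact_mod_cast q.den_nz
  have key : d * (q.den : ℤ) ^ 2 = q.num ^ 2 * e := by
    have : ((d * (q.den : ℤ) ^ 2 : ℤ) : ℚ) = (q.num ^ 2 * e : ℤ) := by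
      rw [← Rat.num_div_den q] at h
      push_cast at h ⊢
      field_simp at h
      linear_combination h
    exact_mod_cast this
  have hcop : IsCoprime ((q.den : ℤ) ^ 2) (q.num ^ 2) := by
    apply IsCoprime.pow
    rw [Int.isCoprime_iff_gcd_eq_one, Int.gcd_comm]
    simpa [Int.gcd, Nat.Coprime] using q.reduced
  have h1 : (q.den : ℤ) * q.den ∣ e := by
    rw [← sq]
    exact hcop.dvd_of_dvd_mul_left ⟨d, by linarith⟩
  have h2 : q.num * q.num ∣ d := by
    rw [← sq]
    exact hcop.symm.dvd_of_dvd_mul_right ⟨e, key⟩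
  rcases Int.isUnit_iff.mp (he _ h1) with h1 | h1 <;>
  rcases Int.isUnit_iff.mp (hd _ h2) with h2 | h2 <;> rw [h1, h2] at key <;> linarith

theorem exists_squarefree_sq {K : Type*} [Field K] [CharZero K] {x : K} (hx : x ≠ 0) {q : ℚ}
    (h : x ^ 2 = q) : ∃ (d : ℤ) (r : ℚ), Squarefree d ∧ r ≠ 0 ∧ (r * x) ^ 2 = d := by
  have hq : q ≠ 0 := by
    rintro rfl
    simp at h
    exact hx h
  -- The rational `q` has the square class of `q.num * q.den`, so its signed squarefree part is the
  -- required `d`, reached by scaling `x` by `q.den / t`.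
  obtain ⟨s, t, hst, hs⟩ := Nat.sq_mul_squarefree (q.num * q.den).natAbs
  have hn : q.num * q.den ≠ 0 := mul_ne_zero (Rat.num_ne_zero.mpr hq) (by exact_mod_cast q.den_nz)
  have ht : t ≠ 0 := by
    rintro rfl
    simp at hst
    exact hn (by simpa using hst.symm)
  obtain ⟨u, hu, hu'⟩ : ∃ u : ℤ, Squarefree u ∧ (t : ℤ) ^ 2 * u = q.num * q.den := by
    rcases Int.natAbs_eq (q.num * q.den) with e | e
    · exact ⟨s, Int.squarefree_natCast.mpr hs, by rw [e, ← hst]; push_cast; ring⟩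
    · exact ⟨-s, (Int.squarefree_natCast.mpr hs).squarefree_of_dvd (neg_dvd.mpr dvd_rfl),
        by rw [e, ← hst]; push_cast; ring⟩
  refine ⟨u, q.den / t, hu, ?_, ?_⟩
  · have := q.den_nz
    positivity
  · have h1 : ((q.den / t : ℚ)) ^ 2 * q = u := by
      have hden0 : (q.den : ℚ) ≠ 0 := by exact_mod_cast q.den_nz
      have ht0 : (t : ℚ) ≠ 0 := by exact_mod_cast ht
      have hu'' : (t : ℚ) ^ 2 * u = q.num * q.den := by exact_mod_cast hu'
      field_simp
      linear_combination (q.den : ℚ) * q.mul_den_eq_num - hu''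
    rw [mul_pow, h]
    exact_mod_cast congrArg (Rat.cast (K := K)) h1

namespace BiquadGen

variable {K : Type*} [Field K] {a b c : ℤ} {x y z : K}

theorem zmod_ne_zero (h : BiquadGen a b c x y z) : (a * b * c : ZMod 4) ≠ 0 := by
  intro h0
  have : 4 ∣ a * b * c := by rw [four_dvd_iff_zmod]; push_cast; exact h0
  have := Int.isUnit_iff.mp (h.sqf 2 (by simpa using this))
  omega

theorem of_sq [CharZero K] (hs : Squarefree (a * b * c)) (hx : b * c ≠ 1) (hy : a * c ≠ 1)
    (hz : a * b ≠ 1) (xx : x ^ 2 = b * c) (yy : y ^ 2 = a * c) :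
    BiquadGen a b c x y (x * y / c) := by
  have hc : (c : K) ≠ 0 := by
    have : c ≠ 0 := by rintro rfl; simp at hs
    exact_mod_cast this
  refine ⟨xx, yy, ?_, ?_, ?_, ?_, hs, hx, hy, hz⟩
  all_goals field_simp
  · linear_combination y ^ 2 * xx + (b * c : K) * yy
  · linear_combination y * xx
  · linear_combination x * yy

/-- Rotation and simultaneous negation reduce everything to the three integral bases. Squarefreeness
excludes the residue 0 and allows 2 at most once: equal residues are all 1 or all 3, and pairwise
distinct residues include a 2. -/
theorem discr [NumberField K] (h : BiquadGen a b c x y z) (hK : Module.finrank ℚ K = 4) :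
    NumberField.discr K = (ramFactor a b c * (a * b * c)) ^ 2 := by
  have H4 : ∀ {a b c : ℤ} {x y z : K} (h : BiquadGen a b c x y z),
      (b : ZMod 4) = c → ¬ ((a : ZMod 4) = b ∧ (b : ZMod 4) = c) →
      NumberField.discr K = (ramFactor a b c * (a * b * c)) ^ 2 := by
    intro a b c x y z h h1 h2
    have hr : ramFactor a b c = 4 := by
      rw [ramFactor, if_neg h2, if_pos (Or.inl h1)]
    rw [hr]
    have h3 := h.zmod_ne_zero
    have : (b * c : ZMod 4) = 1 ∧ ((c * a : ZMod 4) = 2 ∨ (c * a : ZMod 4) = 3) := by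
      revert h1 h2 h3
      generalize (a : ZMod 4) = a
      generalize (b : ZMod 4) = b
      generalize (c : ZMod 4) = c
      revert a b c
      decide
    exact h.discr_of_one_of_ne hK (by push_cast; exact this.1) (by push_cast; exact this.2)
  have H8 : ∀ {a b c : ℤ} {x y z : K} (h : BiquadGen a b c x y z),
      ¬ ((b : ZMod 4) = c ∨ (c : ZMod 4) = a ∨ (a : ZMod 4) = b) → (a : ZMod 4) = 2 →
      NumberField.discr K = (ramFactor a b c * (a * b * c)) ^ 2 := by
    intro a b c x y z h h1 h2
    have hr : ramFactor a b c = 8 := by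
      rw [ramFactor, if_neg (by tauto), if_neg h1]
    rw [hr]
    have h3 := h.zmod_ne_zero
    have : (b * c : ZMod 4) = 3 := by
      revert h1 h2 h3
      generalize (a : ZMod 4) = a
      generalize (b : ZMod 4) = b
      generalize (c : ZMod 4) = c
      revert a b c
      decide
    exact h.discr_of_three hK (by push_cast; exact this) h2
  have rot : ∀ {a b c : ℤ}, NumberField.discr K = (ramFactor b c a * (b * c * a)) ^ 2 →
      NumberField.discr K = (ramFactor a b c * (a * b * c)) ^ 2 := by
    intro a b c h
    rw [h, ramFactor_rotate, show b * c * a = a * b * c by ring]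
  by_cases h1 : (a : ZMod 4) = b ∧ (b : ZMod 4) = c
  · have h3 := h.zmod_ne_zero
    have hr : ramFactor a b c = 1 := by rw [ramFactor, if_pos h1]
    rw [hr]
    have : (c : ZMod 4) = 1 ∨ (-c : ZMod 4) = 1 := by
      rw [h1.1, h1.2] at h3
      revert h3
      generalize (c : ZMod 4) = c
      revert c
      decide
    rcases this with h2 | h2
    · rw [h.discr_of_one hK (by rw [h1.1, h1.2, h2]) (by rw [h1.2, h2]) h2]
      push_cast; ring
    · rw [h.neg.discr_of_one hK (by push_cast; rw [h1.1, h1.2, h2]) (by push_cast; rw [h1.2, h2])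
        (by push_cast; exact h2)]
      push_cast; ring
  · by_cases hbc : (b : ZMod 4) = c
    · exact H4 h hbc h1
    by_cases hca : (c : ZMod 4) = a
    · exact rot (H4 h.rotate hca (fun h' => h1 ⟨(h'.1.trans hca).symm ▸ rfl, h'.1⟩))
    by_cases hab : (a : ZMod 4) = b
    · exact rot (rot (H4 h.rotate.rotate hab (fun h' => hca h'.1)))
    have h3 := h.zmod_ne_zero
    have : (a : ZMod 4) = 2 ∨ (b : ZMod 4) = 2 ∨ (c : ZMod 4) = 2 := by
      clear h1
      revert hbc hca hab h3
      generalize (a : ZMod 4) = a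
      generalize (b : ZMod 4) = b
      generalize (c : ZMod 4) = c
      revert a b c
      decide
    rcases this with h2 | h2 | h2
    · exact H8 h (by tauto) h2
    · exact rot (H8 h.rotate (by tauto) h2)
    · exact rot (rot (H8 h.rotate.rotate (by tauto) h2))

variable [CharZero K]

/-- The squarefree integers other than `1` that become squares in `K`. -/
theorem eq_of_sq_eq (h : BiquadGen a b c x y z) (hK : Module.finrank ℚ K = 4) {d : ℤ}
    (hd : Squarefree d) (hd1 : d ≠ 1) {w : K} (hw : w ^ 2 = d) :
    d = b * c ∨ d = a * c ∨ d = a * b := by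
  obtain ⟨p, q, r, s, rfl⟩ := h.exists_coord hK w
  have sgn : ∀ σ : K →ₐ[ℚ] K, σ (p + q * x + r * y + s * z) = p + q * x + r * y + s * z ∨
      σ (p + q * x + r * y + s * z) = -(p + q * x + r * y + s * z) := by
    intro σ
    apply sq_eq_sq_iff_eq_or_eq_neg.mp
    rw [← map_pow, hw]
    simp
  -- A conjugation sends `w` to `w` or `-w`, which kills one half of the coordinates; two different
  -- conjugations leave a single coordinate.
  have h1 : (r = 0 ∧ s = 0) ∨ (p = 0 ∧ q = 0) := by
    obtain ⟨σ, e1, e2, e3⟩ := h.exists_conj hK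
    rcases sgn σ with e | e
    · left
      have := h.eq_zero_of_comb (p := 0) (q := 0) (r := 2 * r) (s := 2 * s) (by
        simp [e1, e2, e3] at e
        push_cast
        linear_combination -e)
      simpa using this
    · right
      have := h.eq_zero_of_comb (p := 2 * p) (q := 2 * q) (r := 0) (s := 0) (by
        simp [e1, e2, e3] at e
        push_cast
        linear_combination e)
      simpa using this
  have h2 : (q = 0 ∧ s = 0) ∨ (p = 0 ∧ r = 0) := by
    obtain ⟨σ, e2, e3, e1⟩ := h.rotate.exists_conj hK
    rcases sgn σ with e | e
    · left
      have := h.eq_zero_of_comb (p := 0) (q := 2 * q) (r := 0) (s := 2 * s) (by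
        simp [e1, e2, e3] at e
        push_cast
        linear_combination -e)
      simpa using this
    · right
      have := h.eq_zero_of_comb (p := 2 * p) (q := 0) (r := 2 * r) (s := 0) (by
        simp [e1, e2, e3] at e
        push_cast
        linear_combination e)
      simpa using this
  rcases h1 with ⟨rfl, rfl⟩ | ⟨rfl, rfl⟩ <;> rcases h2 with ⟨h2, h2'⟩ | ⟨h2, h2'⟩ <;>
    (try subst h2) <;> (try subst h2')
  · exfalso
    apply hd1
    refine eq_one_of_squarefree_of_rat_sq hd (r := p) ?_
    have : ((p ^ 2 : ℚ) : K) = ((d : ℚ) : K) := by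
      push_cast
      rw [← hw]; simp
    exact_mod_cast this
  · left
    refine eq_of_squarefree_of_rat_sq_mul hd h.sqfX (q := q) ?_
    have : ((d : ℚ) : K) = ((q ^ 2 * (b * c : ℤ) : ℚ) : K) := by
      push_cast
      rw [← hw, ← h.xx]; simp; ring
    exact_mod_cast this
  · right; left
    refine eq_of_squarefree_of_rat_sq_mul hd h.sqfY (q := r) ?_
    have : ((d : ℚ) : K) = ((r ^ 2 * (a * c : ℤ) : ℚ) : K) := by
      push_cast
      rw [← hw, ← h.yy]; simp; ring
    exact_mod_cast this
  · right; right
    refine eq_of_squarefree_of_rat_sq_mul hd h.sqfZ (q := s) ?_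
    have : ((d : ℚ) : K) = ((s ^ 2 * (a * b : ℤ) : ℚ) : K) := by
      push_cast
      rw [← hw, ← h.zz]; simp; ring
    exact_mod_cast this

theorem x_ne_zero (h : BiquadGen a b c x y z) : x ≠ 0 := by
  rintro rfl
  have h1 := h.xx
  have : (b * c : K) ≠ 0 := by
    exact_mod_cast mul_ne_zero h.b_ne_zero h.c_ne_zero
  apply this
  rw [← h1]; ring

theorem algHom_x (h : BiquadGen a b c x y z) (σ : K →ₐ[ℚ] K) : σ x = x ∨ σ x = -x := by
  apply sq_eq_sq_iff_eq_or_eq_neg.mp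
  rw [← map_pow, h.xx]
  simp

/-- The identity and three conjugations already give as many automorphisms as the degree. Every
automorphism changes only the signs of `x, y, z`, hence is an involution. -/
theorem isBiquadratic [NumberField K] (h : BiquadGen a b c x y z)
    (hK : Module.finrank ℚ K = 4) : IsBiquadratic K := by
  have hx0 := h.x_ne_zero
  have hy0 := h.rotate.x_ne_zero
  have hz0 := h.rotate.rotate.x_ne_zero
  have nx : x ≠ -x := fun e => hx0 (self_eq_neg.mp e)
  have ny : y ≠ -y := fun e => hy0 (self_eq_neg.mp e)
  obtain ⟨σ, a1, a2, -⟩ := h.exists_conj hK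
  obtain ⟨τ, b2, -, b1⟩ := h.rotate.exists_conj hK
  obtain ⟨ρ, -, c1, c2⟩ := h.rotate.rotate.exists_conj hK
  let E : (K →ₐ[ℚ] K) → (K ≃ₐ[ℚ] K) := fun f =>
    AlgEquiv.ofBijective f (Algebra.IsAlgebraic.algHom_bijective f)
  have hE : ∀ f w, E f w = f w := fun f w => rfl
  have hcard : Nat.card (K ≃ₐ[ℚ] K) = 4 := by
    apply le_antisymm
    · rw [← hK, Nat.card_eq_fintype_card]
      exact AlgEquiv.card_le
    · have hinj : Function.Injective ![(1 : K ≃ₐ[ℚ] K), E σ, E τ, E ρ] := by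
        intro i j hij
        have hx := congrArg (fun f : K ≃ₐ[ℚ] K => f x) hij
        have hy := congrArg (fun f : K ≃ₐ[ℚ] K => f y) hij
        fin_cases i <;> fin_cases j <;> simp [hE, a1, a2, b1, b2, c1, c2] at hx hy ⊢ <;>
          first
          | exact absurd hx nx
          | exact absurd hx.symm nx
          | exact absurd hy ny
          | exact absurd hy.symm ny
      have := Nat.card_le_card_of_injective _ hinj
      simpa using this
  refine ⟨IsGalois.of_card_aut_eq_finrank ℚ K (by rw [hcard, hK]), hcard, ?_⟩
  have hnt : Nontrivial (K ≃ₐ[ℚ] K) := by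
    rw [← Finite.one_lt_card_iff_nontrivial, hcard]; norm_num
  rw [Monoid.exponent_eq_prime_iff Nat.prime_two]
  intro g hg
  refine orderOf_eq_prime ?_ hg
  ext w
  obtain ⟨p, q, r, s, rfl⟩ := h.exists_coord hK w
  have g2 : ∀ {a b c : ℤ} {x y z : K}, BiquadGen a b c x y z → g (g x) = x := by
    intro a b c x y z h
    rcases h.algHom_x (g : K →ₐ[ℚ] K) with e | e <;> simp at e <;> simp [e]
  simp [pow_two, g2 h, g2 h.rotate, g2 h.rotate.rotate]

end BiquadGen

/-! ### Generators of an abstract biquadratic field -/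

/-- As `h` lies outside the group generated by `g`, Galois correspondence gives `u` fixed by `g` but
not by `h`. The element `u - h u` is fixed by `g` and negated by `h`, so its square is rational;
scaling makes the square a squarefree integer. -/
theorem exists_rat_sq_of_klein {K : Type*} [Field K] [NumberField K] [IsGalois ℚ K]
    (hG : IsKleinFour (K ≃ₐ[ℚ] K)) {g h : K ≃ₐ[ℚ] K} (hg : g ≠ 1) (hh : h ≠ 1) (hgh : h ≠ g) :
    ∃ (x : K) (d : ℤ), Squarefree d ∧ x ^ 2 = d ∧ g x = x ∧ h x = -x ∧ x ≠ 0 := by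
  have hex : Monoid.exponent (K ≃ₐ[ℚ] K) = 2 := hG.exponent_two
  have gg : g * g = 1 := by rw [← sq]; exact hex ▸ Monoid.pow_exponent_eq_one g
  have hhh : h * h = 1 := by rw [← sq]; exact hex ▸ Monoid.pow_exponent_eq_one h
  have comm : g * h = h * g := mul_comm_of_exponent_two hex g h
  have gg' : ∀ w, g (g w) = w := fun w => DFunLike.congr_fun gg w
  have hh' : ∀ w, h (h w) = w := fun w => DFunLike.congr_fun hhh w
  have comm' : ∀ w, g (h w) = h (g w) := fun w => DFunLike.congr_fun comm w
  have hfix : ∃ u : K, g u = u ∧ h u ≠ u := by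
    by_contra! hcon
    have : h ∈ (IntermediateField.fixedField (Subgroup.zpowers g)).fixingSubgroup := by
      rw [IntermediateField.mem_fixingSubgroup_iff]
      intro u hu
      apply hcon
      rw [IntermediateField.mem_fixedField_iff] at hu
      exact hu g (Subgroup.mem_zpowers g)
    rw [IntermediateField.fixingSubgroup_fixedField, Subgroup.mem_zpowers_iff] at this
    obtain ⟨k, hk⟩ := this
    rcases Int.even_or_odd' k with ⟨m, rfl | rfl⟩
    · rw [zpow_mul, zpow_two, gg, one_zpow] at hk
      exact hh hk.symm
    · rw [zpow_add, zpow_mul, zpow_two, gg, one_zpow, one_mul, zpow_one] at hk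
      exact hgh hk.symm
  obtain ⟨u, hu1, hu2⟩ := hfix
  set x := u - h u with hx
  have hx0 : x ≠ 0 := sub_ne_zero.mpr hu2.symm
  have gx : g x = x := by rw [hx, map_sub, comm', hu1]
  have hx' : h x = -x := by rw [hx, map_sub, hh']; ring
  have hall : ∀ σ : K ≃ₐ[ℚ] K, σ (x ^ 2) = x ^ 2 := by
    intro σ
    have := hG
    classical
    have hf := IsKleinFour.eq_finset_univ (x := g) (y := h) hg hh hgh.symm
    have := Finset.mem_univ σ
    rw [← hf] at this
    simp only [Finset.mem_insert, Finset.mem_singleton] at this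
    rcases this with rfl | rfl | rfl | rfl <;> simp [gx, hx']
  obtain ⟨q, hq⟩ := (IsGalois.mem_range_algebraMap_iff_fixed (F := ℚ) (x ^ 2)).mpr hall
  obtain ⟨d, r, hd, hr, hrx⟩ := exists_squarefree_sq hx0 (q := q) (by rw [← hq]; simp)
  refine ⟨r * x, d, hd, hrx, by simp [gx], by simp [hx'], mul_ne_zero (by exact_mod_cast hr) hx0⟩

/-- Take `c` to be the gcd: the cofactors are coprime to each other and, by squarefreeness, to `c`.
If `a b = 1`, then `a = b` and `d = e`. -/
theorem squarefree_triple {d e : ℤ} (hd : Squarefree d) (he : Squarefree e) (hde : d ≠ e) :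
    ∃ a b c : ℤ, 0 < c ∧ d = b * c ∧ e = a * c ∧ Squarefree (a * b * c) ∧ a * b ≠ 1 := by
  have hd0 := hd.ne_zero
  obtain ⟨b, hb⟩ := Int.gcd_dvd_left d e
  obtain ⟨a, ha⟩ := Int.gcd_dvd_right d e
  have hc : 0 < Int.gcd d e := Int.gcd_pos_of_ne_zero_left e hd0
  have hab : IsCoprime a b := by
    rw [Int.isCoprime_iff_gcd_eq_one]
    have h1 : Int.gcd (Int.gcd d e * b) (Int.gcd d e * a) = Int.gcd d e := by
      rw [← hb, ← ha]
    rw [Int.gcd_mul_left] at h1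
    simp only [Int.natAbs_natCast] at h1
    rw [Int.gcd_comm]
    exact Nat.eq_of_mul_eq_mul_left hc (by omega)
  set c : ℤ := (Int.gcd d e : ℤ) with hcdef
  refine ⟨a, b, c, Int.natCast_pos.mpr hc, by rw [hb]; ring, by rw [ha]; ring, ?_, ?_⟩
  · have hac : Squarefree (c * a) := ha ▸ he
    have hbc : Squarefree (c * b) := hb ▸ hd
    rw [squarefree_mul_iff] at hac hbc
    rw [mul_assoc, squarefree_mul_iff]
    refine ⟨?_, hac.2.2, ?_⟩
    · exact IsRelPrime.mul_right hab.isRelPrime hac.1.symm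
    · rw [mul_comm, squarefree_mul_iff]; exact hbc
  · intro h1
    rcases Int.eq_one_or_neg_one_of_mul_eq_one' h1 with ⟨h1, h2⟩ | ⟨h1, h2⟩ <;>
    exact hde (by rw [hb, ha, h1, h2])

theorem IsBiquadratic.finrank_eq {K : Type*} [Field K] [NumberField K] (h : IsBiquadratic K) :
    Module.finrank ℚ K = 4 := by
  have := h.1
  rw [← IsGalois.card_aut_eq_finrank, h.2.card_four]

/-- Two distinct nontrivial automorphisms give square roots `x` and `y`, each negated by just one of
them. Such elements are not `±1`, nor is `x = ±y`, so the radicands are admissible. -/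
theorem IsBiquadratic.exists_gen {K : Type*} [Field K] [NumberField K] (h : IsBiquadratic K) :
    ∃ (a b c : ℤ) (x y z : K), 0 < c ∧ BiquadGen a b c x y z := by
  obtain ⟨hGal, hG⟩ := h
  have hcard : Nat.card (K ≃ₐ[ℚ] K) = 4 := hG.card_four
  obtain ⟨g, hg, h, hh, hgh⟩ : ∃ g : K ≃ₐ[ℚ] K, g ≠ 1 ∧ ∃ h : K ≃ₐ[ℚ] K, h ≠ 1 ∧ h ≠ g := by
    have hnt : Nontrivial (K ≃ₐ[ℚ] K) := by
      rw [← Finite.one_lt_card_iff_nontrivial, hcard]; norm_num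
    obtain ⟨g, hg⟩ := exists_ne (1 : K ≃ₐ[ℚ] K)
    refine ⟨g, hg, ?_⟩
    by_contra! hcon
    classical
    have h3 : (Finset.univ : Finset (K ≃ₐ[ℚ] K)) ⊆ {1, g} := by
      intro k _
      by_cases hk : k = 1
      · simp [hk]
      · simp [hcon k hk]
    have := (Finset.card_le_card h3).trans Finset.card_le_two
    rw [Finset.card_univ, ← Nat.card_eq_fintype_card, hcard] at this
    omega
  obtain ⟨x, d, hd, hxd, gx, hx, hx0⟩ := exists_rat_sq_of_klein hG hg hh hgh
  obtain ⟨y, e, he, hye, hy, gy, hy0⟩ := exists_rat_sq_of_klein hG hh hg hgh.symm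
  have ne_one : ∀ {w : K} {σ : K ≃ₐ[ℚ] K}, σ w = -w → w ≠ 0 → w ^ 2 ≠ 1 := by
    intro w σ h1 h2 h3
    have h4 : σ w = w := by
      rcases mul_self_eq_one_iff.mp ((sq w).symm.trans h3) with rfl | rfl <;> simp
    exact h2 (self_eq_neg.mp (h4.symm.trans h1))
  have hd1 : d ≠ 1 := by
    rintro rfl
    exact ne_one hx hx0 (by simpa using hxd)
  have he1 : e ≠ 1 := by
    rintro rfl
    exact ne_one gy hy0 (by simpa using hye)
  have hde : d ≠ e := by
    rintro rfl
    rw [← hye] at hxd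
    rcases sq_eq_sq_iff_eq_or_eq_neg.mp hxd with rfl | rfl
    · exact hx0 (self_eq_neg.mp (hy.symm.trans hx))
    · rw [map_neg, hy, neg_neg] at hx
      exact hy0 (self_eq_neg.mp hx.symm)
  obtain ⟨a, b, c, hc, rfl, rfl, hs, hab⟩ := squarefree_triple hd he hde
  exact ⟨a, b, c, x, y, _, hc, BiquadGen.of_sq hs hd1 he1 hab (by simpa using hxd)
    (by simpa using hye)⟩

/-! ### Real and complex places -/

namespace BiquadGen

open NumberField

variable {K : Type*} [Field K] [NumberField K] {a b c : ℤ} {x y z : K}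

omit [NumberField K] in
theorem not_isReal_of_neg (h : BiquadGen a b c x y z) (hneg : b * c < 0) (v : InfinitePlace K) :
    ¬ v.IsReal := by
  intro hv
  obtain ⟨φ, hφ, -⟩ := hv
  have h1 : (φ x) ^ 2 = ((b * c : ℤ) : ℂ) := by
    rw [← map_pow, h.xx]; simp
  have h2 : (φ x).im = 0 := by
    rw [← Complex.conj_eq_iff_im]
    exact DFunLike.congr_fun hφ x
  have h3 := congrArg Complex.re h1
  rw [sq, Complex.mul_re, h2, Complex.intCast_re] at h3
  have : ((b * c : ℤ) : ℝ) < 0 := by exact_mod_cast hneg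
  nlinarith [mul_self_nonneg (φ x).re]

omit [NumberField K] in
theorem conj_x_of_pos (h : BiquadGen a b c x y z) (hpos : 0 < b * c) (φ : K →+* ℂ) :
    (starRingEnd ℂ) (φ x) = φ x := by
  have h1 : (φ x) ^ 2 = ((b * c : ℤ) : ℂ) := by
    rw [← map_pow, h.xx]; simp
  have h3 := congrArg Complex.re h1
  have h4 := congrArg Complex.im h1
  rw [sq, Complex.mul_im, Complex.intCast_im] at h4
  rw [sq, Complex.mul_re, Complex.intCast_re] at h3
  rw [Complex.conj_eq_iff_im]
  have hp : (0 : ℝ) < ((b * c : ℤ) : ℝ) := by exact_mod_cast hpos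
  have h5 : (φ x).re * (φ x).im = 0 := by linarith
  rcases mul_eq_zero.mp h5 with h6 | h6
  · rw [h6] at h3
    nlinarith [mul_self_nonneg (φ x).im]
  · exact h6

theorem isReal_of_pos (h : BiquadGen a b c x y z) (hK : Module.finrank ℚ K = 4)
    (hx : 0 < b * c) (hy : 0 < a * c) (v : InfinitePlace K) : v.IsReal := by
  rw [InfinitePlace.isReal_iff, ComplexEmbedding.isReal_iff]
  ext w
  obtain ⟨p, q, r, s, rfl⟩ := h.exists_coord hK w
  have hz : 0 < a * b := by
    have := h.c_ne_zero
    have h1 : 0 < (a * b) * (c * c) := by nlinarith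
    exact pos_of_mul_pos_left h1 (mul_self_nonneg c)
  have e1 := h.conj_x_of_pos hx v.embedding
  have e2 := h.rotate.conj_x_of_pos (by rwa [mul_comm]) v.embedding
  have e3 := h.rotate.rotate.conj_x_of_pos hz v.embedding
  simp [ComplexEmbedding.conjugate_coe_eq, e1, e2, e3]

/-- The sign condition in terms of the triple `(a, b, c)`. -/
theorem holds_iff (h : BiquadGen a b c x y z) (hK : Module.finrank ℚ K = 4) (hc : 0 < c)
    (σ : FieldSign) : σ.Holds K ↔ match σ with
      | .plus => 0 < a ∧ 0 < b
      | .minus => ¬ (0 < a ∧ 0 < b) := by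
  -- As `c > 0`, the signs of the radicands `b c` and `a c` are those of `b` and `a`; one negative
  -- radicand makes every place complex.
  have key : (0 < a ∧ 0 < b) ∧ (∀ v : InfinitePlace K, v.IsReal) ∨
      ¬ (0 < a ∧ 0 < b) ∧ (∀ v : InfinitePlace K, v.IsComplex) := by
    by_cases h0 : 0 < a ∧ 0 < b
    · exact Or.inl ⟨h0, h.isReal_of_pos hK (mul_pos h0.2 hc) (mul_pos h0.1 hc)⟩
    · refine Or.inr ⟨h0, fun v => ?_⟩
      rw [← InfinitePlace.not_isReal_iff_isComplex]
      rw [not_and_or, not_lt, not_lt] at h0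
      rcases h0 with h0 | h0
      · exact h.rotate.not_isReal_of_neg
          (mul_neg_of_pos_of_neg hc (lt_of_le_of_ne h0 h.a_ne_zero)) v
      · exact h.not_isReal_of_neg (mul_neg_of_neg_of_pos (lt_of_le_of_ne h0 h.b_ne_zero) hc) v
  obtain ⟨v⟩ := (inferInstance : Nonempty (InfinitePlace K))
  cases σ with
  | plus =>
    simp only [FieldSign.Holds]
    rcases key with ⟨h1, h2⟩ | ⟨h1, h2⟩
    · exact ⟨fun _ => h1, fun _ => ⟨h2⟩⟩
    · refine ⟨fun hr => ?_, fun hh => absurd hh h1⟩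
      exact absurd (hr.isReal v) (InfinitePlace.not_isReal_iff_isComplex.mpr (h2 v))
  | minus =>
    simp only [FieldSign.Holds]
    rcases key with ⟨h1, h2⟩ | ⟨h1, h2⟩
    · refine ⟨fun hr => ?_, fun hh => absurd h1 hh⟩
      exact absurd (h2 v) (InfinitePlace.not_isReal_iff_isComplex.mpr (hr.isComplex v))
    · exact ⟨fun _ => h1, fun _ => ⟨h2⟩⟩

end BiquadGen

/-! ### The six-to-one correspondence between triples and fields -/

namespace BiquadGen

variable {a b c : ℤ}

theorem coe {K : IntermediateField ℚ (AlgebraicClosure ℚ)} {x y z : K}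
    (h : BiquadGen a b c x y z) :
    BiquadGen a b c (x : AlgebraicClosure ℚ) (y : AlgebraicClosure ℚ) (z : AlgebraicClosure ℚ) where
  xx := by simpa using congrArg (algebraMap K (AlgebraicClosure ℚ)) h.xx
  yy := by simpa using congrArg (algebraMap K (AlgebraicClosure ℚ)) h.yy
  zz := by simpa using congrArg (algebraMap K (AlgebraicClosure ℚ)) h.zz
  xy := by simpa using congrArg (algebraMap K (AlgebraicClosure ℚ)) h.xy
  xz := by simpa using congrArg (algebraMap K (AlgebraicClosure ℚ)) h.xz
  yz := by simpa using congrArg (algebraMap K (AlgebraicClosure ℚ)) h.yz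
  sqf := h.sqf
  hx := h.hx
  hy := h.hy
  hz := h.hz

theorem x_mem {K K' : IntermediateField ℚ (AlgebraicClosure ℚ)} {x y z : K} {x' y' z' : K'}
    (h : BiquadGen a b c x y z) (h' : BiquadGen a b c x' y' z') : (x : AlgebraicClosure ℚ) ∈ K' := by
  have := h.coe.xx.trans h'.coe.xx.symm
  rcases sq_eq_sq_iff_eq_or_eq_neg.mp this with e | e <;> rw [e]
  · exact x'.2
  · exact neg_mem x'.2

theorem field_le {K K' : IntermediateField ℚ (AlgebraicClosure ℚ)} {x y z : K} {x' y' z' : K'}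
    (h : BiquadGen a b c x y z) (hK : Module.finrank ℚ K = 4) (h' : BiquadGen a b c x' y' z') :
    K ≤ K' := by
  intro w hw
  obtain ⟨p, q, r, s, e⟩ := h.exists_coord hK ⟨w, hw⟩
  have e' := congrArg (algebraMap K (AlgebraicClosure ℚ)) e
  simp at e'
  rw [e']
  have hrat : ∀ q : ℚ, (q : AlgebraicClosure ℚ) ∈ K' := fun q => by
    simp
  exact add_mem (add_mem (add_mem (hrat p) (mul_mem (hrat q) (h.x_mem h')))
    (mul_mem (hrat r) (h.rotate.x_mem h'.rotate)))
    (mul_mem (hrat s) (h.rotate.rotate.x_mem h'.rotate.rotate))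

end BiquadGen

/-- The triple `(a, b, c)` parametrizes generators of the biquadratic field `K`. -/
def GeneratedBy (K : IntermediateField ℚ (AlgebraicClosure ℚ)) (t : ℤ × ℤ × ℤ) : Prop :=
  Module.finrank ℚ K = 4 ∧ ∃ x y z : K, BiquadGen t.1 t.2.1 t.2.2 x y z

/-- The triples `(a, b, c)` for which `ℚ(√(b c), √(a c))` is biquadratic. -/
def IsBiquadTriple (t : ℤ × ℤ × ℤ) : Prop :=
  0 < t.2.2 ∧ Squarefree (t.1 * t.2.1 * t.2.2) ∧ t.2.1 * t.2.2 ≠ 1 ∧ t.1 * t.2.2 ≠ 1 ∧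
    t.1 * t.2.1 ≠ 1

theorem isIntegral_algebraicClosure (w : AlgebraicClosure ℚ) : IsIntegral ℚ w := by
  convert! ((AlgebraicClosure.isAlgebraic ℚ).isAlgebraic w).isIntegral

theorem GeneratedBy.eq {K K' : IntermediateField ℚ (AlgebraicClosure ℚ)} {t : ℤ × ℤ × ℤ}
    (h : GeneratedBy K t) (h' : GeneratedBy K' t) : K = K' := by
  obtain ⟨hK, x, y, z, h⟩ := h
  obtain ⟨hK', x', y', z', h'⟩ := h'
  exact le_antisymm (h.field_le hK h') (h'.field_le hK' h)

theorem GeneratedBy.numberField {K : IntermediateField ℚ (AlgebraicClosure ℚ)} {t : ℤ × ℤ × ℤ}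
    (h : GeneratedBy K t) : NumberField K :=
  have : FiniteDimensional ℚ K := FiniteDimensional.of_finrank_pos (by rw [h.1]; norm_num)
  ⟨⟩

open IntermediateField in
-- The compositum of the two quadratic extensions has degree at most 4, and linear independence of
-- `1, x, y, z` gives at least 4.
theorem IsBiquadTriple.exists_field {t : ℤ × ℤ × ℤ} (ht : IsBiquadTriple t) :
    ∃ K, GeneratedBy K t := by
  obtain ⟨a, b, c⟩ := t
  obtain ⟨hc, hs, h1, h2, h3⟩ := ht
  simp only at hc hs h1 h2 h3
  obtain ⟨x, hx⟩ := IsAlgClosed.exists_pow_nat_eq ((b * c : ℤ) : AlgebraicClosure ℚ) two_pos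
  obtain ⟨y, hy⟩ := IsAlgClosed.exists_pow_nat_eq ((a * c : ℤ) : AlgebraicClosure ℚ) two_pos
  have deg : ∀ (w : AlgebraicClosure ℚ) (n : ℤ), w ^ 2 = n → Module.finrank ℚ ℚ⟮w⟯ ≤ 2 := by
    intro w n hw
    have hint : IsIntegral ℚ w := isIntegral_algebraicClosure w
    rw [IntermediateField.adjoin.finrank hint]
    have hdeg : (Polynomial.X ^ 2 - Polynomial.C (n : ℚ)).natDegree = 2 :=
      Polynomial.natDegree_X_pow_sub_C
    rw [← hdeg]
    apply Polynomial.natDegree_le_of_dvd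
    · apply minpoly.dvd
      simp [hw]
    · exact Polynomial.X_pow_sub_C_ne_zero two_pos _
  let K : IntermediateField ℚ (AlgebraicClosure ℚ) := ℚ⟮x⟯ ⊔ ℚ⟮y⟯
  have : FiniteDimensional ℚ ℚ⟮x⟯ := adjoin.finiteDimensional (isIntegral_algebraicClosure x)
  have : FiniteDimensional ℚ ℚ⟮y⟯ := adjoin.finiteDimensional (isIntegral_algebraicClosure y)
  have hfd : FiniteDimensional ℚ K := IntermediateField.finiteDimensional_sup _ _
  have hxK : x ∈ K := (le_sup_left : ℚ⟮x⟯ ≤ K) (mem_adjoin_simple_self ℚ x)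
  have hyK : y ∈ K := (le_sup_right : ℚ⟮y⟯ ≤ K) (mem_adjoin_simple_self ℚ y)
  have hgen : BiquadGen a b c (⟨x, hxK⟩ : K) ⟨y, hyK⟩ (⟨x, hxK⟩ * ⟨y, hyK⟩ / c) := by
    refine BiquadGen.of_sq hs h1 h2 h3 ?_ ?_ <;> apply Subtype.ext
    · simpa using hx
    · simpa using hy
  refine ⟨K, le_antisymm ?_ ?_, _, _, _, hgen⟩
  · calc Module.finrank ℚ K ≤ Module.finrank ℚ ℚ⟮x⟯ * Module.finrank ℚ ℚ⟮y⟯ := finrank_sup_le _ _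
      _ ≤ 2 * 2 := Nat.mul_le_mul (deg x _ hx) (deg y _ hy)
  · simpa using hgen.linearIndependent.fintype_card_le_finrank

theorem IsBiquadTriple.of_generatedBy {K : IntermediateField ℚ (AlgebraicClosure ℚ)}
    {t : ℤ × ℤ × ℤ} (h : GeneratedBy K t) (hc : 0 < t.2.2) : IsBiquadTriple t := by
  obtain ⟨-, x, y, z, h⟩ := h
  exact ⟨hc, h.sqf, h.hx, h.hy, h.hz⟩

/-- The map `(a, b, c) ↦ (b c, a c)` is a bijection onto ordered pairs of distinct radicands. There
are three radicands, hence `3 · 2` pairs. -/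
theorem GeneratedBy.ncard_triples {K : IntermediateField ℚ (AlgebraicClosure ℚ)}
    {t : ℤ × ℤ × ℤ} (h : GeneratedBy K t) :
    {u : ℤ × ℤ × ℤ | 0 < u.2.2 ∧ GeneratedBy K u}.ncard = 6 := by
  obtain ⟨a, b, c⟩ := t
  obtain ⟨hK, x, y, z, h⟩ := h
  simp only at h
  have distinct : ∀ {a b c : ℤ} {x y z : K}, BiquadGen a b c x y z → b * c ≠ a * c := by
    intro a b c x y z h e
    have e' : b = a := mul_right_cancel₀ h.c_ne_zero e
    subst e'
    have hb := h.sqfZ b dvd_rfl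
    exact h.hz (by rcases Int.isUnit_iff.mp hb with e | e <;> rw [e] <;> rfl)
  set S : Finset ℤ := {b * c, a * c, a * b} with hS
  have hcard : S.card = 3 := by
    rw [hS, Finset.card_eq_three]
    refine ⟨_, _, _, distinct h, ?_, ?_, rfl⟩
    · have := distinct h.rotate.rotate
      intro e
      exact this (by rw [← e]; ring)
    · have := distinct h.rotate
      intro e
      exact this (by linarith)
  have hoff : S.offDiag.card = 6 := by rw [Finset.offDiag_card, hcard]
  have memS : ∀ {d : ℤ}, d ∈ S ↔ Squarefree d ∧ d ≠ 1 ∧ ∃ w : K, w ^ 2 = d := by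
    intro d
    rw [hS, Finset.mem_insert, Finset.mem_insert, Finset.mem_singleton]
    constructor
    · rintro (rfl | rfl | rfl)
      · exact ⟨h.sqfX, h.hx, x, by simpa using h.xx⟩
      · exact ⟨h.sqfY, h.hy, y, by simpa using h.yy⟩
      · exact ⟨h.sqfZ, h.hz, z, by simpa using h.zz⟩
    · rintro ⟨h1, h2, w, hw⟩
      exact h.eq_of_sq_eq hK h1 h2 hw
  rw [← hoff, ← Set.ncard_coe_finset]
  refine Set.ncard_congr (fun u _ => (u.2.1 * u.2.2, u.1 * u.2.2)) ?_ ?_ ?_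
  · rintro ⟨a', b', c'⟩ ⟨-, -, x', y', z', h'⟩
    simp only at h'
    rw [Finset.mem_coe, Finset.mem_offDiag]
    exact ⟨memS.mpr ⟨h'.sqfX, h'.hx, x', by simpa using h'.xx⟩,
      memS.mpr ⟨h'.sqfY, h'.hy, y', by simpa using h'.yy⟩, distinct h'⟩
  · rintro ⟨a₁, b₁, c₁⟩ ⟨a₂, b₂, c₂⟩ ⟨hc1, -, x₁, y₁, z₁, h₁⟩ ⟨hc2, -, x₂, y₂, z₂, h₂⟩ e
    simp only [Prod.mk.injEq] at e h₁ h₂ hc1 hc2 ⊢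
    obtain ⟨e1, e2⟩ := e
    have hc1' : (c₁ : ℚ) ≠ 0 := by exact_mod_cast hc1.ne'
    -- The product `a b` is the squarefree part of `(a c) (b c)`, so it is determined by the pair;
    -- then `c ^ 2` is determined too, and `c` by positivity.
    have hab : a₁ * b₁ = a₂ * b₂ := by
      refine eq_of_squarefree_of_rat_sq_mul h₁.sqfZ h₂.sqfZ (q := c₂ / c₁) ?_
      have e1' : (b₁ * c₁ : ℚ) = b₂ * c₂ := by exact_mod_cast e1
      have e2' : (a₁ * c₁ : ℚ) = a₂ * c₂ := by exact_mod_cast e2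
      push_cast
      field_simp
      linear_combination (a₁ * c₁ : ℚ) * e1' + (b₂ * c₂ : ℚ) * e2'
    have hcc : c₁ = c₂ := by
      have h0 : a₂ * b₂ ≠ 0 := h₂.sqfZ.ne_zero
      have h1 : c₁ ^ 2 = c₂ ^ 2 := by
        apply mul_left_cancel₀ h0
        calc a₂ * b₂ * c₁ ^ 2 = (a₁ * c₁) * (b₁ * c₁) := by rw [← hab]; ring
          _ = a₂ * b₂ * c₂ ^ 2 := by rw [e1, e2]; ring
      exact (sq_eq_sq₀ hc1.le hc2.le).mp h1
    subst hcc
    exact ⟨mul_right_cancel₀ hc1.ne' e2, mul_right_cancel₀ hc1.ne' e1, rfl⟩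
  · rintro ⟨d, e⟩ hde
    rw [Finset.mem_coe, Finset.mem_offDiag] at hde
    obtain ⟨hd, he, hde⟩ := hde
    simp only at hd he hde
    obtain ⟨hd1, hd2, w, hw⟩ := memS.mp hd
    obtain ⟨he1, he2, v, hv⟩ := memS.mp he
    obtain ⟨a', b', c', hc', rfl, rfl, hs, hab⟩ := squarefree_triple hd1 he1 hde
    exact ⟨(a', b', c'), ⟨hc', hK, w, v, _, BiquadGen.of_sq hs hd2 he2 hab (by simpa using hw)
      (by simpa using hv)⟩, rfl⟩

/-- The square root of the discriminant of the field attached to a triple. -/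
def tripleHeight (t : ℤ × ℤ × ℤ) : ℕ :=
  ramFactor t.1 t.2.1 t.2.2 * (t.1 * t.2.1 * t.2.2).natAbs

/-- The sign condition on triples. -/
def FieldSign.HoldsTriple (t : ℤ × ℤ × ℤ) : FieldSign → Prop
  | .plus => 0 < t.1 ∧ 0 < t.2.1
  | .minus => ¬ (0 < t.1 ∧ 0 < t.2.1)

/-- The triples of sign `σ` attached to fields of discriminant at most `X`. -/
def biquadTriples (σ : FieldSign) (X : ℝ) : Set (ℤ × ℤ × ℤ) :=
  {t | IsBiquadTriple t ∧ σ.HoldsTriple t ∧ (tripleHeight t : ℝ) ^ 2 ≤ X}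

theorem GeneratedBy.mem_iff {K : IntermediateField ℚ (AlgebraicClosure ℚ)}
    {t : ℤ × ℤ × ℤ} (h : GeneratedBy K t) (hc : 0 < t.2.2) (σ : FieldSign) (X : ℝ) :
    K ∈ biquadraticFields σ X ↔ t ∈ biquadTriples σ X := by
  have hidx := IsBiquadTriple.of_generatedBy h hc
  have hnf := h.numberField
  obtain ⟨hK, x, y, z, h⟩ := h
  have hs := h.holds_iff hK hc σ
  have hd : (NumberField.discr K : ℝ) = (tripleHeight t : ℝ) ^ 2 := by
    rw [h.discr hK, tripleHeight]
    push_cast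
    rw [mul_pow, mul_pow (_ : ℝ) (((t.1 * t.2.1 * t.2.2).natAbs : ℕ) : ℝ), Nat.cast_natAbs,
      Int.cast_abs, sq_abs]
    push_cast
    rfl
  have hs' : σ.Holds K ↔ σ.HoldsTriple t := by cases σ <;> exact hs
  constructor
  · rintro ⟨_, h1, h2, h3⟩
    exact ⟨hidx, hs'.mp h2, by rw [← hd]; exact h3⟩
  · rintro ⟨h1, h2, h3⟩
    exact ⟨hnf, h.isBiquadratic hK, hs'.mpr h2, by rw [hd]; exact h3⟩

theorem ramFactor_pos (a b c : ZMod 4) : 0 < ramFactor a b c := by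
  revert a b c; decide

theorem natAbs_le_of_squarefree {a b : ℤ} (h : Squarefree (a * b)) :
    a.natAbs ≤ (a * b).natAbs ∧ b.natAbs ≤ (a * b).natAbs := by
  rw [Int.natAbs_mul]
  have := h.ne_zero
  have h1 : a.natAbs ≠ 0 := by simp; rintro rfl; simp at this
  have h2 : b.natAbs ≠ 0 := by simp; rintro rfl; simp at this
  exact ⟨Nat.le_mul_of_pos_right _ (by omega), Nat.le_mul_of_pos_left _ (by omega)⟩

theorem biquadTriples_finite (σ : FieldSign) (X : ℝ) : (biquadTriples σ X).Finite := by
  obtain ⟨N, hN⟩ : ∃ N : ℤ, N = ((⌊|X|⌋₊ : ℕ) : ℤ) := ⟨_, rfl⟩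
  refine ((Set.finite_Icc (-N) N).prod ((Set.finite_Icc (-N) N).prod
    (Set.finite_Icc (-N) N))).subset ?_
  rintro ⟨a, b, c⟩ ⟨⟨hc, hs, -⟩, -, hX⟩
  simp only at hc hs
  have h1 := natAbs_le_of_squarefree hs
  have h2 := natAbs_le_of_squarefree (hs.squarefree_of_dvd ⟨c, rfl⟩ : Squarefree (a * b))
  have h3 : (a * b * c).natAbs ≤ tripleHeight (a, b, c) :=
    Nat.le_mul_of_pos_left _ (ramFactor_pos _ _ _)
  have h4 : tripleHeight (a, b, c) ≤ ⌊|X|⌋₊ := by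
    apply Nat.le_floor
    have : tripleHeight (a, b, c) ≤ tripleHeight (a, b, c) ^ 2 := Nat.le_self_pow two_ne_zero _
    calc (tripleHeight (a, b, c) : ℝ) ≤ (tripleHeight (a, b, c) : ℝ) ^ 2 := by exact_mod_cast this
      _ ≤ X := hX
      _ ≤ |X| := le_abs_self X
  have key : ∀ n : ℤ, n.natAbs ≤ ⌊|X|⌋₊ → n ∈ Set.Icc (-N) N := by
    intro n hn
    rw [Set.mem_Icc]
    omega
  exact ⟨key a (by omega), key b (by omega), key c (by omega)⟩

theorem biquadraticFields_finite_and_count (σ : FieldSign) (X : ℝ) :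
    (biquadraticFields σ X).Finite ∧ (biquadTriples σ X).ncard = 6 * biquadraticCount σ X := by
  classical
  have hfin := biquadTriples_finite σ X
  have hex : ∀ t : ℤ × ℤ × ℤ, ∃ K, IsBiquadTriple t → GeneratedBy K t := by
    intro t
    by_cases ht : IsBiquadTriple t
    · obtain ⟨K, hK⟩ := ht.exists_field
      exact ⟨K, fun _ => hK⟩
    · exact ⟨⊥, fun h => absurd h ht⟩
  choose F hF using hex
  have hmaps : ∀ t ∈ biquadTriples σ X, F t ∈ biquadraticFields σ X := fun t ht =>
    ((hF t ht.1).mem_iff ht.1.1 σ X).mpr ht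
  have hgen : ∀ K ∈ biquadraticFields σ X, ∃ t, 0 < t.2.2 ∧ GeneratedBy K t := by
    rintro K ⟨_, hK, -⟩
    obtain ⟨a, b, c, x, y, z, hc, h⟩ := hK.exists_gen
    exact ⟨(a, b, c), hc, hK.finrank_eq, x, y, z, h⟩
  have hFK : ∀ K t, 0 < t.2.2 → GeneratedBy K t → F t = K := fun K t hc h =>
    (hF t (IsBiquadTriple.of_generatedBy h hc)).eq h
  have hfin' : (biquadraticFields σ X).Finite := by
    refine (hfin.image F).subset ?_
    intro K hK
    obtain ⟨t, hc, ht⟩ := hgen K hK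
    exact ⟨t, (ht.mem_iff hc σ X).mp hK, hFK K t hc ht⟩
  refine ⟨hfin', ?_⟩
  rw [biquadraticCount, Set.ncard_eq_toFinset_card _ hfin, Set.ncard_eq_toFinset_card _ hfin']
  rw [Finset.card_eq_sum_card_fiberwise (f := F) (t := hfin'.toFinset) (fun t ht => by
    simp only [Set.Finite.coe_toFinset] at ht ⊢
    exact hmaps t ht)]
  rw [Finset.sum_const_nat (m := 6), mul_comm]
  intro K hK
  rw [Set.Finite.mem_toFinset] at hK
  obtain ⟨t, hc, ht⟩ := hgen K hK
  rw [← ht.ncard_triples, ← Set.ncard_coe_finset]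
  congr 1
  ext u
  simp only [Finset.coe_filter, Set.Finite.mem_toFinset, Set.mem_ofPred_eq]
  constructor
  · rintro ⟨h1, rfl⟩
    exact ⟨h1.1.1, hF u h1.1⟩
  · rintro ⟨h1, h2⟩
    exact ⟨(h2.mem_iff h1 σ X).mp hK, hFK K u h1 h2⟩

/-! ### Threefold convolutions on odd squarefree numbers and their correction factor -/

/-- Convergence of a nonnegative multiplicative series from a bound on its Euler factors. -/
theorem summable_of_eulerFactor_le {F : ℕ → ℝ} (h0 : F 0 = 0) (h1 : F 1 = 1) (hF : ∀ n, 0 ≤ F n)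
    (hmul : ∀ {m n : ℕ}, m.Coprime n → F (m * n) = F m * F n)
    (hsum : ∀ {p : ℕ}, p.Prime → Summable (fun k : ℕ => F (p ^ k)))
    {B : ℕ → ℝ} (hB : Summable B) (hB0 : ∀ n, 0 ≤ B n)
    (hle : ∀ p : ℕ, p.Prime → ∑' k : ℕ, F (p ^ k) ≤ 1 + B p) : Summable F := by
  refine summable_of_sum_range_le (c := Real.exp (∑' n, B n)) hF fun N => ?_
  have hs := (EulerProduct.summable_and_hasSum_smoothNumbers_prod_primesBelow_tsum h1 hmul
    (fun hp => (hsum hp).norm) N).2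
  -- Every positive integer below `N` is `N`-smooth, so this finite Euler product dominates the
  -- partial sum.
  have hs' : HasSum ((Nat.smoothNumbers N).indicator F)
      (∏ p ∈ N.primesBelow, ∑' k : ℕ, F (p ^ k)) :=
    (hasSum_subtype_iff_indicator (s := Nat.smoothNumbers N)).mp hs
  calc ∑ i ∈ Finset.range N, F i
      = ∑ i ∈ Finset.range N, (Nat.smoothNumbers N).indicator F i := by
        refine Finset.sum_congr rfl fun i hi => ?_
        rcases Nat.eq_zero_or_pos i with rfl | hpos
        · rw [h0, Set.indicator_apply, h0, ite_self]
        · rw [Set.indicator_of_mem]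
          exact Nat.mem_smoothNumbers_of_lt hpos (Finset.mem_range.mp hi)
    _ ≤ ∏ p ∈ N.primesBelow, ∑' k : ℕ, F (p ^ k) :=
        sum_le_hasSum _ (fun i _ => Set.indicator_nonneg (fun n _ => hF n) i) hs'
    _ ≤ ∏ p ∈ N.primesBelow, Real.exp (B p) := by
        refine Finset.prod_le_prod (fun p _ => tsum_nonneg fun k => hF _) fun p hp => ?_
        have := hle p (Nat.prime_of_mem_primesBelow hp)
        have := Real.add_one_le_exp (B p)
        linarith
    _ = Real.exp (∑ p ∈ N.primesBelow, B p) := (Real.exp_sum _ _).symm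
    _ ≤ Real.exp (∑' n, B n) := Real.exp_le_exp.mpr (hB.sum_le_tsum _ fun n _ => hB0 n)

namespace ArithmeticFunction

/-- Complete multiplicativity. -/
structure IsCompletelyMultiplicative (u : ArithmeticFunction ℝ) : Prop where
  map_one : u 1 = 1
  map_mul : ∀ m n, u (m * n) = u m * u n

/-- The Dirichlet inverse of a completely multiplicative function. -/
noncomputable def twistedMoebius (u : ArithmeticFunction ℝ) : ArithmeticFunction ℝ :=
  pmul (moebius : ArithmeticFunction ℝ) u

namespace IsCompletelyMultiplicative

variable {u : ArithmeticFunction ℝ}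

theorem isMultiplicative (hu : IsCompletelyMultiplicative u) : u.IsMultiplicative :=
  ⟨hu.map_one, fun _ => hu.map_mul _ _⟩

theorem isMultiplicative_twistedMoebius (hu : IsCompletelyMultiplicative u) :
    (twistedMoebius u).IsMultiplicative :=
  isMultiplicative_moebius.intCast.pmul hu.isMultiplicative

/-- Pointwise multiplication by a completely multiplicative function respects convolution, so the
identity is the twist by `u` of Möbius inversion. -/
theorem mul_twistedMoebius (hu : IsCompletelyMultiplicative u) : u * twistedMoebius u = 1 := by
  have h1 : u * twistedMoebius u
      = pmul ((zeta : ArithmeticFunction ℝ) * (moebius : ArithmeticFunction ℝ)) u := by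
    ext n
    rw [mul_apply, pmul_apply, mul_apply, Finset.sum_mul]
    refine Finset.sum_congr rfl fun x hx => ?_
    obtain ⟨hx1, hx2⟩ := Nat.mem_divisorsAntidiagonal.mp hx
    have hx0 : x.1 ≠ 0 := by rintro h; simp [h] at hx1; exact hx2 hx1.symm
    rw [twistedMoebius, pmul_apply, ← hx1, hu.map_mul, natCoe_apply, zeta_apply_ne hx0]
    push_cast
    ring
  rw [h1, coe_zeta_mul_coe_moebius]
  ext n
  rw [pmul_apply]
  by_cases hn : n = 1
  · subst hn; simp [hu.map_one]
  · simp [one_apply_ne hn]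

/-- The local series of `twistedMoebius u` at `p` is `1 - u(p) X`. -/
theorem mul_twistedMoebius_prime_pow (hu : IsCompletelyMultiplicative u)
    (g : ArithmeticFunction ℝ) {p : ℕ} (hp : p.Prime) (k : ℕ) :
    (g * twistedMoebius u) (p ^ (k + 1)) = g (p ^ (k + 1)) - u p * g (p ^ k) := by
  rw [mul_apply, Nat.sum_divisorsAntidiagonal' (f := fun a b => g a * twistedMoebius u b),
    Nat.sum_divisors_prime_pow hp, Finset.sum_range_succ', Finset.sum_range_succ',
    Finset.sum_eq_zero]
  · have h1 : p ^ (k + 1) / p = p ^ k := by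
      rw [pow_succ, Nat.mul_div_cancel _ hp.pos]
    simp [twistedMoebius, moebius_apply_prime hp, h1, hu.map_one]
    ring
  · intro j _
    simp [twistedMoebius, moebius_apply_prime_pow hp]

end IsCompletelyMultiplicative

/-- The indicator function of odd squarefree numbers. -/
noncomputable def oddSquarefree : ArithmeticFunction ℝ :=
  ⟨fun n => if Squarefree n ∧ Odd n then 1 else 0, by simp⟩

theorem oddSquarefree_apply (n : ℕ) :
    oddSquarefree n = if Squarefree n ∧ Odd n then 1 else 0 := rfl

theorem isMultiplicative_oddSquarefree : oddSquarefree.IsMultiplicative := by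
  refine ⟨by simp [oddSquarefree_apply], fun {m n} hmn => ?_⟩
  simp only [oddSquarefree_apply, Nat.squarefree_mul hmn, Nat.odd_mul]
  by_cases h1 : Squarefree m <;> by_cases h2 : Squarefree n <;> by_cases h3 : Odd m <;>
    by_cases h4 : Odd n <;> simp [h1, h2, h3, h4]

/-- Weighted count of the factorizations of an odd squarefree number into three factors. -/
noncomputable def tripleWeight (u v w : ArithmeticFunction ℝ) : ArithmeticFunction ℝ :=
  oddSquarefree.pmul (u * v * w)

/-- The factor of `tripleWeight` complementary to `u * v * w`. -/
noncomputable def tripleCorrection (u v w : ArithmeticFunction ℝ) : ArithmeticFunction ℝ :=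
  tripleWeight u v w * twistedMoebius u * twistedMoebius v * twistedMoebius w

section

variable {u v w : ArithmeticFunction ℝ}

theorem tripleCorrection_mul (hu : IsCompletelyMultiplicative u)
    (hv : IsCompletelyMultiplicative v) (hw : IsCompletelyMultiplicative w) :
    tripleCorrection u v w * (u * v * w) = tripleWeight u v w := by
  have : tripleCorrection u v w * (u * v * w) = tripleWeight u v w * (u * twistedMoebius u) *
      (v * twistedMoebius v) * (w * twistedMoebius w) := by
    rw [tripleCorrection]; ring
  rw [this, hu.mul_twistedMoebius, hv.mul_twistedMoebius, hw.mul_twistedMoebius]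
  ring

theorem isMultiplicative_tripleWeight (hu : IsCompletelyMultiplicative u)
    (hv : IsCompletelyMultiplicative v) (hw : IsCompletelyMultiplicative w) :
    (tripleWeight u v w).IsMultiplicative :=
  isMultiplicative_oddSquarefree.pmul
    ((hu.isMultiplicative.mul hv.isMultiplicative).mul hw.isMultiplicative)

theorem isMultiplicative_tripleCorrection (hu : IsCompletelyMultiplicative u)
    (hv : IsCompletelyMultiplicative v) (hw : IsCompletelyMultiplicative w) :
    (tripleCorrection u v w).IsMultiplicative :=
  (((isMultiplicative_tripleWeight hu hv hw).mul hu.isMultiplicative_twistedMoebius).mul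
    hv.isMultiplicative_twistedMoebius).mul hw.isMultiplicative_twistedMoebius

theorem mul_apply_prime (f g : ArithmeticFunction ℝ) {p : ℕ} (hp : p.Prime) :
    (f * g) p = f 1 * g p + f p * g 1 := by
  rw [mul_apply, Nat.sum_divisorsAntidiagonal (f := fun a b => f a * g b), hp.divisors,
    Finset.sum_pair hp.one_lt.ne, Nat.div_one, Nat.div_self hp.pos]

theorem tripleWeight_prime (hu : IsCompletelyMultiplicative u)
    (hv : IsCompletelyMultiplicative v) (hw : IsCompletelyMultiplicative w) {p : ℕ}
    (hp : p.Prime) (hodd : Odd p) : tripleWeight u v w p = u p + v p + w p := by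
  rw [tripleWeight, pmul_apply, oddSquarefree_apply, if_pos ⟨hp.prime.squarefree, hodd⟩, one_mul,
    mul_apply_prime _ _ hp, mul_apply_prime _ _ hp,
    (hu.isMultiplicative.mul hv.isMultiplicative).map_one, hu.map_one, hv.map_one, hw.map_one]
  ring

theorem tripleWeight_two_pow (k : ℕ) : tripleWeight u v w (2 ^ (k + 1)) = 0 := by
  rw [tripleWeight, pmul_apply, oddSquarefree_apply, if_neg, zero_mul]
  rintro ⟨-, h⟩
  rw [← Nat.not_even_iff_odd] at h
  exact h ⟨2 ^ k, by ring⟩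

theorem tripleWeight_prime_pow {p : ℕ} (hp : p.Prime) (k : ℕ) :
    tripleWeight u v w (p ^ (k + 2)) = 0 := by
  rw [tripleWeight, pmul_apply, oddSquarefree_apply, if_neg, zero_mul]
  rintro ⟨h, -⟩
  have := h p ⟨p ^ k, by ring⟩
  exact hp.not_isUnit this

/-- The local factor is `1 + (u + v + w) X` times `(1 - u X) (1 - v X) (1 - w X)`, whose linear
terms cancel. This cancellation gives convergence to the left of 1. -/
theorem tripleCorrection_prime (hu : IsCompletelyMultiplicative u)
    (hv : IsCompletelyMultiplicative v) (hw : IsCompletelyMultiplicative w) {p : ℕ}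
    (hp : p.Prime) (hodd : Odd p) : tripleCorrection u v w p = 0 := by
  have h1 := (isMultiplicative_tripleWeight hu hv hw).map_one
  have e1 := IsCompletelyMultiplicative.mul_twistedMoebius_prime_pow hu (tripleWeight u v w) hp 0
  have e2 := IsCompletelyMultiplicative.mul_twistedMoebius_prime_pow hv
    (tripleWeight u v w * twistedMoebius u) hp 0
  have e3 := IsCompletelyMultiplicative.mul_twistedMoebius_prime_pow hw
    (tripleWeight u v w * twistedMoebius u * twistedMoebius v) hp 0
  have m1 := ((isMultiplicative_tripleWeight hu hv hw).mul hu.isMultiplicative_twistedMoebius)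
  have m2 := m1.mul hv.isMultiplicative_twistedMoebius
  simp only [zero_add, pow_one, pow_zero, h1, m1.map_one, m2.map_one] at e1 e2 e3
  rw [tripleCorrection, e3, e2, e1, tripleWeight_prime hu hv hw hp hodd]
  ring

theorem abs_mul_twistedMoebius_le (hu : IsCompletelyMultiplicative u) (hb : ∀ n, |u n| ≤ 1)
    {g : ArithmeticFunction ℝ} {M : ℝ} {p : ℕ} (hp : p.Prime)
    (hg : ∀ k, |g (p ^ k)| ≤ M) (k : ℕ) : |(g * twistedMoebius u) (p ^ k)| ≤ 2 * M := by
  have hM : 0 ≤ M := (abs_nonneg _).trans (hg 0)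
  cases k with
  | zero =>
    have : (g * twistedMoebius u) 1 = g 1 := by
      simp [mul_apply, hu.isMultiplicative_twistedMoebius.map_one]
    have h0 := hg 0
    rw [pow_zero] at h0 ⊢
    rw [this]
    linarith
  | succ k =>
    rw [IsCompletelyMultiplicative.mul_twistedMoebius_prime_pow hu g hp]
    calc |g (p ^ (k + 1)) - u p * g (p ^ k)| ≤ |g (p ^ (k + 1))| + |u p * g (p ^ k)| := abs_sub _ _
      _ ≤ M + 1 * M := by
        rw [abs_mul]
        exact add_le_add (hg _) (mul_le_mul (hb p) (hg k) (abs_nonneg _) zero_le_one)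
      _ = 2 * M := by ring

/-- The weight is at most 3 on prime powers, and each of the three factors `1 - u(p) X` at most
doubles the bound. -/
theorem abs_tripleCorrection_le (hu : IsCompletelyMultiplicative u)
    (hv : IsCompletelyMultiplicative v) (hw : IsCompletelyMultiplicative w)
    (bu : ∀ n, |u n| ≤ 1) (bv : ∀ n, |v n| ≤ 1) (bw : ∀ n, |w n| ≤ 1) {p : ℕ} (hp : p.Prime)
    (k : ℕ) : |tripleCorrection u v w (p ^ k)| ≤ 24 := by
  have h : ∀ k, |tripleWeight u v w (p ^ k)| ≤ 3 := by
    intro k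
    match k with
    | 0 => simp [(isMultiplicative_tripleWeight hu hv hw).map_one]
    | 1 =>
      rcases hp.eq_two_or_odd' with rfl | hodd
      · simpa using (congrArg abs (tripleWeight_two_pow (u := u) (v := v) (w := w) 0)).le.trans
          (by norm_num : |(0 : ℝ)| ≤ 3)
      · rw [pow_one, tripleWeight_prime hu hv hw hp hodd]
        have := abs_add_three (u p) (v p) (w p)
        linarith [bu p, bv p, bw p]
    | k + 2 => rw [tripleWeight_prime_pow hp]; simp
  have := abs_mul_twistedMoebius_le hw bw hp (abs_mul_twistedMoebius_le hv bv hp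
    (abs_mul_twistedMoebius_le hu bu hp h)) k
  rw [tripleCorrection]
  linarith

/-- Absolute convergence of the correction series to the left of `1`. -/
theorem summable_tripleCorrection (hu : IsCompletelyMultiplicative u)
    (hv : IsCompletelyMultiplicative v) (hw : IsCompletelyMultiplicative w)
    (bu : ∀ n, |u n| ≤ 1) (bv : ∀ n, |v n| ≤ 1) (bw : ∀ n, |w n| ≤ 1) :
    Summable fun n : ℕ => |tripleCorrection u v w n| * (n : ℝ) ^ (-(3 / 4) : ℝ) := by
  have hm := isMultiplicative_tripleCorrection hu hv hw
  have key : ∀ p : ℕ, p.Prime → ∃ x : ℝ, x = (p : ℝ) ^ (-(3 / 4) : ℝ) ∧ 0 ≤ x ∧ x ≤ 3 / 5 ∧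
      ∀ k : ℕ, ((p ^ k : ℕ) : ℝ) ^ (-(3 / 4) : ℝ) = x ^ k := by
    intro p hp
    refine ⟨_, rfl, by positivity, ?_, ?_⟩
    · have h2 : (2 : ℝ) ≤ p := by exact_mod_cast hp.two_le
      calc (p : ℝ) ^ (-(3 / 4) : ℝ) ≤ (2 : ℝ) ^ (-(3 / 4) : ℝ) :=
            Real.rpow_le_rpow_of_nonpos two_pos h2 (by norm_num)
        _ ≤ 3 / 5 := by
            rw [Real.rpow_neg two_pos.le, inv_le_comm₀ (by positivity) (by norm_num)]
            refine le_of_pow_le_pow_left₀ (n := 4) (by norm_num) (by positivity) ?_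
            rw [← Real.rpow_natCast ((2 : ℝ) ^ (3 / 4 : ℝ)) 4, ← Real.rpow_mul two_pos.le]
            norm_num
    · intro k
      push_cast
      rw [← Real.rpow_natCast, ← Real.rpow_mul (by positivity), mul_comm,
        Real.rpow_mul (by positivity), Real.rpow_natCast]
  have hgeo : ∀ x : ℝ, 0 ≤ x → x ≤ 3 / 5 → HasSum (fun k : ℕ => x ^ k) (1 - x)⁻¹ :=
    fun x h0 h1 => hasSum_geometric_of_lt_one h0 (by linarith)
  have hsum : ∀ p : ℕ, p.Prime → Summable (fun k : ℕ =>
      |tripleCorrection u v w (p ^ k)| * ((p ^ k : ℕ) : ℝ) ^ (-(3 / 4) : ℝ)) := by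
    intro p hp
    obtain ⟨x, -, h0, h1, hx⟩ := key p hp
    refine Summable.of_nonneg_of_le (fun k => by positivity) (fun k => ?_)
      ((hgeo x h0 h1).summable.mul_left 24)
    rw [hx]
    exact mul_le_mul_of_nonneg_right (abs_tripleCorrection_le hu hv hw bu bv bw hp k) (by positivity)
  -- Put `x = p ^ (-3/4) ≤ 3/5`, so that `1 / (1 - x) ≤ 5/2`. For odd `p` the linear term vanishes
  -- and the tail is at most `60 x ^ 2`. At 2 the whole factor is at most 60, and `300 x ^ 2 ≥ 75`
  -- covers it.
  refine summable_of_eulerFactor_le (B := fun n => 300 * (n : ℝ) ^ (-(3 / 2) : ℝ)) (by simp)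
    (by simp [hm.map_one]) (fun n => by positivity) ?_ (fun hp => hsum _ hp) ?_
    (fun n => by positivity) ?_
  · intro m n hmn
    rw [hm.map_mul_of_coprime hmn, abs_mul]
    push_cast
    rw [Real.mul_rpow (by positivity) (by positivity)]
    ring
  · exact (Real.summable_nat_rpow.mpr (by norm_num)).mul_left _
  · intro p hp
    obtain ⟨x, hxp, h0, h1, hx⟩ := key p hp
    have hx2 : (p : ℝ) ^ (-(3 / 2) : ℝ) = x ^ 2 := by
      rw [hxp, ← Real.rpow_natCast, ← Real.rpow_mul (by positivity)]
      norm_num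
    have hG : (1 - x)⁻¹ ≤ 5 / 2 := by
      rw [inv_le_comm₀ (by linarith) (by norm_num)]; linarith
    rw [hx2]
    rcases hp.eq_two_or_odd' with rfl | hodd
    · calc ∑' k : ℕ, |tripleCorrection u v w (2 ^ k)| * ((2 ^ k : ℕ) : ℝ) ^ (-(3 / 4) : ℝ)
          ≤ ∑' k : ℕ, 24 * x ^ k := by
            refine (hsum 2 hp).tsum_le_tsum (fun k => ?_) ((hgeo x h0 h1).summable.mul_left 24)
            rw [hx]
            exact mul_le_mul_of_nonneg_right (abs_tripleCorrection_le hu hv hw bu bv bw hp k)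
              (by positivity)
        _ = 24 * (1 - x)⁻¹ := by rw [tsum_mul_left, (hgeo x h0 h1).tsum_eq]
        _ ≤ 1 + 300 * x ^ 2 := by
            have : (1 : ℝ) / 4 ≤ x ^ 2 := by
              rw [← hx2]
              calc (1 : ℝ) / 4 = (2 : ℝ) ^ (-2 : ℝ) := by norm_num [Real.rpow_neg]
                _ ≤ ((2 : ℕ) : ℝ) ^ (-(3 / 2) : ℝ) := by
                  push_cast
                  exact Real.rpow_le_rpow_of_exponent_le (by norm_num) (by norm_num)
            linarith
    · rw [← (hsum p hp).sum_add_tsum_nat_add 2]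
      have hz : ∑ k ∈ Finset.range 2, |tripleCorrection u v w (p ^ k)| *
          ((p ^ k : ℕ) : ℝ) ^ (-(3 / 4) : ℝ) = 1 := by
        simp [Finset.sum_range_succ, hm.map_one, tripleCorrection_prime hu hv hw hp hodd]
      rw [hz]
      have : ∑' k : ℕ, |tripleCorrection u v w (p ^ (k + 2))| *
          ((p ^ (k + 2) : ℕ) : ℝ) ^ (-(3 / 4) : ℝ) ≤ ∑' k : ℕ, 24 * x ^ 2 * x ^ k := by
        refine ((summable_nat_add_iff 2).mpr (hsum p hp)).tsum_le_tsum (fun k => ?_)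
          ((hgeo x h0 h1).summable.mul_left _)
        rw [hx, mul_assoc, ← pow_add, add_comm 2 k]
        exact mul_le_mul_of_nonneg_right (abs_tripleCorrection_le hu hv hw bu bv bw hp _)
          (by positivity)
      rw [tsum_mul_left, (hgeo x h0 h1).tsum_eq] at this
      have h3 : 24 * x ^ 2 * (1 - x)⁻¹ ≤ 24 * x ^ 2 * (5 / 2) :=
        mul_le_mul_of_nonneg_left hG (by positivity)
      nlinarith [sq_nonneg x]

end

end ArithmeticFunction

/-! ### Elementary divisor sums and transfer through convolution -/

open Finset

theorem log_natCast_sub_bounds {N : ℕ} (hN : 0 < N) :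
    1 / ((N : ℝ) + 1) ≤ Real.log ((N : ℝ) + 1) - Real.log N ∧
      Real.log ((N : ℝ) + 1) - Real.log N ≤ 1 / N := by
  have hN' : (0 : ℝ) < N := by exact_mod_cast hN
  constructor
  · have := Real.log_le_sub_one_of_pos (x := (N : ℝ) / (N + 1)) (by positivity)
    rw [Real.log_div (by positivity) (by positivity)] at this
    have e : (N : ℝ) / (N + 1) - 1 = -(1 / (N + 1)) := by field_simp; ring
    linarith
  · have := Real.log_le_sub_one_of_pos (x := ((N : ℝ) + 1) / N) (by positivity)
    rw [Real.log_div (by positivity) (by positivity)] at this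
    have e : ((N : ℝ) + 1) / N - 1 = 1 / N := by field_simp; ring
    linarith

/-- The sum of `log (Z / d) / d`, with `L = log Z`. -/
theorem sum_log_div_bounds {L : ℝ} {N : ℕ} (hN : 0 < N) (hL : Real.log N ≤ L) :
    (L ^ 2 - (L - Real.log N) ^ 2) / 2 ≤ ∑ d ∈ Ioc 0 N, (L - Real.log d) / d ∧
      ∑ d ∈ Ioc 0 N, (L - Real.log d) / d ≤ L + L ^ 2 / 2 := by
  -- Comparison with the integral of `(L - log u) / u`. For the induction to close, the lower bound
  -- retains the last summand and the upper bound retains the first summand `L`.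
  have key : ∀ N : ℕ, 0 < N → Real.log N ≤ L →
      (L ^ 2 - (L - Real.log N) ^ 2) / 2 + (L - Real.log N) / N
        ≤ ∑ d ∈ Ioc 0 N, (L - Real.log d) / d ∧
      ∑ d ∈ Ioc 0 N, (L - Real.log d) / d ≤ L + (L ^ 2 - (L - Real.log N) ^ 2) / 2 := by
    intro N hN
    induction N, hN using Nat.le_induction with
    | base => intro h; simp
    | succ N hN ih =>
      intro h
      push_cast at h
      obtain ⟨b1, b2⟩ := log_natCast_sub_bounds hN
      have hN' : (0 : ℝ) < N := by exact_mod_cast hN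
      have hlt : Real.log N ≤ Real.log ((N : ℝ) + 1) :=
        Real.log_le_log hN' (by linarith)
      obtain ⟨i1, i2⟩ := ih (by linarith)
      rw [sum_Ioc_succ_top (Nat.zero_le N)]
      push_cast
      set t := L - Real.log N
      set t' := L - Real.log ((N : ℝ) + 1) with ht'
      have e : Real.log ((N : ℝ) + 1) - Real.log N = t - t' := by ring
      rw [e] at b1 b2
      have ht0 : 0 ≤ t' := by linarith
      have htt : t' ≤ t := by linarith
      have d1 : t' / (N + 1) ≤ (t - t') * t' := by
        rw [div_eq_mul_one_div, mul_comm]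
        exact mul_le_mul_of_nonneg_right b1 ht0
      have d2 : (t - t') * t ≤ t / N := by
        rw [div_eq_mul_one_div, mul_comm t]
        exact mul_le_mul_of_nonneg_right b2 (ht0.trans htt)
      constructor
      · nlinarith [sq_nonneg (t - t')]
      · nlinarith [sq_nonneg (t - t')]
  obtain ⟨h1, h2⟩ := key N hN hL
  have h3 : 0 ≤ (L - Real.log N) / N := div_nonneg (by linarith) (Nat.cast_nonneg _)
  exact ⟨by linarith, by nlinarith [sq_nonneg (L - Real.log N)]⟩

theorem sum_one_div_bounds (N : ℕ) :
    Real.log ((N : ℝ) + 1) ≤ ∑ d ∈ Ioc 0 N, 1 / (d : ℝ) ∧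
      ∑ d ∈ Ioc 0 N, 1 / (d : ℝ) ≤ 1 + Real.log N := by
  have h : ((harmonic N : ℚ) : ℝ) = ∑ d ∈ Ioc 0 N, 1 / (d : ℝ) := by
    rw [harmonic_eq_sum_Icc]
    push_cast
    refine sum_congr ?_ fun d _ => by rw [one_div]
    ext; simp [Nat.lt_iff_add_one_le]
  rw [← h]
  exact ⟨by exact_mod_cast log_add_one_le_harmonic N, harmonic_le_one_add_log N⟩

namespace ArithmeticFunction

/-- The constant function `1` with real values. -/
noncomputable abbrev realZeta : ArithmeticFunction ℝ := (zeta : ArithmeticFunction ℝ)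

theorem sum_realZeta (N : ℕ) : ∑ n ∈ Ioc 0 N, realZeta n = N := by
  have := sum_Ioc_zeta N
  simp only [natCoe_apply]
  exact_mod_cast this

theorem floor_bounds {Z : ℝ} (hZ : 1 ≤ Z) :
    0 < ⌊Z⌋₊ ∧ (⌊Z⌋₊ : ℝ) ≤ Z ∧ Z < (⌊Z⌋₊ : ℝ) + 1 ∧ Real.log ⌊Z⌋₊ ≤ Real.log Z ∧
      Real.log Z ≤ Real.log ((⌊Z⌋₊ : ℝ) + 1) := by
  have h1 : 0 < ⌊Z⌋₊ := Nat.floor_pos.mpr hZ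
  have h2 : (⌊Z⌋₊ : ℝ) ≤ Z := Nat.floor_le (by linarith)
  have h3 : Z < (⌊Z⌋₊ : ℝ) + 1 := Nat.lt_floor_add_one Z
  exact ⟨h1, h2, h3, Real.log_le_log (by exact_mod_cast h1) h2,
    Real.log_le_log (by linarith) h3.le⟩

theorem one_le_div_of_mem {Z : ℝ} (hZ : 1 ≤ Z) {d : ℕ} (hd : d ∈ Ioc 0 ⌊Z⌋₊) :
    (0 : ℝ) < d ∧ (1 : ℝ) ≤ Z / d := by
  rw [mem_Ioc] at hd
  have h0 : (0 : ℝ) < d := by exact_mod_cast hd.1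
  refine ⟨h0, ?_⟩
  rw [le_div_iff₀ h0, one_mul]
  exact (Nat.le_floor_iff (by linarith)).mp hd.2

/-- The sum is that of `⌊Z / d⌋`. Removing the floors costs at most `Z`, and the harmonic sum lies
between `log Z` and `1 + log Z`. -/
theorem abs_sum_zeta_sq_sub_le {Z : ℝ} (hZ : 1 ≤ Z) :
    |∑ n ∈ Ioc 0 ⌊Z⌋₊, (realZeta * realZeta) n - Z * Real.log Z| ≤ Z := by
  obtain ⟨h1, h2, h3, h4, h5⟩ := floor_bounds hZ
  obtain ⟨s1, s2⟩ := sum_one_div_bounds ⌊Z⌋₊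
  rw [sum_Ioc_mul_eq_sum_sum]
  have e : ∀ d ∈ Ioc 0 ⌊Z⌋₊, realZeta d * ∑ m ∈ Ioc 0 (⌊Z⌋₊ / d), realZeta m
      = (⌊Z / d⌋₊ : ℝ) := by
    intro d hd
    rw [mem_Ioc] at hd
    rw [sum_realZeta, natCoe_apply, zeta_apply_ne hd.1.ne', Nat.floor_div_natCast]
    simp
  rw [sum_congr rfl e, abs_le]
  have up : ∑ d ∈ Ioc 0 ⌊Z⌋₊, (⌊Z / d⌋₊ : ℝ) ≤ Z * ∑ d ∈ Ioc 0 ⌊Z⌋₊, 1 / (d : ℝ) := by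
    rw [mul_sum]
    refine sum_le_sum fun d hd => ?_
    rw [mul_one_div]
    exact Nat.floor_le (by positivity)
  have lo : Z * ∑ d ∈ Ioc 0 ⌊Z⌋₊, 1 / (d : ℝ) - ⌊Z⌋₊ ≤ ∑ d ∈ Ioc 0 ⌊Z⌋₊, (⌊Z / d⌋₊ : ℝ) := by
    have : (⌊Z⌋₊ : ℝ) = ∑ d ∈ Ioc 0 ⌊Z⌋₊, (1 : ℝ) := by simp
    rw [mul_sum]
    conv_lhs => rw [this]
    rw [← sum_sub_distrib]
    refine sum_le_sum fun d hd => ?_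
    rw [mul_one_div]
    linarith [Nat.lt_floor_add_one (Z / d)]
  constructor <;> nlinarith

theorem sum_zeta_sq_le {Z : ℝ} (hZ : 1 ≤ Z) :
    ∑ n ∈ Ioc 0 ⌊Z⌋₊, (realZeta * realZeta) n ≤ Z * (1 + Real.log Z) := by
  have := (abs_le.mp (abs_sum_zeta_sq_sub_le hZ)).2
  linarith

/-- The three-fold divisor problem with the trivial error term. -/
theorem abs_sum_zeta_cube_sub_le {Z : ℝ} (hZ : 1 ≤ Z) :
    |∑ n ∈ Ioc 0 ⌊Z⌋₊, (realZeta * realZeta * realZeta) n - Z * (Real.log Z) ^ 2 / 2|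
      ≤ 2 * (Z * (1 + Real.log Z)) := by
  obtain ⟨h1, h2, h3, h4, h5⟩ := floor_bounds hZ
  obtain ⟨s1, s2⟩ := sum_one_div_bounds ⌊Z⌋₊
  obtain ⟨t1, t2⟩ := sum_log_div_bounds h1 h4
  have hN1 : (0 : ℝ) < ⌊Z⌋₊ := by exact_mod_cast h1
  rw [mul_assoc, sum_Ioc_mul_eq_sum_sum]
  have hmain : |∑ d ∈ Ioc 0 ⌊Z⌋₊, realZeta d * ∑ m ∈ Ioc 0 (⌊Z⌋₊ / d), (realZeta * realZeta) m
      - Z * ∑ d ∈ Ioc 0 ⌊Z⌋₊, (Real.log Z - Real.log d) / d|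
      ≤ Z * ∑ d ∈ Ioc 0 ⌊Z⌋₊, 1 / (d : ℝ) := by
    rw [mul_sum, mul_sum, ← sum_sub_distrib]
    refine (abs_sum_le_sum_abs _ _).trans (sum_le_sum fun d hd => ?_)
    obtain ⟨hd0, hd1⟩ := one_le_div_of_mem hZ hd
    have := abs_sum_zeta_sq_sub_le hd1
    rw [Nat.floor_div_natCast, Real.log_div (by positivity) hd0.ne'] at this
    rw [natCoe_apply, zeta_apply_ne (mem_Ioc.mp hd).1.ne', Nat.cast_one, one_mul, mul_one_div]
    convert! this using 3
    ring
  -- The boundary term `(log Z - log ⌊Z⌋) ^ 2 / 2` is harmless, since rounding down changes the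
  -- logarithm by at most 1.
  have hs : |∑ d ∈ Ioc 0 ⌊Z⌋₊, (Real.log Z - Real.log d) / d - (Real.log Z) ^ 2 / 2|
      ≤ 1 + Real.log Z := by
    have hl0 : 0 ≤ Real.log Z := Real.log_nonneg hZ
    have b0 : 0 ≤ Real.log Z - Real.log ⌊Z⌋₊ := by linarith
    have b1 : Real.log Z - Real.log ⌊Z⌋₊ ≤ 1 := by
      have := (log_natCast_sub_bounds h1).2
      have h7 : 1 / (⌊Z⌋₊ : ℝ) ≤ 1 := by
        rw [div_le_one hN1]; exact_mod_cast h1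
      linarith
    rw [abs_le]
    constructor <;> nlinarith
  have hs' : |Z * ∑ d ∈ Ioc 0 ⌊Z⌋₊, (Real.log Z - Real.log d) / d - Z * (Real.log Z) ^ 2 / 2|
      ≤ Z * (1 + Real.log Z) := by
    have e : Z * ∑ d ∈ Ioc 0 ⌊Z⌋₊, (Real.log Z - Real.log d) / d - Z * (Real.log Z) ^ 2 / 2
        = Z * (∑ d ∈ Ioc 0 ⌊Z⌋₊, (Real.log Z - Real.log d) / d - (Real.log Z) ^ 2 / 2) := by ring
    rw [e, abs_mul, abs_of_nonneg (by linarith)]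
    exact mul_le_mul_of_nonneg_left hs (by linarith)
  have h6 : Z * ∑ d ∈ Ioc 0 ⌊Z⌋₊, 1 / (d : ℝ) ≤ Z * (1 + Real.log Z) :=
    mul_le_mul_of_nonneg_left (by linarith) (by linarith)
  refine (abs_sub_le _ (Z * ∑ d ∈ Ioc 0 ⌊Z⌋₊, (Real.log Z - Real.log d) / d) _).trans ?_
  linarith

/-- A convolution with an absolutely convergent factor preserves the bound `Y (1 + log Y)`. -/
theorem abs_sum_mul_le {h g : ArithmeticFunction ℝ} {C : ℝ}
    (hs : Summable fun n : ℕ => |h n| * (n : ℝ) ^ (-(3 / 4) : ℝ))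
    (hg : ∀ Z : ℝ, 1 ≤ Z → |∑ n ∈ Ioc 0 ⌊Z⌋₊, g n| ≤ C * (Z * (1 + Real.log Z)))
    {Y : ℝ} (hY : 1 ≤ Y) :
    |∑ n ∈ Ioc 0 ⌊Y⌋₊, (h * g) n| ≤
      C * (∑' n : ℕ, |h n| * (n : ℝ) ^ (-(3 / 4) : ℝ)) * (Y * (1 + Real.log Y)) := by
  have hl := Real.log_nonneg hY
  have hC : 0 ≤ C := by
    have := (abs_nonneg _).trans (hg 1 le_rfl)
    simpa using this
  rw [sum_Ioc_mul_eq_sum_sum]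
  calc |∑ d ∈ Ioc 0 ⌊Y⌋₊, h d * ∑ m ∈ Ioc 0 (⌊Y⌋₊ / d), g m|
      ≤ ∑ d ∈ Ioc 0 ⌊Y⌋₊, |h d * ∑ m ∈ Ioc 0 (⌊Y⌋₊ / d), g m| := abs_sum_le_sum_abs _ _
    _ ≤ ∑ d ∈ Ioc 0 ⌊Y⌋₊, C * (Y * (1 + Real.log Y)) * (|h d| * (d : ℝ) ^ (-(3 / 4) : ℝ)) := by
      refine sum_le_sum fun d hd => ?_
      obtain ⟨hd0, hd1⟩ := one_le_div_of_mem hY hd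
      have hd1' : (1 : ℝ) ≤ d := by exact_mod_cast (mem_Ioc.mp hd).1
      have := hg _ hd1
      rw [Nat.floor_div_natCast] at this
      rw [abs_mul]
      have e1 : Real.log (Y / d) ≤ Real.log Y := by
        apply Real.log_le_log (by linarith)
        exact div_le_self (by linarith) hd1'
      have e2 : Y / d ≤ Y * (d : ℝ) ^ (-(3 / 4) : ℝ) := by
        rw [div_eq_mul_inv, ← Real.rpow_neg_one]
        exact mul_le_mul_of_nonneg_left
          (Real.rpow_le_rpow_of_exponent_le hd1' (by norm_num)) (by linarith)
      have e3 : Y / d * (1 + Real.log (Y / d)) ≤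
          Y * (d : ℝ) ^ (-(3 / 4) : ℝ) * (1 + Real.log Y) := by
        apply mul_le_mul e2 (by linarith) _ (by positivity)
        linarith [Real.log_nonneg hd1]
      calc |h d| * |∑ m ∈ Ioc 0 (⌊Y⌋₊ / d), g m|
          ≤ |h d| * (C * (Y * (d : ℝ) ^ (-(3 / 4) : ℝ) * (1 + Real.log Y))) :=
            mul_le_mul_of_nonneg_left (this.trans (mul_le_mul_of_nonneg_left e3 hC))
              (abs_nonneg _)
        _ = _ := by ring
    _ = C * (Y * (1 + Real.log Y)) * ∑ d ∈ Ioc 0 ⌊Y⌋₊, (|h d| * (d : ℝ) ^ (-(3 / 4) : ℝ)) := by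
      rw [mul_sum]
    _ ≤ C * (Y * (1 + Real.log Y)) * ∑' n : ℕ, |h n| * (n : ℝ) ^ (-(3 / 4) : ℝ) := by
      refine mul_le_mul_of_nonneg_left (hs.sum_le_tsum _ fun n _ => by positivity) (by positivity)
    _ = _ := by ring

end ArithmeticFunction

namespace ArithmeticFunction

/-- The gap between the exponents `3/4` and 1 absorbs one logarithm. -/
theorem log_le_four_mul_rpow {d : ℝ} (hd : 1 ≤ d) :
    Real.log d / d ≤ 4 * d ^ (-(3 / 4) : ℝ) := by
  have h0 : 0 < d := by linarith
  have := Real.log_le_rpow_div h0.le (ε := 1 / 4) (by norm_num)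
  have e : d ^ (-(3 / 4) : ℝ) = d ^ (1 / 4 : ℝ) / d := by
    rw [eq_div_iff h0.ne']
    nth_rewrite 2 [← Real.rpow_one d]
    rw [← Real.rpow_add h0]
    norm_num
  rw [e, ← mul_div_assoc]
  apply div_le_div_of_nonneg_right _ h0.le
  linarith

theorem summable_div_of_rpow {h : ArithmeticFunction ℝ}
    (hs : Summable fun n : ℕ => |h n| * (n : ℝ) ^ (-(3 / 4) : ℝ)) :
    Summable fun n : ℕ => h n / n := by
  refine hs.of_norm_bounded fun n => ?_
  rw [Real.norm_eq_abs, abs_div, Nat.abs_cast]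
  rcases Nat.eq_zero_or_pos n with rfl | hn
  · simp
  rw [div_eq_mul_inv, ← Real.rpow_neg_one]
  exact mul_le_mul_of_nonneg_left
    (Real.rpow_le_rpow_of_exponent_le (by exact_mod_cast hn) (by norm_num)) (abs_nonneg _)

/-- Transfer of the asymptotic `Z (log Z) ^ 2 / 2` through an absolutely convergent factor. -/
theorem abs_sum_mul_sub_le {h g : ArithmeticFunction ℝ} {C : ℝ}
    (hs : Summable fun n : ℕ => |h n| * (n : ℝ) ^ (-(3 / 4) : ℝ))
    (hg : ∀ Z : ℝ, 1 ≤ Z → |∑ n ∈ Ioc 0 ⌊Z⌋₊, g n - Z * (Real.log Z) ^ 2 / 2|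
      ≤ C * (Z * (1 + Real.log Z))) {Y : ℝ} (hY : 1 ≤ Y) :
    |∑ n ∈ Ioc 0 ⌊Y⌋₊, (h * g) n - (∑' n : ℕ, h n / n) * (Y * (Real.log Y) ^ 2 / 2)| ≤
      (C + 6) * (∑' n : ℕ, |h n| * (n : ℝ) ^ (-(3 / 4) : ℝ)) * (Y * (1 + Real.log Y)) := by
  have hl := Real.log_nonneg hY
  have hC : 0 ≤ C := by
    have := (abs_nonneg _).trans (hg 1 le_rfl)
    simpa using this
  set L := Real.log Y with hL
  set M := Y * L ^ 2 / 2 with hM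
  -- The outer sum is extended by zero, so that it can be compared term by term with the infinite
  -- series for the main term.
  set G : ℕ → ℝ := fun d => if d ∈ Ioc 0 ⌊Y⌋₊ then
    h d * ∑ m ∈ Ioc 0 (⌊Y⌋₊ / d), g m else 0 with hG
  have hsumG : HasSum G (∑ n ∈ Ioc 0 ⌊Y⌋₊, (h * g) n) := by
    rw [sum_Ioc_mul_eq_sum_sum]
    have e := hasSum_sum_of_ne_finset_zero (L := SummationFilter.unconditional ℕ) (f := G) (s := Ioc 0 ⌊Y⌋₊)
      (fun d hd => if_neg hd)
    rwa [sum_congr rfl (fun d hd => (if_pos hd : G d = _))] at e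
  have hsumM : HasSum (fun n : ℕ => h n / n * M) ((∑' n : ℕ, h n / n) * M) :=
    (summable_div_of_rpow hs).hasSum.mul_right M
  have hdiff := hsumG.sub hsumM
  rw [← hdiff.tsum_eq, ← Real.norm_eq_abs]
  have hb : ∀ d : ℕ, ‖G d - h d / d * M‖ ≤
      (C + 6) * (Y * (1 + L)) * (|h d| * (d : ℝ) ^ (-(3 / 4) : ℝ)) := by
    intro d
    rw [Real.norm_eq_abs]
    rcases Nat.eq_zero_or_pos d with rfl | hdpos
    · simp [hG]
    have hd1' : (1 : ℝ) ≤ d := by exact_mod_cast hdpos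
    have hd0 : (0 : ℝ) < d := by linarith
    have hlog := log_le_four_mul_rpow hd1'
    set l := Real.log (d : ℝ) with hldef
    have hl0 : 0 ≤ l := Real.log_nonneg hd1'
    set r := (d : ℝ) ^ (-(3 / 4) : ℝ) with hr
    have hr0 : 0 ≤ r := by positivity
    have hrd : 1 / (d : ℝ) ≤ r := by
      rw [one_div, ← Real.rpow_neg_one]
      exact Real.rpow_le_rpow_of_exponent_le hd1' (by norm_num)
    have hYLr : 0 ≤ Y * L * r := by positivity
    by_cases hd : d ∈ Ioc 0 ⌊Y⌋₊
    · obtain ⟨-, hd1⟩ := one_le_div_of_mem hY hd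
      have hg' := hg _ hd1
      rw [Nat.floor_div_natCast, Real.log_div (by linarith) hd0.ne', ← hL, ← hldef] at hg'
      have hlL : l ≤ L := by
        have := Real.log_nonneg hd1
        rw [Real.log_div (by linarith) hd0.ne'] at this
        linarith
      have e1 : Y / d * (1 + (L - l)) ≤ Y * r * (1 + L) := by
        refine mul_le_mul ?_ (by linarith) (by linarith) (by positivity)
        rw [div_eq_mul_one_div]
        exact mul_le_mul_of_nonneg_left hrd (by linarith)
      -- Replacing `(L - l) ^ 2` by `L ^ 2` costs `l (2 L - l)`, and `l / d ≤ 4 r`.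
      have e2 : |Y / d * (L - l) ^ 2 / 2 - 1 / d * M| ≤ 6 * (Y * L * r) := by
        have e3 : Y / d * (L - l) ^ 2 / 2 - 1 / d * M = -(Y * (l / d) * (2 * L - l) / 2) := by
          rw [hM]; field_simp; ring
        have e4 : 0 ≤ l / d := by positivity
        rw [e3, abs_neg, abs_of_nonneg (by
          have : 0 ≤ 2 * L - l := by linarith
          positivity)]
        calc Y * (l / d) * (2 * L - l) / 2 ≤ Y * (4 * r) * (2 * L) / 2 := by
              gcongr <;> linarith
          _ ≤ 6 * (Y * L * r) := by linarith
      have e5 : G d - h d / d * M = h d * ((∑ m ∈ Ioc 0 (⌊Y⌋₊ / d), g m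
          - Y / d * (L - l) ^ 2 / 2) + (Y / d * (L - l) ^ 2 / 2 - 1 / d * M)) := by
        rw [hG]
        simp only [if_pos hd]
        ring
      rw [e5, abs_mul]
      calc |h d| * |(∑ m ∈ Ioc 0 (⌊Y⌋₊ / d), g m
          - Y / d * (L - l) ^ 2 / 2) + (Y / d * (L - l) ^ 2 / 2 - 1 / d * M)|
          ≤ |h d| * (C * (Y * r * (1 + L)) + 6 * (Y * L * r)) := by
            refine mul_le_mul_of_nonneg_left ?_ (abs_nonneg _)
            refine (abs_add_le _ _).trans (add_le_add (hg'.trans ?_) e2)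
            exact mul_le_mul_of_nonneg_left e1 hC
        _ ≤ |h d| * ((C + 6) * (Y * (1 + L)) * r) := by
            refine mul_le_mul_of_nonneg_left ?_ (abs_nonneg _)
            have : 0 ≤ Y * r := by positivity
            linarith
        _ = _ := by ring
    -- Beyond `Y` only the main term remains; there `L ≤ l`, so one factor `L` can be traded for
    -- `l`.
    · have hYd : Y < d := by
        rw [mem_Ioc, not_and, not_le] at hd
        exact (Nat.floor_lt (by linarith)).mp (hd hdpos)
      have hLl : L ≤ l := Real.log_le_log (by linarith) hYd.le
      have e1 : L ^ 2 / d ≤ L * (4 * r) := by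
        calc L ^ 2 / d = L * (L / d) := by ring
          _ ≤ L * (l / d) := by gcongr
          _ ≤ L * (4 * r) := by gcongr
      rw [hG]
      simp only [if_neg hd, zero_sub, abs_neg]
      have e2 : h d / d * M = h d * (Y / 2 * (L ^ 2 / d)) := by rw [hM]; ring
      rw [e2, abs_mul, abs_of_nonneg (by positivity : 0 ≤ Y / 2 * (L ^ 2 / d))]
      calc |h d| * (Y / 2 * (L ^ 2 / d)) ≤ |h d| * (Y / 2 * (L * (4 * r))) := by gcongr
        _ ≤ |h d| * ((C + 6) * (Y * (1 + L)) * r) := by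
          refine mul_le_mul_of_nonneg_left ?_ (abs_nonneg _)
          have h1 : 0 ≤ Y * r := by positivity
          have h2 : 0 ≤ C * (Y * (1 + L) * r) := by positivity
          linarith
        _ = _ := by ring
  refine (tsum_of_norm_bounded (hs.hasSum.mul_left _) hb).trans (le_of_eq ?_)
  ring

theorem isCompletelyMultiplicative_realZeta : IsCompletelyMultiplicative realZeta where
  map_one := by simp
  map_mul m n := by
    by_cases hm : m = 0 <;> by_cases hn : n = 0 <;> simp [natCoe_apply, zeta_apply, hm, hn]

theorem abs_realZeta_le (n : ℕ) : |realZeta n| ≤ 1 := by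
  by_cases hn : n = 0 <;> simp [natCoe_apply, zeta_apply, hn]

/-- The nontrivial character modulo `4` with real values. -/
noncomputable def chiFour : ArithmeticFunction ℝ :=
  ⟨fun n => ((ZMod.χ₄ (n : ZMod 4) : ℤ) : ℝ), by simp⟩

theorem chiFour_apply (n : ℕ) : chiFour n = ((ZMod.χ₄ (n : ZMod 4) : ℤ) : ℝ) := rfl

theorem isCompletelyMultiplicative_chiFour : IsCompletelyMultiplicative chiFour where
  map_one := by simp [chiFour_apply]
  map_mul m n := by
    rw [chiFour_apply, chiFour_apply, chiFour_apply, Nat.cast_mul, map_mul, Int.cast_mul]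

theorem abs_chiFour_le (n : ℕ) : |chiFour n| ≤ 1 := by
  rw [chiFour_apply, ZMod.χ₄_nat_eq_if_mod_four]
  split_ifs <;> simp

theorem abs_sum_chiFour_le (N : ℕ) : |∑ n ∈ Ioc 0 N, chiFour n| ≤ 1 := by
  have h : ∀ N : ℕ, ∑ n ∈ Ioc 0 N, chiFour n = if N % 4 = 1 ∨ N % 4 = 2 then 1 else 0 := by
    intro N
    induction N with
    | zero => simp
    | succ N ih =>
      rw [sum_Ioc_succ_top (Nat.zero_le N), ih, chiFour_apply, ZMod.χ₄_nat_eq_if_mod_four]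
      split_ifs <;> first | (exfalso; omega) | norm_num
  rw [h]
  split_ifs <;> simp

/-- One copy of `chiFour` is summed first, with partial sums bounded by 1; the remaining convolution
is dominated by the divisor function. -/
theorem abs_sum_chiFour_sq_mul_zeta_le {Z : ℝ} (hZ : 1 ≤ Z) :
    |∑ n ∈ Ioc 0 ⌊Z⌋₊, (chiFour * chiFour * realZeta) n| ≤ 1 * (Z * (1 + Real.log Z)) := by
  rw [show chiFour * chiFour * realZeta = (chiFour * realZeta) * chiFour by ring,
    sum_Ioc_mul_eq_sum_sum, one_mul]
  refine le_trans ?_ (sum_zeta_sq_le hZ)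
  refine (abs_sum_le_sum_abs _ _).trans (sum_le_sum fun d _ => ?_)
  rw [abs_mul]
  calc |(chiFour * realZeta) d| * |∑ m ∈ Ioc 0 (⌊Z⌋₊ / d), chiFour m|
      ≤ |(chiFour * realZeta) d| * 1 :=
        mul_le_mul_of_nonneg_left (abs_sum_chiFour_le _) (abs_nonneg _)
    _ = |(chiFour * realZeta) d| := mul_one _
    _ ≤ (realZeta * realZeta) d := by
      rw [mul_apply, mul_apply]
      refine (abs_sum_le_sum_abs _ _).trans (sum_le_sum fun x hx => ?_)
      have hx1 : x.1 ≠ 0 := by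
        have := Nat.mem_divisorsAntidiagonal.mp hx
        rintro h; simp [h] at this; omega
      have hz : 0 ≤ realZeta x.2 := by rw [natCoe_apply]; positivity
      rw [abs_mul, abs_of_nonneg hz]
      refine mul_le_mul_of_nonneg_right ?_ hz
      simpa [natCoe_apply, zeta_apply, hx1] using abs_chiFour_le x.1

/-- Sums of `tripleWeight` with two nontrivial characters are small. -/
theorem exists_abs_sum_tripleWeight_chi_le :
    ∃ C : ℝ, ∀ Y : ℝ, 1 ≤ Y →
      |∑ n ∈ Ioc 0 ⌊Y⌋₊, tripleWeight chiFour chiFour realZeta n| ≤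
        C * (Y * (1 + Real.log Y)) := by
  have hc := isCompletelyMultiplicative_chiFour
  have hz := isCompletelyMultiplicative_realZeta
  refine ⟨1 * (∑' n : ℕ, |tripleCorrection chiFour chiFour realZeta n| *
    (n : ℝ) ^ (-(3 / 4) : ℝ)), fun Y hY => ?_⟩
  rw [← tripleCorrection_mul hc hc hz]
  exact abs_sum_mul_le (summable_tripleCorrection hc hc hz abs_chiFour_le abs_chiFour_le
    abs_realZeta_le) (fun Z hZ => abs_sum_chiFour_sq_mul_zeta_le hZ) hY

theorem hasSum_mul_twistedMoebius {u g : ArithmeticFunction ℝ}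
    (hu : IsCompletelyMultiplicative u) {p : ℕ} (hp : p.Prime) {x G : ℝ}
    (hg : HasSum (fun k : ℕ => g (p ^ k) * x ^ k) G) :
    HasSum (fun k : ℕ => (g * twistedMoebius u) (p ^ k) * x ^ k) ((1 - u p * x) * G) := by
  have h1 : HasSum (fun k : ℕ => g (p ^ (k + 1)) * x ^ (k + 1)) (G - g 1) := by
    have := (hasSum_nat_add_iff' 1).mpr hg
    simpa using this
  have h2 := h1.sub (hg.mul_left (u p * x))
  have h3 := (hasSum_nat_add_iff (f := fun k : ℕ => (g * twistedMoebius u) (p ^ k) * x ^ k) 1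
    (g := G - g 1 - u p * x * G)).mp ?_
  · have h4 : (g * twistedMoebius u) 1 = g 1 := by
      simp [mul_apply, hu.isMultiplicative_twistedMoebius.map_one]
    simp only [range_one, sum_singleton, pow_zero, mul_one, h4] at h3
    convert! h3 using 1
    ring
  · convert! h2 using 2 with k
    rw [hu.mul_twistedMoebius_prime_pow g hp]
    ring

/-- Three convolutions with Möbius give `(1 - 1/p) ^ 3`. At 2 the weight contributes 1 in place of
`1 + 3/2`, which accounts for `2 / 5`. -/
theorem hasSum_tripleCorrection_zeta (p : Nat.Primes) :
    HasSum (fun k : ℕ => tripleCorrection realZeta realZeta realZeta ((p : ℕ) ^ k) *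
      (1 / (p : ℝ)) ^ k) (eulerFactor p * if (p : ℕ) = 2 then 2 / 5 else 1) := by
  obtain ⟨p, hp⟩ := p
  have hz := isCompletelyMultiplicative_realZeta
  have hzp : realZeta p = 1 := by simp [natCoe_apply, zeta_apply, hp.ne_zero]
  have h1 : HasSum (fun k : ℕ => tripleWeight realZeta realZeta realZeta (p ^ k) *
      (1 / (p : ℝ)) ^ k) (if p = 2 then 1 else 1 + 3 / p) := by
    have := hasSum_sum_of_ne_finset_zero (L := SummationFilter.unconditional ℕ) (f := fun k : ℕ =>
      tripleWeight realZeta realZeta realZeta (p ^ k) * (1 / (p : ℝ)) ^ k) (s := range 2) ?_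
    · convert! this using 1
      simp only [sum_range_succ, range_zero, sum_empty, zero_add, pow_zero, pow_one,
        (isMultiplicative_tripleWeight hz hz hz).map_one]
      rcases hp.eq_two_or_odd' with rfl | hodd
      · have := tripleWeight_two_pow (u := realZeta) (v := realZeta) (w := realZeta) 0
        rw [zero_add, pow_one] at this
        simp [this]
      · have hne : p ≠ 2 := by rintro rfl; exact absurd hodd (by decide)
        rw [if_neg hne, tripleWeight_prime hz hz hz hp hodd, hzp]
        ring
    · intro k hk
      rw [mem_range, not_lt] at hk
      obtain ⟨j, rfl⟩ := Nat.exists_eq_add_of_le' hk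
      rw [tripleWeight_prime_pow hp, zero_mul]
  have h2 := hasSum_mul_twistedMoebius hz hp (hasSum_mul_twistedMoebius hz hp
    (hasSum_mul_twistedMoebius hz hp h1))
  have e : (1 - realZeta p * (1 / (p : ℝ))) * ((1 - realZeta p * (1 / (p : ℝ))) *
      ((1 - realZeta p * (1 / (p : ℝ))) * if p = 2 then 1 else 1 + 3 / (p : ℝ)))
      = (1 - 1 / (p : ℝ)) ^ 3 * (1 + 3 / (p : ℝ)) * if p = 2 then 2 / 5 else 1 := by
    rw [hzp]
    split_ifs with h
    · subst h; norm_num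
    · ring
  rw [e] at h2
  exact h2

/-- This is the Euler product of the absolutely convergent correction series at 1; the factor `5 /
2` restores the prime 2. -/
theorem hasProd_eulerFactor : HasProd eulerFactor
    (5 / 2 * ∑' n : ℕ, tripleCorrection realZeta realZeta realZeta n / n) := by
  have hz := isCompletelyMultiplicative_realZeta
  have hm := isMultiplicative_tripleCorrection hz hz hz
  have hs := summable_div_of_rpow (summable_tripleCorrection hz hz hz abs_realZeta_le
    abs_realZeta_le abs_realZeta_le)
  set F : ℕ → ℝ := fun n => tripleCorrection realZeta realZeta realZeta n / n with hF
  have h1 := EulerProduct.eulerProduct_hasProd (f := F) (by simp [hF, hm.map_one])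
    (fun {m n} hmn => by
      simp only [hF]
      rw [hm.map_mul_of_coprime hmn]
      push_cast
      rw [mul_div_mul_comm]) hs.norm (by simp [hF])
  have h2 : ∀ p : Nat.Primes, ∑' e : ℕ, F ((p : ℕ) ^ e)
      = eulerFactor p * if (p : ℕ) = 2 then 2 / 5 else 1 := by
    intro p
    rw [← (hasSum_tripleCorrection_zeta p).tsum_eq]
    refine tsum_congr fun k => ?_
    simp only [hF]
    push_cast
    rw [one_div, inv_pow, div_eq_mul_inv]
  have h3 : HasProd (fun p : Nat.Primes => if (p : ℕ) = 2 then (5 / 2 : ℝ) else 1) (5 / 2) := by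
    have := hasProd_single (f := fun p : Nat.Primes => if (p : ℕ) = 2 then (5 / 2 : ℝ) else 1)
      ⟨2, Nat.prime_two⟩ (fun p hp => if_neg fun h => hp (Subtype.ext h))
    simpa using this
  have h4 := h3.mul h1
  convert! h4 using 2 with p
  rw [h2]
  split_ifs <;> ring

/-- The count of triples of odd coprime squarefree numbers. -/
theorem exists_abs_sum_tripleWeight_sub_le :
    ∃ C : ℝ, ∀ Y : ℝ, 1 ≤ Y →
      |∑ n ∈ Ioc 0 ⌊Y⌋₊, tripleWeight realZeta realZeta realZeta n -
        (∏' p : Nat.Primes, eulerFactor p) / 5 * (Y * (Real.log Y) ^ 2)| ≤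
        C * (Y * (1 + Real.log Y)) := by
  have hz := isCompletelyMultiplicative_realZeta
  refine ⟨(2 + 6) * (∑' n : ℕ, |tripleCorrection realZeta realZeta realZeta n| *
    (n : ℝ) ^ (-(3 / 4) : ℝ)), fun Y hY => ?_⟩
  have := abs_sum_mul_sub_le (summable_tripleCorrection hz hz hz abs_realZeta_le
    abs_realZeta_le abs_realZeta_le) (fun Z hZ => abs_sum_zeta_cube_sub_le hZ) hY
  rw [tripleCorrection_mul hz hz hz] at this
  -- Half of the correction series, the half coming from `Z (log Z) ^ 2 / 2`, is one fifth of the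
  -- Euler product.
  rw [hasProd_eulerFactor.tprod_eq]
  convert! this using 3
  ring

end ArithmeticFunction

/-! ### Counting triples by parity and residues modulo 4 -/

/-- The product of a triple. -/
def tripleProd (x : ℕ × ℕ × ℕ) : ℕ := x.1 * x.2.1 * x.2.2

open scoped Classical in
/-- The triples with squarefree product at most `N` satisfying `P`. -/
noncomputable def tripleSet (N : ℕ) (P : ℕ × ℕ × ℕ → Prop) : Finset (ℕ × ℕ × ℕ) :=
  (Ioc 0 N ×ˢ Ioc 0 N ×ˢ Ioc 0 N).filter fun x =>
    Squarefree (tripleProd x) ∧ tripleProd x ≤ N ∧ P x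

theorem pos_of_squarefree_tripleProd {x : ℕ × ℕ × ℕ} (h : Squarefree (tripleProd x)) :
    0 < x.1 ∧ 0 < x.2.1 ∧ 0 < x.2.2 := by
  have h0 := h.ne_zero
  simp only [tripleProd, ne_eq, mul_eq_zero, not_or] at h0
  omega

theorem mem_tripleSet {N : ℕ} {P : ℕ × ℕ × ℕ → Prop} {x : ℕ × ℕ × ℕ} :
    x ∈ tripleSet N P ↔ Squarefree (tripleProd x) ∧ tripleProd x ≤ N ∧ P x := by
  classical
  simp only [tripleSet, mem_filter]
  rw [and_iff_right_iff_imp]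
  rintro ⟨h1, h2, -⟩
  obtain ⟨p1, p2, p3⟩ := pos_of_squarefree_tripleProd h1
  simp only [mem_product, mem_Ioc]
  have e1 : x.1 ≤ tripleProd x := by
    rw [tripleProd, mul_assoc]; exact Nat.le_mul_of_pos_right _ (Nat.mul_pos p2 p3)
  have e2 : x.2.1 ≤ tripleProd x := by
    rw [tripleProd, mul_comm x.1, mul_assoc]
    exact Nat.le_mul_of_pos_right _ (Nat.mul_pos p1 p3)
  have e3 : x.2.2 ≤ tripleProd x := Nat.le_mul_of_pos_left _ (Nat.mul_pos p1 p2)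
  omega

namespace ArithmeticFunction

/-- Group the triples by their product `n`: for odd squarefree `n` the fibre is the set of all
ordered factorizations into three factors. -/
theorem sum_tripleSet_odd (u v w : ArithmeticFunction ℝ) (N : ℕ) :
    ∑ x ∈ tripleSet N (fun x => Odd (tripleProd x)), u x.1 * v x.2.1 * w x.2.2
      = ∑ n ∈ Ioc 0 N, tripleWeight u v w n := by
  rw [← sum_fiberwise_of_maps_to (g := tripleProd) (t := Ioc 0 N)]
  · refine sum_congr rfl fun n hn => ?_
    rw [mem_Ioc] at hn
    rw [tripleWeight, pmul_apply, oddSquarefree_apply]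
    split_ifs with h
    · rw [one_mul, mul_apply]
      simp_rw [mul_apply, sum_mul]
      rw [sum_sigma']
      refine sum_bij' (fun x _ => ⟨(x.1 * x.2.1, x.2.2), (x.1, x.2.1)⟩)
        (fun y _ => (y.2.1, y.2.2, y.1.2)) ?_ ?_ ?_ ?_ ?_
      · rintro ⟨a, b, c⟩ hx
        rw [mem_filter, mem_tripleSet] at hx
        obtain ⟨⟨hs, -, -⟩, hp⟩ := hx
        have hpos := pos_of_squarefree_tripleProd hs
        simp only [tripleProd] at hp hpos
        simp only [mem_sigma, Nat.mem_divisorsAntidiagonal]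
        exact ⟨⟨hp, hn.1.ne'⟩, trivial, (Nat.mul_pos hpos.1 hpos.2.1).ne'⟩
      · rintro ⟨⟨m, c⟩, ⟨a, b⟩⟩ hy
        simp only [mem_sigma, Nat.mem_divisorsAntidiagonal] at hy
        obtain ⟨⟨h1, -⟩, h2, -⟩ := hy
        have hp : tripleProd (a, b, c) = n := by rw [tripleProd, h2, h1]
        rw [mem_filter, mem_tripleSet, hp]
        exact ⟨⟨h.1, hn.2, h.2⟩, rfl⟩
      · rintro ⟨a, b, c⟩ _; rfl
      · rintro ⟨⟨m, c⟩, ⟨a, b⟩⟩ hy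
        simp only [mem_sigma, Nat.mem_divisorsAntidiagonal] at hy
        obtain ⟨-, rfl, -⟩ := hy
        rfl
      · rintro ⟨a, b, c⟩ _; rfl
    · rw [zero_mul, sum_eq_zero]
      intro x hx
      rw [mem_filter, mem_tripleSet] at hx
      exact absurd ⟨hx.2 ▸ hx.1.1, hx.2 ▸ hx.1.2.2⟩ h
  · intro x hx
    rw [mem_tripleSet] at hx
    rw [mem_Ioc]
    exact ⟨Nat.pos_of_ne_zero hx.1.ne_zero, hx.2.1⟩

end ArithmeticFunction

/-- Meant for ramification factors taking two values: each value only rescales the bound on the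
product, and `k m ≤ N` is exactly `m ≤ N / k` with natural division. -/
theorem card_tripleSet_odd_ite (N k l : ℕ) (hk : 0 < k) (hl : 0 < l)
    (P : ℕ × ℕ × ℕ → Prop) [DecidablePred P] :
    ((tripleSet N fun x => Odd (tripleProd x) ∧
        (if P x then k else l) * tripleProd x ≤ N).card : ℝ) =
      ∑ x ∈ tripleSet (N / k) (fun x => Odd (tripleProd x)), (if P x then 1 else 0 : ℝ) +
      ∑ x ∈ tripleSet (N / l) (fun x => Odd (tripleProd x)), (1 - if P x then 1 else 0 : ℝ) := by
  have e1 : ∀ M : ℕ, ∑ x ∈ tripleSet M (fun x => Odd (tripleProd x)), (if P x then 1 else 0 : ℝ)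
      = (((tripleSet M (fun x => Odd (tripleProd x))).filter P).card : ℝ) := by
    intro M; simp
  have e2 : ∀ M : ℕ, ∑ x ∈ tripleSet M (fun x => Odd (tripleProd x)),
      (1 - if P x then 1 else 0 : ℝ)
      = (((tripleSet M (fun x => Odd (tripleProd x))).filter (fun x => ¬ P x)).card : ℝ) := by
    intro M
    rw [card_filter]
    push_cast
    refine sum_congr rfl fun x _ => ?_
    by_cases h : P x <;> simp [h]
  rw [e1, e2, ← Nat.cast_add, ← card_union_of_disjoint]
  · congr 2
    ext x
    simp only [mem_union, mem_filter, mem_tripleSet, Nat.le_div_iff_mul_le hk,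
      Nat.le_div_iff_mul_le hl]
    have h1 : tripleProd x ≤ k * tripleProd x := Nat.le_mul_of_pos_left _ hk
    have h2 : tripleProd x ≤ l * tripleProd x := Nat.le_mul_of_pos_left _ hl
    rw [mul_comm (tripleProd x) k, mul_comm (tripleProd x) l]
    by_cases h : P x
    · simp only [h, if_true, not_true_eq_false, and_false, or_false, and_true]
      constructor
      · rintro ⟨a, -, b, c⟩; exact ⟨a, c, b⟩
      · rintro ⟨a, c, b⟩; exact ⟨a, h1.trans c, b, c⟩
    · simp only [h, if_false, not_false_eq_true, and_false, false_or, and_true]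
      constructor
      · rintro ⟨a, -, b, c⟩; exact ⟨a, c, b⟩
      · rintro ⟨a, c, b⟩; exact ⟨a, h2.trans c, b, c⟩
  · rw [disjoint_left]
    intro x h1 h2
    rw [mem_filter] at h1 h2
    exact h2.2 h1.2

/-- The ramification factor of the triple `(s α, t β, γ)`. -/
def signedRamFactor (s t : ℤ) (x : ℕ × ℕ × ℕ) : ℕ := ramFactor (s * x.1) (t * x.2.1) x.2.2

theorem odd_tripleProd_iff {x : ℕ × ℕ × ℕ} :
    Odd (tripleProd x) ↔ Odd x.1 ∧ Odd x.2.1 ∧ Odd x.2.2 := by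
  rw [tripleProd, Nat.odd_mul, Nat.odd_mul, and_assoc]

theorem zmod_four_of_odd {n : ℕ} (h : Odd n) : (n : ZMod 4) = 1 ∨ (n : ZMod 4) = 3 := by
  rcases Nat.odd_mod_four_iff.mp (Nat.odd_iff.mp h) with e | e
  · left
    have := (ZMod.natCast_eq_natCast_iff' n 1 4).mpr e
    simpa using this
  · right
    have := (ZMod.natCast_eq_natCast_iff' n 3 4).mpr e
    simpa using this

section SignedRamFactor

variable {s t : ℤ} (hs : s = 1 ∨ s = -1) (ht : t = 1 ∨ t = -1)

include hs ht

theorem signedRamFactor_odd {x : ℕ × ℕ × ℕ} (hx : Odd (tripleProd x)) :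
    signedRamFactor s t x = if (s * x.1 : ZMod 4) = t * x.2.1 ∧ (t * x.2.1 : ZMod 4) = x.2.2
      then 1 else 4 := by
  obtain ⟨h1, h2, h3⟩ := odd_tripleProd_iff.mp hx
  have h1 := zmod_four_of_odd h1
  have h2 := zmod_four_of_odd h2
  have h3 := zmod_four_of_odd h3
  rw [signedRamFactor]
  generalize (x.1 : ZMod 4) = a at *
  generalize (x.2.1 : ZMod 4) = b at *
  generalize (x.2.2 : ZMod 4) = c at *
  clear hx
  rcases hs with rfl | rfl <;> rcases ht with rfl | rfl <;> rcases h1 with rfl | rfl <;>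
    rcases h2 with rfl | rfl <;> rcases h3 with rfl | rfl <;> decide

/-- The extra factor 2 comes from the even entry, so that the height is measured against the odd
product. Only the two odd entries decide between 8 and 16. -/
theorem signedRamFactor_even_fst {x : ℕ × ℕ × ℕ} (hx : Odd (tripleProd x)) :
    2 * signedRamFactor s t (2 * x.1, x.2.1, x.2.2)
      = if (t * x.2.1 : ZMod 4) = x.2.2 then 8 else 16 := by
  obtain ⟨h1, h2, h3⟩ := odd_tripleProd_iff.mp hx
  have h1 := zmod_four_of_odd h1
  have h2 := zmod_four_of_odd h2
  have h3 := zmod_four_of_odd h3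
  rw [signedRamFactor]
  push_cast
  generalize (x.1 : ZMod 4) = a at *
  generalize (x.2.1 : ZMod 4) = b at *
  generalize (x.2.2 : ZMod 4) = c at *
  clear hx
  rcases hs with rfl | rfl <;> rcases ht with rfl | rfl <;> rcases h1 with rfl | rfl <;>
    rcases h2 with rfl | rfl <;> rcases h3 with rfl | rfl <;> decide

theorem signedRamFactor_even_snd {x : ℕ × ℕ × ℕ} (hx : Odd (tripleProd x)) :
    2 * signedRamFactor s t (x.1, 2 * x.2.1, x.2.2)
      = if (s * x.1 : ZMod 4) = x.2.2 then 8 else 16 := by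
  obtain ⟨h1, h2, h3⟩ := odd_tripleProd_iff.mp hx
  have h1 := zmod_four_of_odd h1
  have h2 := zmod_four_of_odd h2
  have h3 := zmod_four_of_odd h3
  rw [signedRamFactor]
  push_cast
  generalize (x.1 : ZMod 4) = a at *
  generalize (x.2.1 : ZMod 4) = b at *
  generalize (x.2.2 : ZMod 4) = c at *
  clear hx
  rcases hs with rfl | rfl <;> rcases ht with rfl | rfl <;> rcases h1 with rfl | rfl <;>
    rcases h2 with rfl | rfl <;> rcases h3 with rfl | rfl <;> decide

theorem signedRamFactor_even_trd {x : ℕ × ℕ × ℕ} (hx : Odd (tripleProd x)) :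
    2 * signedRamFactor s t (x.1, x.2.1, 2 * x.2.2)
      = if (s * x.1 : ZMod 4) = t * x.2.1 then 8 else 16 := by
  obtain ⟨h1, h2, h3⟩ := odd_tripleProd_iff.mp hx
  have h1 := zmod_four_of_odd h1
  have h2 := zmod_four_of_odd h2
  have h3 := zmod_four_of_odd h3
  rw [signedRamFactor]
  push_cast
  generalize (x.1 : ZMod 4) = a at *
  generalize (x.2.1 : ZMod 4) = b at *
  generalize (x.2.2 : ZMod 4) = c at *
  clear hx
  rcases hs with rfl | rfl <;> rcases ht with rfl | rfl <;> rcases h1 with rfl | rfl <;>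
    rcases h2 with rfl | rfl <;> rcases h3 with rfl | rfl <;> decide

end SignedRamFactor

section Indicators

open ArithmeticFunction

theorem chiFour_eq_of_odd {n : ℕ} (h : Odd n) :
    (n : ZMod 4) = 1 ∧ chiFour n = 1 ∨ (n : ZMod 4) = 3 ∧ chiFour n = -1 := by
  rw [chiFour_apply]
  rcases zmod_four_of_odd h with e | e <;> rw [e]
  · left; simp
  · right
    refine ⟨rfl, ?_⟩
    have : ZMod.χ₄ 3 = -1 := by decide
    rw [this]; simp

/-- Orthogonality modulo 4: since `χ₄(-1) = -1`, the signed residues agree exactly when `s t χ₄(m)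
χ₄(n) = 1`. -/
theorem ite_zmod_four_pair {s t : ℤ} (hs : s = 1 ∨ s = -1) (ht : t = 1 ∨ t = -1) {m n : ℕ}
    (hm : Odd m) (hn : Odd n) : (if (s * m : ZMod 4) = t * n then 1 else 0 : ℝ)
      = (1 + s * t * (chiFour m * chiFour n)) / 2 := by
  have d1 : ¬ ((1 : ZMod 4) = -1) := by decide
  have d2 : ¬ ((1 : ZMod 4) = 3) := by decide
  have d3 : ((1 : ZMod 4) = -3) ↔ True := by decide
  have d4 : ((-1 : ZMod 4) = 3) ↔ True := by decide
  have d5 : ¬ ((3 : ZMod 4) = 1) := by decide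
  have d6 : ((3 : ZMod 4) = -1) ↔ True := by decide
  have d7 : ¬ ((-3 : ZMod 4) = -1) := by decide
  have d8 : ¬ ((-1 : ZMod 4) = 1) := by decide
  have d9 : ¬ ((-1 : ZMod 4) = -3) := by decide
  have d10 : ¬ ((3 : ZMod 4) = -3) := by decide
  have d11 : ¬ ((-3 : ZMod 4) = 3) := by decide
  have d12 : ((-3 : ZMod 4) = 1) ↔ True := by decide
  rcases hs with rfl | rfl <;> rcases ht with rfl | rfl <;>
    rcases chiFour_eq_of_odd hm with ⟨e1, e2⟩ | ⟨e1, e2⟩ <;>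
    rcases chiFour_eq_of_odd hn with ⟨f1, f2⟩ | ⟨f1, f2⟩ <;>
    rw [e1, e2, f1, f2] <;>
    simp only [Int.cast_one, Int.cast_neg, one_mul, neg_mul, mul_one, mul_neg, neg_neg, d1, d2, d3,
      d4, d5, d6, d7, d8, d9, d10, d11, d12, if_true, if_false] <;> norm_num

theorem ite_zmod_four_triple {s t : ℤ} (hs : s = 1 ∨ s = -1) (ht : t = 1 ∨ t = -1) {l m n : ℕ}
    (hl : Odd l) (hm : Odd m) (hn : Odd n) :
    (if (s * l : ZMod 4) = t * m ∧ (t * m : ZMod 4) = n then 1 else 0 : ℝ)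
      = (1 + t * (chiFour m * chiFour n) + s * (chiFour l * chiFour n)
        + s * t * (chiFour l * chiFour m)) / 4 := by
  have e1 := ite_zmod_four_pair hs ht hl hm
  have e2 := ite_zmod_four_pair ht (Or.inl rfl) hm hn
  have e3 : (if (s * l : ZMod 4) = t * m ∧ (t * m : ZMod 4) = n then 1 else 0 : ℝ)
      = (if (s * l : ZMod 4) = t * m then 1 else 0)
        * (if (t * m : ZMod 4) = (1 : ℤ) * n then 1 else 0) := by
    rw [Int.cast_one, one_mul, ite_and]
    split_ifs <;> simp
  rw [e3, e1, e2]
  -- In the product of the two pair indicators, the cross term simplifies because the sign and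
  -- character of the middle entry occur squared.
  have ht2 : (t : ℝ) ^ 2 = 1 := by rcases ht with rfl | rfl <;> norm_num
  have hm2 : chiFour m ^ 2 = 1 := by
    rcases chiFour_eq_of_odd hm with ⟨-, e⟩ | ⟨-, e⟩ <;> rw [e] <;> norm_num
  push_cast
  linear_combination (s * chiFour l * chiFour m ^ 2 * chiFour n / 4) * ht2
    + (s * chiFour l * chiFour n / 4) * hm2

end Indicators

open ArithmeticFunction

theorem signedRamFactor_pos (s t : ℤ) (x : ℕ × ℕ × ℕ) : 0 < signedRamFactor s t x :=
  ramFactor_pos _ _ _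

theorem squarefree_two_mul_iff {n : ℕ} : Squarefree (2 * n) ↔ Squarefree n ∧ Odd n := by
  rw [← Nat.coprime_two_left]
  constructor
  · intro h
    have hc := Nat.coprime_of_squarefree_mul h
    exact ⟨((Nat.squarefree_mul hc).mp h).2, hc⟩
  · rintro ⟨h, hc⟩
    exact (Nat.squarefree_mul hc).mpr ⟨Nat.prime_two.prime.squarefree, h⟩

/-- Here `φ` doubles one entry. A number `2 n` is squarefree exactly when `n` is odd and squarefree,
so triples with that entry even correspond to odd triples. -/
theorem card_tripleSet_doubled {φ : ℕ × ℕ × ℕ → ℕ × ℕ × ℕ} (hφ : Function.Injective φ)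
    (hprod : ∀ x, tripleProd (φ x) = 2 * tripleProd x) {E : ℕ × ℕ × ℕ → Prop}
    (hE : ∀ y, E y ↔ ∃ x, φ x = y) {R : ℕ × ℕ × ℕ → ℕ} (hR : ∀ x, 0 < R x) (N : ℕ) :
    (tripleSet N fun y => E y ∧ R y * tripleProd y ≤ N).card
      = (tripleSet N fun x => Odd (tripleProd x) ∧ (2 * R (φ x)) * tripleProd x ≤ N).card := by
  symm
  refine card_bij (fun x _ => φ x) ?_ (fun x _ y _ h => hφ h) ?_
  · intro x hx
    rw [mem_tripleSet] at hx ⊢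
    obtain ⟨h1, h2, h3, h4⟩ := hx
    have e : R (φ x) * tripleProd (φ x) = 2 * R (φ x) * tripleProd x := by rw [hprod]; ring
    have h5 : tripleProd (φ x) ≤ R (φ x) * tripleProd (φ x) :=
      Nat.le_mul_of_pos_left _ (hR _)
    refine ⟨?_, h5.trans (e ▸ h4), (hE _).mpr ⟨x, rfl⟩, e ▸ h4⟩
    rw [hprod]
    exact squarefree_two_mul_iff.mpr ⟨h1, h3⟩
  · intro y hy
    rw [mem_tripleSet] at hy
    obtain ⟨h1, h2, h3, h4⟩ := hy
    obtain ⟨x, rfl⟩ := (hE y).mp h3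
    have e : R (φ x) * tripleProd (φ x) = 2 * R (φ x) * tripleProd x := by rw [hprod]; ring
    rw [hprod] at h1 h2
    obtain ⟨h5, h6⟩ := squarefree_two_mul_iff.mp h1
    refine ⟨x, mem_tripleSet.mpr ⟨h5, by omega, h6, e ▸ h4⟩, rfl⟩

/-- A squarefree product allows at most one even entry. -/
theorem card_tripleSet_eq_parity (N : ℕ) (P : ℕ × ℕ × ℕ → Prop) :
    (tripleSet N P).card = (tripleSet N fun x => Odd (tripleProd x) ∧ P x).card
      + (tripleSet N fun x => Even x.1 ∧ P x).card + (tripleSet N fun x => Even x.2.1 ∧ P x).card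
      + (tripleSet N fun x => Even x.2.2 ∧ P x).card := by
  classical
  have key : ∀ A : ℕ × ℕ × ℕ → Prop, (tripleSet N fun x => A x ∧ P x).card
      = ∑ x ∈ tripleSet N P, if A x then 1 else 0 := by
    intro A
    rw [← card_filter]
    congr 1
    ext x
    simp only [mem_filter, mem_tripleSet]
    tauto
  rw [key, key, key, key, ← sum_add_distrib, ← sum_add_distrib, ← sum_add_distrib,
    card_eq_sum_ones]
  refine sum_congr rfl fun x hx => ?_
  have hs := (mem_tripleSet.mp hx).1
  have hne : ∀ {a b c : ℕ}, Squarefree (a * b * c) → ¬ (Even a ∧ Even b) := by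
    rintro a b c h ⟨⟨i, hi⟩, ⟨j, hj⟩⟩
    have := h 2 ⟨i * j * c, by rw [hi, hj]; ring⟩
    exact absurd this (by decide)
  have h12 := hne hs
  have h13 := hne (a := x.1) (b := x.2.2) (c := x.2.1) (by
    rw [tripleProd] at hs; rwa [mul_right_comm] at hs)
  have h23 := hne (a := x.2.1) (b := x.2.2) (c := x.1) (by
    rw [tripleProd, mul_assoc] at hs; rwa [mul_comm] at hs)
  rw [odd_tripleProd_iff, ← Nat.not_even_iff_odd, ← Nat.not_even_iff_odd, ← Nat.not_even_iff_odd]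
  by_cases h1 : Even x.1 <;> by_cases h2 : Even x.2.1 <;> by_cases h3 : Even x.2.2 <;>
    simp [h1, h2, h3] at h12 h13 h23 ⊢

/-- The number of triples of odd numbers with squarefree product at most `N`. -/
noncomputable def mainSum (N : ℕ) : ℝ :=
  ∑ n ∈ Ioc 0 N, tripleWeight realZeta realZeta realZeta n

/-- The number of such triples weighted by the nontrivial character of two of the factors. -/
noncomputable def twistedSum (N : ℕ) : ℝ :=
  ∑ n ∈ Ioc 0 N, tripleWeight chiFour chiFour realZeta n

theorem sum_odd_one (N : ℕ) :
    ∑ _x ∈ tripleSet N (fun x => Odd (tripleProd x)), (1 : ℝ) = mainSum N := by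
  rw [mainSum, ← sum_tripleSet_odd]
  refine sum_congr rfl fun x hx => ?_
  obtain ⟨h1, h2, h3⟩ := pos_of_squarefree_tripleProd (mem_tripleSet.mp hx).1
  simp [natCoe_apply, zeta_apply, h1.ne', h2.ne', h3.ne']

theorem sum_odd_chi_fst_snd (N : ℕ) :
    ∑ x ∈ tripleSet N (fun x => Odd (tripleProd x)), chiFour x.1 * chiFour x.2.1
      = twistedSum N := by
  rw [twistedSum, ← sum_tripleSet_odd]
  refine sum_congr rfl fun x hx => ?_
  obtain ⟨h1, h2, h3⟩ := pos_of_squarefree_tripleProd (mem_tripleSet.mp hx).1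
  simp [natCoe_apply, zeta_apply, h3.ne']

theorem sum_odd_chi_fst_trd (N : ℕ) :
    ∑ x ∈ tripleSet N (fun x => Odd (tripleProd x)), chiFour x.1 * chiFour x.2.2
      = twistedSum N := by
  have e : tripleWeight chiFour chiFour realZeta = tripleWeight chiFour realZeta chiFour := by
    rw [tripleWeight, tripleWeight, mul_right_comm]
  rw [twistedSum, e, ← sum_tripleSet_odd]
  refine sum_congr rfl fun x hx => ?_
  obtain ⟨h1, h2, h3⟩ := pos_of_squarefree_tripleProd (mem_tripleSet.mp hx).1
  simp [natCoe_apply, zeta_apply, h2.ne']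

theorem sum_odd_chi_snd_trd (N : ℕ) :
    ∑ x ∈ tripleSet N (fun x => Odd (tripleProd x)), chiFour x.2.1 * chiFour x.2.2
      = twistedSum N := by
  have e : tripleWeight chiFour chiFour realZeta = tripleWeight realZeta chiFour chiFour := by
    rw [tripleWeight, tripleWeight, mul_comm, ← mul_assoc]
  rw [twistedSum, e, ← sum_tripleSet_odd]
  refine sum_congr rfl fun x hx => ?_
  obtain ⟨h1, h2, h3⟩ := pos_of_squarefree_tripleProd (mem_tripleSet.mp hx).1
  simp [natCoe_apply, zeta_apply, h1.ne']

theorem tripleSet_congr {N : ℕ} {P Q : ℕ × ℕ × ℕ → Prop}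
    (h : ∀ x, P x ↔ Q x) : tripleSet N P = tripleSet N Q := by
  ext x
  simp only [mem_tripleSet, h]

/-- The triples `(α, β, γ)` such that `(s α, t β, γ)` has height at most `N`. -/
noncomputable def signedSet (s t : ℤ) (N : ℕ) : Finset (ℕ × ℕ × ℕ) :=
  tripleSet N fun x => signedRamFactor s t x * tripleProd x ≤ N

section

variable {s t : ℤ} (hs : s = 1 ∨ s = -1) (ht : t = 1 ∨ t = -1)

include hs ht

/-- The factor is 1 when the three signed residues agree, which has density `1/4`, and 4 otherwise.
-/
theorem card_signedSet_odd (N : ℕ) :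
    ((tripleSet N fun x => Odd (tripleProd x) ∧
        signedRamFactor s t x * tripleProd x ≤ N).card : ℝ)
      = (mainSum N + (t + s + s * t) * twistedSum N) / 4
        + (3 * mainSum (N / 4) - (t + s + s * t) * twistedSum (N / 4)) / 4 := by
  have e1 := card_tripleSet_odd_ite N 1 4 one_pos four_pos fun x =>
    (s * x.1 : ZMod 4) = t * x.2.1 ∧ (t * x.2.1 : ZMod 4) = x.2.2
  have e2 : (tripleSet N fun x => Odd (tripleProd x) ∧
      signedRamFactor s t x * tripleProd x ≤ N) = tripleSet N fun x => Odd (tripleProd x) ∧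
      (if (s * x.1 : ZMod 4) = t * x.2.1 ∧ (t * x.2.1 : ZMod 4) = x.2.2 then 1 else 4)
        * tripleProd x ≤ N :=
    tripleSet_congr fun x => and_congr_right fun hx => by rw [signedRamFactor_odd hs ht hx]
  have e3 : ∀ M : ℕ, ∑ x ∈ tripleSet M (fun x => Odd (tripleProd x)),
      (if (s * x.1 : ZMod 4) = t * x.2.1 ∧ (t * x.2.1 : ZMod 4) = x.2.2 then 1 else 0 : ℝ)
      = (mainSum M + (t + s + s * t) * twistedSum M) / 4 := by
    intro M
    have : ∑ x ∈ tripleSet M (fun x => Odd (tripleProd x)),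
      (if (s * x.1 : ZMod 4) = t * x.2.1 ∧ (t * x.2.1 : ZMod 4) = x.2.2 then 1 else 0 : ℝ)
      = ∑ x ∈ tripleSet M (fun x => Odd (tripleProd x)), ((1 + t * (chiFour x.2.1 * chiFour x.2.2)
        + s * (chiFour x.1 * chiFour x.2.2) + s * t * (chiFour x.1 * chiFour x.2.1)) / 4) := by
      refine sum_congr rfl fun x hx => ?_
      obtain ⟨h1, h2, h3⟩ := odd_tripleProd_iff.mp (mem_tripleSet.mp hx).2.2
      exact ite_zmod_four_triple hs ht h1 h2 h3
    rw [this, ← sum_div, sum_add_distrib, sum_add_distrib, sum_add_distrib, ← mul_sum, ← mul_sum,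
      ← mul_sum, sum_odd_one, sum_odd_chi_fst_snd, sum_odd_chi_fst_trd, sum_odd_chi_snd_trd]
    ring
  rw [e2, e1, sum_sub_distrib, e3, e3, sum_odd_one, Nat.div_one]
  ring

omit hs ht in
theorem card_signedSet_even {φ : ℕ × ℕ × ℕ → ℕ × ℕ × ℕ} (hφ : Function.Injective φ)
    (hprod : ∀ x, tripleProd (φ x) = 2 * tripleProd x) {E : ℕ × ℕ × ℕ → Prop}
    (hE : ∀ y, E y ↔ ∃ x, φ x = y) {P : ℕ × ℕ × ℕ → Prop} [DecidablePred P]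
    (hP : ∀ x, Odd (tripleProd x) → 2 * signedRamFactor s t (φ x) = if P x then 8 else 16)
    {ε : ℝ} {f : ℕ × ℕ × ℕ → ℝ} (hf : ∀ x, Odd (tripleProd x) →
      (if P x then 1 else 0 : ℝ) = (1 + ε * f x) / 2)
    (hsum : ∀ M, ∑ x ∈ tripleSet M (fun x => Odd (tripleProd x)), f x = twistedSum M) (N : ℕ) :
    ((tripleSet N fun x => E x ∧ signedRamFactor s t x * tripleProd x ≤ N).card : ℝ)
      = (mainSum (N / 8) + ε * twistedSum (N / 8)) / 2
        + (mainSum (N / 16) - ε * twistedSum (N / 16)) / 2 := by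
  rw [card_tripleSet_doubled hφ hprod hE (signedRamFactor_pos s t)]
  have e1 := card_tripleSet_odd_ite N 8 16 (by norm_num) (by norm_num) P
  have e2 : (tripleSet N fun x => Odd (tripleProd x) ∧
      2 * signedRamFactor s t (φ x) * tripleProd x ≤ N) = tripleSet N fun x =>
      Odd (tripleProd x) ∧ (if P x then 8 else 16) * tripleProd x ≤ N :=
    tripleSet_congr fun x => and_congr_right fun hx => by rw [hP x hx]
  have e3 : ∀ M : ℕ, ∑ x ∈ tripleSet M (fun x => Odd (tripleProd x)),
      (if P x then 1 else 0 : ℝ) = (mainSum M + ε * twistedSum M) / 2 := by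
    intro M
    rw [sum_congr rfl fun x hx => hf x (mem_tripleSet.mp hx).2.2, ← sum_div, sum_add_distrib,
      ← mul_sum, sum_odd_one, hsum]
  rw [e2, e1, sum_sub_distrib, e3, e3, sum_odd_one]
  ring

/-- The 6 over 4 comes from three positions of the even entry, each with density `1/2` at the
thresholds `N / 8` and `N / 16`. The signs enter only through the twisted sums, so the main term is
the same for all sign patterns. -/
theorem card_signedSet (N : ℕ) : ((signedSet s t N).card : ℝ) =
    (mainSum N + 3 * mainSum (N / 4) + 6 * mainSum (N / 8) + 6 * mainSum (N / 16)) / 4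
      + (t + s + s * t) * (twistedSum N - twistedSum (N / 4) + 2 * twistedSum (N / 8)
        - 2 * twistedSum (N / 16)) / 4 := by
  rw [signedSet, card_tripleSet_eq_parity]
  have ev : ∀ n : ℕ, Even n ↔ ∃ m, 2 * m = n := fun n => by
    rw [even_iff_exists_two_mul]; exact exists_congr fun m => eq_comm
  have a1 := card_signedSet_even (s := s) (t := t) (φ := fun x => (2 * x.1, x.2.1, x.2.2))
    (E := fun x => Even x.1) (P := fun x => (t * x.2.1 : ZMod 4) = x.2.2)
    (ε := t) (f := fun x => chiFour x.2.1 * chiFour x.2.2)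
    (fun x y h => by simpa [Prod.ext_iff] using h) (fun x => by simp only [tripleProd]; ring)
    (fun y => by simp [ev, Prod.ext_iff]) (fun x hx => signedRamFactor_even_fst hs ht hx)
    (fun x hx => by
      obtain ⟨h1, h2, h3⟩ := odd_tripleProd_iff.mp hx
      simpa using ite_zmod_four_pair ht (Or.inl rfl) h2 h3) sum_odd_chi_snd_trd N
  have a2 := card_signedSet_even (s := s) (t := t) (φ := fun x => (x.1, 2 * x.2.1, x.2.2))
    (E := fun x => Even x.2.1) (P := fun x => (s * x.1 : ZMod 4) = x.2.2)
    (ε := s) (f := fun x => chiFour x.1 * chiFour x.2.2)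
    (fun x y h => by simpa [Prod.ext_iff] using h) (fun x => by simp only [tripleProd]; ring)
    (fun y => by simp [ev, Prod.ext_iff]) (fun x hx => signedRamFactor_even_snd hs ht hx)
    (fun x hx => by
      obtain ⟨h1, h2, h3⟩ := odd_tripleProd_iff.mp hx
      simpa using ite_zmod_four_pair hs (Or.inl rfl) h1 h3) sum_odd_chi_fst_trd N
  have a3 := card_signedSet_even (s := s) (t := t) (φ := fun x => (x.1, x.2.1, 2 * x.2.2))
    (E := fun x => Even x.2.2) (P := fun x => (s * x.1 : ZMod 4) = t * x.2.1)
    (ε := s * t) (f := fun x => chiFour x.1 * chiFour x.2.1)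
    (fun x y h => by simpa [Prod.ext_iff] using h) (fun x => by simp only [tripleProd]; ring)
    (fun y => by simp [ev, Prod.ext_iff]) (fun x hx => signedRamFactor_even_trd hs ht hx)
    (fun x hx => by
      obtain ⟨h1, h2, h3⟩ := odd_tripleProd_iff.mp hx
      exact ite_zmod_four_pair hs ht h1 h2) sum_odd_chi_fst_snd N
  push_cast
  rw [card_signedSet_odd hs ht, a1, a2, a3]
  ring

end

/-! ### Sign patterns, degenerate triples and the final asymptotics -/

/-- The signs of `a` and `b` in the triples attached to fields of sign `σ`. -/
def FieldSign.patterns : FieldSign → Finset (ℤ × ℤ)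
  | .plus => {(1, 1)}
  | .minus => {(1, -1), (-1, 1), (-1, -1)}

theorem FieldSign.sign_of_mem_patterns {σ : FieldSign} {p : ℤ × ℤ} (hp : p ∈ σ.patterns) :
    (p.1 = 1 ∨ p.1 = -1) ∧ (p.2 = 1 ∨ p.2 = -1) := by
  cases σ <;> simp [FieldSign.patterns] at hp <;> aesop

theorem FieldSign.mem_patterns_iff {σ : FieldSign} {s t : ℤ} (hs : s = 1 ∨ s = -1)
    (ht : t = 1 ∨ t = -1) {a b c : ℤ} (ha : 0 < s * a) (hb : 0 < t * b) :
    (s, t) ∈ σ.patterns ↔ σ.HoldsTriple (a, b, c) := by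
  cases σ <;> simp only [FieldSign.patterns, FieldSign.HoldsTriple] <;>
    rcases hs with rfl | rfl <;> rcases ht with rfl | rfl <;> simp <;> omega

/-- The condition that the three quadratic subfields are nontrivial. -/
def NonDegenerate (s t : ℤ) (x : ℕ × ℕ × ℕ) : Prop :=
  t * x.2.1 * x.2.2 ≠ 1 ∧ s * x.1 * x.2.2 ≠ 1 ∧ s * x.1 * (t * x.2.1) ≠ 1

instance (s t : ℤ) : DecidablePred (NonDegenerate s t) := fun _ =>
  inferInstanceAs (Decidable (_ ∧ _ ∧ _))

theorem natAbs_sign_mul {s : ℤ} (hs : s = 1 ∨ s = -1) (n : ℤ) : (s * n).natAbs = n.natAbs := by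
  rcases hs with rfl | rfl <;> simp

theorem natAbs_signed {s t : ℤ} (hs : s = 1 ∨ s = -1) (ht : t = 1 ∨ t = -1) (x : ℕ × ℕ × ℕ) :
    (s * x.1 * (t * x.2.1) * x.2.2).natAbs = tripleProd x := by
  rw [Int.natAbs_mul, Int.natAbs_mul, natAbs_sign_mul hs, natAbs_sign_mul ht]
  rfl

theorem tripleHeight_signed {s t : ℤ} (hs : s = 1 ∨ s = -1) (ht : t = 1 ∨ t = -1)
    (x : ℕ × ℕ × ℕ) :
    tripleHeight (s * x.1, t * x.2.1, x.2.2) = signedRamFactor s t x * tripleProd x := by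
  rw [tripleHeight, natAbs_signed hs ht, signedRamFactor]
  push_cast
  rfl

/-- Separate `a` and `b` into sign and absolute value; `c` is positive already. Heights are natural
numbers, so bounding the square by `X` means bounding the height by `⌊√X⌋`. -/
theorem ncard_biquadTriples (σ : FieldSign) {X : ℝ} (hX : 0 ≤ X) :
    (biquadTriples σ X).ncard =
      ∑ p ∈ σ.patterns, ((signedSet p.1 p.2 ⌊√X⌋₊).filter (NonDegenerate p.1 p.2)).card := by
  rw [← card_sigma, ← Set.ncard_coe_finset]
  have hht : ∀ n : ℕ, n ≤ ⌊√X⌋₊ ↔ (n : ℝ) ^ 2 ≤ X := fun n => by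
    rw [Nat.le_floor_iff (Real.sqrt_nonneg X), Real.le_sqrt (Nat.cast_nonneg n) hX]
  symm
  refine Set.ncard_congr (fun y _ => (y.1.1 * y.2.1, y.1.2 * y.2.2.1, y.2.2.2)) ?_ ?_ ?_
  · rintro ⟨⟨s, t⟩, x⟩ hy
    rw [mem_coe, mem_sigma, mem_filter, signedSet, mem_tripleSet] at hy
    obtain ⟨hp, ⟨h1, h2, h3⟩, h4, h5, h6⟩ := hy
    obtain ⟨hs, ht⟩ := FieldSign.sign_of_mem_patterns hp
    simp only at hs ht h3 h4 h5 h6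
    obtain ⟨p1, p2, p3⟩ := pos_of_squarefree_tripleProd h1
    refine ⟨⟨Int.natCast_pos.mpr p3, ?_, h4, h5, h6⟩, ?_, ?_⟩
    · rw [← Int.squarefree_natAbs, natAbs_signed hs ht]
      exact h1
    · refine (FieldSign.mem_patterns_iff hs ht ?_ ?_).mp hp
      · rcases hs with rfl | rfl <;> simpa using p1
      · rcases ht with rfl | rfl <;> simpa using p2
    · rw [tripleHeight_signed hs ht]
      exact (hht _).mp h3
  · rintro ⟨⟨s, t⟩, α, β, γ⟩ ⟨⟨s', t'⟩, α', β', γ'⟩ hy hy' h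
    rw [mem_coe, mem_sigma, mem_filter, signedSet, mem_tripleSet] at hy hy'
    obtain ⟨p1, p2, -⟩ := pos_of_squarefree_tripleProd hy.2.1.1
    obtain ⟨p1', p2', -⟩ := pos_of_squarefree_tripleProd hy'.2.1.1
    obtain ⟨hs, ht⟩ := FieldSign.sign_of_mem_patterns hy.1
    obtain ⟨hs', ht'⟩ := FieldSign.sign_of_mem_patterns hy'.1
    simp only [Prod.mk.injEq] at *
    obtain ⟨h1, h2, h3⟩ := h
    have key : ∀ {s s' : ℤ} {m n : ℕ}, (s = 1 ∨ s = -1) → (s' = 1 ∨ s' = -1) → 0 < m → 0 < n →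
        s * m = s' * n → s = s' ∧ m = n := by
      rintro s s' m n (rfl | rfl) (rfl | rfl) hm hn h <;> omega
    obtain ⟨rfl, rfl⟩ := key hs hs' p1 p1' h1
    obtain ⟨rfl, rfl⟩ := key ht ht' p2 p2' h2
    obtain rfl : γ = γ' := by exact_mod_cast h3
    rfl
  · rintro ⟨a, b, c⟩ ⟨⟨hc, hsq, hx, hy, hz⟩, hσ, hH⟩
    simp only at hc hsq hx hy hz
    have hc0 : c ≠ 0 := hc.ne'
    have hab : Squarefree (a * b) := hsq.squarefree_of_dvd ⟨c, rfl⟩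
    have ha0 : a ≠ 0 := by rintro rfl; simp at hab
    have hb0 : b ≠ 0 := by rintro rfl; simp at hab
    have sgn : ∀ n : ℤ, n ≠ 0 → n.sign = 1 ∨ n.sign = -1 := fun n hn => by
      rcases lt_or_gt_of_ne hn with h | h
      · right; exact Int.sign_eq_neg_one_of_neg h
      · left; exact Int.sign_eq_one_of_pos h
    have pos : ∀ n : ℤ, n ≠ 0 → 0 < n.sign * n := fun n hn => by
      rw [Int.sign_mul_self_eq_abs]; exact abs_pos.mpr hn
    have ea : a.sign * (a.natAbs : ℤ) = a := Int.sign_mul_natAbs a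
    have eb : b.sign * (b.natAbs : ℤ) = b := Int.sign_mul_natAbs b
    have ec : (c.natAbs : ℤ) = c := Int.natAbs_of_nonneg hc.le
    have hhs := tripleHeight_signed (sgn a ha0) (sgn b hb0) (a.natAbs, b.natAbs, c.natAbs)
    have hpr := natAbs_signed (sgn a ha0) (sgn b hb0) (a.natAbs, b.natAbs, c.natAbs)
    simp only [ea, eb, ec] at hhs hpr
    refine ⟨⟨(a.sign, b.sign), (a.natAbs, b.natAbs, c.natAbs)⟩, ?_, ?_⟩
    · rw [mem_coe, mem_sigma, mem_filter, signedSet, mem_tripleSet]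
      refine ⟨(FieldSign.mem_patterns_iff (sgn a ha0) (sgn b hb0) (pos a ha0) (pos b hb0)).mpr hσ,
        ⟨?_, ?_, ?_⟩, ?_, ?_, ?_⟩
      · rw [← hpr, Int.squarefree_natAbs]; exact hsq
      · rw [← hht] at hH
        rw [hhs] at hH
        exact (Nat.le_mul_of_pos_left _ (signedRamFactor_pos _ _ _)).trans hH
      · simp only
        rw [← hhs, hht]
        exact hH
      · simp only [eb, ec]; exact hx
      · simp only [ea, ec]; exact hy
      · simp only [ea, eb]; exact hz
    · simp only [ea, eb, ec]

/-- A degenerate triple has two entries equal to 1, and the third is at most `N`; such triples fall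
into the error term. -/
theorem card_signedSet_filter (s t : ℤ) (hs : s = 1 ∨ s = -1) (ht : t = 1 ∨ t = -1) (N : ℕ) :
    (signedSet s t N).card ≤ ((signedSet s t N).filter (NonDegenerate s t)).card + 3 * N := by
  rw [← card_filter_add_card_filter_not (NonDegenerate s t)]
  refine Nat.add_le_add_left ?_ _
  have hsub : (signedSet s t N).filter (fun x => ¬ NonDegenerate s t x) ⊆
      (Ioc 0 N).image (fun n => (n, 1, 1)) ∪ ((Ioc 0 N).image (fun n => (1, n, 1)) ∪
        (Ioc 0 N).image (fun n => (1, 1, n))) := by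
    rintro ⟨α, β, γ⟩ hx
    rw [mem_filter, signedSet, mem_tripleSet, NonDegenerate] at hx
    obtain ⟨⟨h1, h2, -⟩, h3⟩ := hx
    obtain ⟨p1, p2, p3⟩ := pos_of_squarefree_tripleProd h1
    simp only [tripleProd] at h2 h3 p1 p2 p3
    have hz : t * β * γ = 1 ∨ s * α * γ = 1 ∨ s * α * (t * β) = 1 := by tauto
    have key : ∀ {m n : ℕ} {k : ℤ}, k.natAbs = m * n → k = 1 → m = 1 ∧ n = 1 := by
      rintro m n k h rfl
      exact mul_eq_one.mp h.symm
    simp only [mem_union, mem_image, mem_Ioc, Prod.mk.injEq]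
    rcases hz with hz | hz | hz
    · obtain ⟨rfl, rfl⟩ := key (m := β) (n := γ) (by
        rw [Int.natAbs_mul, natAbs_sign_mul ht]; rfl) hz
      exact Or.inl ⟨α, ⟨p1, by simpa using h2⟩, rfl, rfl, rfl⟩
    · obtain ⟨rfl, rfl⟩ := key (m := α) (n := γ) (by
        rw [Int.natAbs_mul, natAbs_sign_mul hs]; rfl) hz
      exact Or.inr (Or.inl ⟨β, ⟨p2, by simpa using h2⟩, rfl, rfl, rfl⟩)
    · obtain ⟨rfl, rfl⟩ := key (m := α) (n := β) (by
        rw [Int.natAbs_mul, natAbs_sign_mul hs, natAbs_sign_mul ht]; rfl) hz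
      exact Or.inr (Or.inr ⟨γ, ⟨p3, by simpa using h2⟩, rfl, rfl, rfl⟩)
  have hc : ∀ f : ℕ → ℕ × ℕ × ℕ, ((Ioc 0 N).image f).card ≤ N := fun f =>
    card_image_le.trans (by simp)
  refine (card_le_card hsub).trans ((card_union_le _ _).trans ?_)
  have := card_union_le ((Ioc 0 N).image (fun n => ((1, n, 1) : ℕ × ℕ × ℕ)))
    ((Ioc 0 N).image (fun n => ((1, 1, n) : ℕ × ℕ × ℕ)))
  have h1 := hc fun n => (n, 1, 1)
  have h2 := hc fun n => (1, n, 1)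
  have h3 := hc fun n => (1, 1, n)
  omega

/-- The asymptotics of `mainSum` at `Y / r`, with the logarithm taken at `Y`. -/
theorem exists_abs_mainSum_div_sub_le : ∃ C : ℝ, ∀ Y : ℝ, 1 ≤ Y → ∀ r : ℕ, 1 ≤ r → r ≤ 16 →
    |mainSum (⌊Y⌋₊ / r) - (∏' p : Nat.Primes, eulerFactor p) / 5 * (Y / r * (Real.log Y) ^ 2)| ≤
      C * (Y * (1 + Real.log Y)) := by
  obtain ⟨C, hC⟩ := exists_abs_sum_tripleWeight_sub_le
  set κ := (∏' p : Nat.Primes, eulerFactor p) / 5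
  have hC0 : 0 ≤ C := by
    have := (abs_nonneg _).trans (hC 1 le_rfl)
    simpa using this
  refine ⟨C + 6 * |κ|, fun Y hY r hr1 hr16 => ?_⟩
  have hr1' : (1 : ℝ) ≤ r := by exact_mod_cast hr1
  have hr0 : (0 : ℝ) < r := by linarith
  have hr16' : (r : ℝ) ≤ 16 := by exact_mod_cast hr16
  have hL := Real.log_nonneg hY
  have hlr0 := Real.log_nonneg hr1'
  have hlr : Real.log r ≤ 3 := by
    refine (Real.log_le_log hr0 hr16').trans ?_
    rw [show (16 : ℝ) = 2 ^ 4 by norm_num, Real.log_pow]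
    have := Real.log_two_lt_d9
    push_cast
    linarith
  have hYr : Y / r ≤ Y := div_le_self (by linarith) hr1'
  have hYr0 : 0 ≤ Y / r := by positivity
  have hκ := abs_nonneg κ
  rw [← Nat.floor_div_natCast]
  by_cases h : 1 ≤ Y / r
  · have h1 := hC _ h
    have hlog : Real.log (Y / r) = Real.log Y - Real.log r :=
      Real.log_div (by linarith) hr0.ne'
    have hlog0 := Real.log_nonneg h
    rw [hlog] at h1 hlog0
    set L := Real.log Y
    set l := Real.log r
    have e1 : |κ * (Y / r * (L - l) ^ 2) - κ * (Y / r * L ^ 2)| ≤ 6 * |κ| * (Y * (1 + L)) := by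
      have e : κ * (Y / r * (L - l) ^ 2) - κ * (Y / r * L ^ 2)
          = -(κ * (Y / r * (l * (2 * L - l)))) := by ring
      have h2 : 0 ≤ l * (2 * L - l) := mul_nonneg hlr0 (by linarith)
      rw [e, abs_neg, abs_mul, abs_of_nonneg (mul_nonneg hYr0 h2)]
      have h3 : l * (2 * L - l) ≤ 6 * (1 + L) := by nlinarith
      calc |κ| * (Y / r * (l * (2 * L - l))) ≤ |κ| * (Y * (6 * (1 + L))) := by gcongr
        _ = _ := by ring
    have e2 : C * (Y / r * (1 + (L - l))) ≤ C * (Y * (1 + L)) := by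
      gcongr
      linarith
    have := abs_sub_le (mainSum ⌊Y / r⌋₊) (κ * (Y / r * (L - l) ^ 2)) (κ * (Y / r * L ^ 2))
    have h4 : |mainSum ⌊Y / r⌋₊ - κ * (Y / r * (L - l) ^ 2)| ≤ C * (Y / r * (1 + (L - l))) := h1
    linarith
  -- For `Y < r` the sum is empty, and `log Y ≤ log 16 < 3` puts the would-be main term inside the
  -- error.
  · rw [not_le] at h
    rw [Nat.floor_eq_zero.mpr h]
    have hY16 : Y < r := by rwa [div_lt_one hr0] at h
    have hL3 : Real.log Y ≤ 3 := (Real.log_le_log (by linarith) hY16.le).trans hlr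
    have e0 : mainSum 0 = 0 := by simp [mainSum]
    rw [e0, zero_sub, abs_neg, abs_mul, abs_of_nonneg (by positivity : 0 ≤ Y / r * Real.log Y ^ 2)]
    set L := Real.log Y
    have h3 : L ^ 2 ≤ 6 * (1 + L) := by nlinarith
    have h4 : 0 ≤ C * (Y * (1 + L)) := by positivity
    calc |κ| * (Y / r * L ^ 2) ≤ |κ| * (Y * (6 * (1 + L))) := by gcongr
      _ ≤ _ := by linarith

theorem exists_abs_twistedSum_div_le : ∃ C : ℝ, ∀ Y : ℝ, 1 ≤ Y → ∀ r : ℕ, 1 ≤ r →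
    |twistedSum (⌊Y⌋₊ / r)| ≤ C * (Y * (1 + Real.log Y)) := by
  obtain ⟨C, hC⟩ := exists_abs_sum_tripleWeight_chi_le
  have hC0 : 0 ≤ C := by
    have := (abs_nonneg _).trans (hC 1 le_rfl)
    simpa using this
  refine ⟨C, fun Y hY r hr1 => ?_⟩
  have hr1' : (1 : ℝ) ≤ r := by exact_mod_cast hr1
  have hL := Real.log_nonneg hY
  have hYr : Y / r ≤ Y := div_le_self (by linarith) hr1'
  rw [← Nat.floor_div_natCast]
  by_cases h : 1 ≤ Y / r
  · refine (hC _ h).trans ?_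
    have := Real.log_le_log (by linarith) hYr
    have := Real.log_nonneg h
    gcongr
  · rw [not_le] at h
    rw [Nat.floor_eq_zero.mpr h]
    have e0 : twistedSum 0 = 0 := by simp [twistedSum]
    rw [e0, abs_zero]
    positivity

/-- The count of triples with a fixed sign pattern. -/
theorem exists_abs_card_signedSet_sub_le : ∃ C : ℝ, ∀ s t : ℤ, (s = 1 ∨ s = -1) →
    (t = 1 ∨ t = -1) → ∀ Y : ℝ, 1 ≤ Y →
    |(((signedSet s t ⌊Y⌋₊).filter (NonDegenerate s t)).card : ℝ) -
      23 / 160 * (∏' p : Nat.Primes, eulerFactor p) * (Y * (Real.log Y) ^ 2)| ≤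
      C * (Y * (1 + Real.log Y)) := by
  obtain ⟨C, hC⟩ := exists_abs_mainSum_div_sub_le
  obtain ⟨D, hD⟩ := exists_abs_twistedSum_div_le
  -- The main sums contribute `(1 + 3 + 6 + 6) C / 4`, the twisted sums at most `3 (1 + 1 + 2 + 2) D
  -- / 4 ≤ 5 D`, and the degenerate triples 3.
  refine ⟨4 * C + 5 * D + 3, fun s t hs ht Y hY => ?_⟩
  have hcard := card_signedSet hs ht ⌊Y⌋₊
  have hle : ((signedSet s t ⌊Y⌋₊).card : ℝ)
      ≤ ((signedSet s t ⌊Y⌋₊).filter (NonDegenerate s t)).card + 3 * ⌊Y⌋₊ := by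
    exact_mod_cast card_signedSet_filter s t hs ht ⌊Y⌋₊
  have hge : (((signedSet s t ⌊Y⌋₊).filter (NonDegenerate s t)).card : ℝ)
      ≤ (signedSet s t ⌊Y⌋₊).card := by
    exact_mod_cast card_filter_le _ _
  have hfl : (⌊Y⌋₊ : ℝ) ≤ Y := Nat.floor_le (by linarith)
  have hL := Real.log_nonneg hY
  have hYL : Y ≤ Y * (1 + Real.log Y) := by nlinarith
  have m1 := abs_le.mp (hC Y hY 1 (by norm_num) (by norm_num))
  have m4 := abs_le.mp (hC Y hY 4 (by norm_num) (by norm_num))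
  have m8 := abs_le.mp (hC Y hY 8 (by norm_num) (by norm_num))
  have m16 := abs_le.mp (hC Y hY 16 (by norm_num) (by norm_num))
  have d1 := abs_le.mp (hD Y hY 1 (by norm_num))
  have d4 := abs_le.mp (hD Y hY 4 (by norm_num))
  have d8 := abs_le.mp (hD Y hY 8 (by norm_num))
  have d16 := abs_le.mp (hD Y hY 16 (by norm_num))
  rw [Nat.div_one] at m1 d1
  have hε : (t + s + s * t : ℝ) = 3 ∨ (t + s + s * t : ℝ) = -1 := by
    rcases hs with rfl | rfl <;> rcases ht with rfl | rfl <;> norm_num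
  set P := ∏' p : Nat.Primes, eulerFactor p
  set E := Y * (1 + Real.log Y)
  set W := Y * Real.log Y ^ 2 with hW
  have w1 : Y / (1 : ℕ) * Real.log Y ^ 2 = W := by rw [hW]; push_cast; ring
  have w4 : Y / (4 : ℕ) * Real.log Y ^ 2 = W / 4 := by rw [hW]; push_cast; ring
  have w8 : Y / (8 : ℕ) * Real.log Y ^ 2 = W / 8 := by rw [hW]; push_cast; ring
  have w16 : Y / (16 : ℕ) * Real.log Y ^ 2 = W / 16 := by rw [hW]; push_cast; ring
  rw [w1] at m1
  rw [w4] at m4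
  rw [w8] at m8
  rw [w16] at m16
  rw [abs_le]
  rcases hε with hε | hε <;> rw [hε] at hcard <;> constructor <;> linarith

theorem FieldSign.card_patterns (σ : FieldSign) : (σ.patterns.card : ℝ) = 4 * σ.c := by
  cases σ
  · simp [FieldSign.patterns, FieldSign.c]
  · have : FieldSign.minus.patterns.card = 3 := by decide
    rw [this, FieldSign.c]; norm_num

theorem mainTheorem2 :
    Multipliable eulerFactor ∧
    ∀ σ : FieldSign,
      (∀ X : ℝ, (biquadraticFields σ X).Finite) ∧
      ∃ C : ℝ, ∀ X : ℝ, 2 ≤ X →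
        |(biquadraticCount σ X : ℝ) -
            23 * σ.c / 960 * Real.sqrt X * (Real.log X) ^ 2 * ∏' p : Nat.Primes, eulerFactor p|
          ≤ C * (Real.sqrt X * Real.log X) := by
  refine ⟨hasProd_eulerFactor.multipliable, fun σ =>
    ⟨fun X => (biquadraticFields_finite_and_count σ X).1, ?_⟩⟩
  obtain ⟨C, hC⟩ := exists_abs_card_signedSet_sub_le
  have hC0 : 0 ≤ C := by
    have := (abs_nonneg _).trans (hC 1 1 (Or.inl rfl) (Or.inl rfl) 1 le_rfl)
    simpa using this
  refine ⟨2 * C, fun X hX => ?_⟩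
  have hcount := (biquadraticFields_finite_and_count σ X).2
  rw [ncard_biquadTriples σ (by linarith)] at hcount
  have hY : 1 ≤ √X := Real.one_le_sqrt.mpr (by linarith)
  have hlogY : Real.log (√X) = Real.log X / 2 := Real.log_sqrt (by linarith)
  set P := ∏' p : Nat.Primes, eulerFactor p
  have hsum : |∑ p ∈ σ.patterns, ((((signedSet p.1 p.2 ⌊√X⌋₊).filter
      (NonDegenerate p.1 p.2)).card : ℝ) - 23 / 160 * P * (√X * (Real.log (√X)) ^ 2))| ≤
      ∑ _p ∈ σ.patterns, C * (√X * (1 + Real.log (√X))) :=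
    (abs_sum_le_sum_abs _ _).trans (sum_le_sum fun p hp =>
      hC p.1 p.2 (FieldSign.sign_of_mem_patterns hp).1 (FieldSign.sign_of_mem_patterns hp).2 _ hY)
  have hcount' : ∑ p ∈ σ.patterns, (((signedSet p.1 p.2 ⌊√X⌋₊).filter
      (NonDegenerate p.1 p.2)).card : ℝ) = 6 * biquadraticCount σ X := by exact_mod_cast hcount
  rw [sum_sub_distrib, sum_const, sum_const, nsmul_eq_mul, nsmul_eq_mul, σ.card_patterns,
    hcount', hlogY] at hsum
  have hc : 0 ≤ σ.c ∧ σ.c ≤ 1 := by cases σ <;> norm_num [FieldSign.c]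
  -- Here `X ≥ 2` matters: it gives `1 + log X / 2 ≤ 3 log X`, so the additive 1 disappears from the
  -- error term.
  have hlogX : 1 / 2 ≤ Real.log X := by
    have h1 := Real.log_le_log two_pos hX
    have := Real.log_two_gt_d9
    linarith
  -- The constants match because `4 · (23 / 160) · (1 / 4) = 6 · (23 / 960)`, the last quarter
  -- coming from `(log √X) ^ 2`.
  have e : 6 * ((biquadraticCount σ X : ℝ) -
      23 * σ.c / 960 * √X * (Real.log X) ^ 2 * P) = 6 * (biquadraticCount σ X : ℝ) -
      4 * σ.c * (23 / 160 * P * (√X * (Real.log X / 2) ^ 2)) := by ring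
  rw [← e, abs_mul, abs_of_pos (by norm_num : (0 : ℝ) < 6)] at hsum
  have hb : 4 * σ.c * (C * (√X * (1 + Real.log X / 2))) ≤ 6 * (2 * C * (√X * Real.log X)) := by
    have h1 : 0 ≤ C * (√X * (1 + Real.log X / 2)) := by positivity
    have h2 : C * (√X * (1 + Real.log X / 2)) ≤ C * (√X * (3 * Real.log X)) := by
      gcongr
      linarith
    calc 4 * σ.c * (C * (√X * (1 + Real.log X / 2)))
        ≤ 4 * 1 * (C * (√X * (1 + Real.log X / 2))) := by gcongr; exact hc.2
      _ ≤ 4 * (C * (√X * (3 * Real.log X))) := by linarith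
      _ = _ := by ring
  linarith
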